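/- Let $k$ be an algebraically closed field of characteristic $0$ and let $\mathcal C$ be a premodular (i.e. ribbon fusion) category over $k$, with braiding $c_{A,B}\colon A\otimes B\to B\otimes A$. Write $\mathrm{ev}_X\colon X^*\otimes X\to\mathbf 1$, $\mathrm{coev}_X\colon\mathbf 1\to X\otimes X^*$ for the duality maps and $\widetilde{\mathrm{ev}}_X\colon X\otimes X^*\to\mathbf 1$ for the evaluation given by the ribbon structure. Let $X_j$ ($j\in J$) represent the isomorphism classes of simple objects, let $d_j=\dim X_j\in k$, fix square roots $\sqrt{d_j}$, and assume $\mathcal D=\sum_j d_j^2\neq 0$. Associativity isomorphisms are suppressed; composites are described as successive steps, read from source to target. A half-braiding on $X$ is a natural isomorphism $\lambda_A\colon A\otimes X\to X\otimes A$ with $\lambda_{A\otimes B}=(\lambda_A\otimes\mathrm{id}_B)(\mathrm{id}_A\otimes\lambda_B)$. The elliptic Drinfeld center $\mathcal Z^{\mathrm{el}}(\mathcal C)$ has as objects the triples $(X,\lambda^1,\lambda^2)$, where $\lambda^1,\lambda^2$ are half-braidings on $X$ such that for all $A,B$ $$(\mathrm{id}_X\otimes c_{A,B})(\lambda^1_A\otimes\mathrm{id}_B)(\mathrm{id}_A\otimes\lambda^2_B)=(\lambda^2_B\otimes\mathrm{id}_A)(\mathrm{id}_B\otimes\lambda^1_A)(c_{B,A}^{-1}\otimes\mathrm{id}_X)\qquad(\mathrm{COMM}),$$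 and as morphisms the morphisms of $\mathcal C$ that intertwine both half-braidings. For half-braidings $\lambda$ on $X$ and $\mu$ on $Y$ let $Q_{\lambda,\mu}=\mathcal D^{-1}\sum_j d_j\,L_j\in\mathrm{End}(X\otimes Y)$, where $L_j$ is the composite $$XY\to X_jX_j^*XY\to X_jXX_j^*Y\to XX_jX_j^*Y\to XX_jYX_j^*\to XYX_jX_j^*\to XY$$ of $\mathrm{coev}_{X_j}$, $\lambda_{X_j^*}$, $c_{X,X_j}^{-1}$, $c_{X_j^*,Y}$, $\mu_{X_j}$ and $\widetilde{\mathrm{ev}}_{X_j}$. **Statement.** (a) $Q_{\lambda,\mu}$ is idempotent for all half-braidings $\lambda,\mu$, so it has an image: an object $X\,{}_{\lambda}\!\otimes_{\mu}Y$ with maps $\iota$ into and $\pi$ from $X\otimes Y$ such that $\pi\iota=\mathrm{id}$ and $\iota\pi=Q_{\lambda,\mu}$. (b) For every choice of such images for the pairs of first half-braidings of pairs of objects, and for every nonzero scalar $\kappa\in k$, the following data are well defined and make $\mathcal Z^{\mathrm{el}}(\mathcal C)$ a monoidal category. * *Tensor product of objects:* $(X,\lambda^1,\lambda^2)\otimes(Y,\mu^1,\mu^2)=(X\,{}_{\lambda^1}\!\otimes_{\mu^1}Y,\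 \lambda^1\bar\otimes\mu^1,\ \lambda^2\otimes\mu^2)$. Here both half-braidings are obtained from maps $AXY\to XYA$ by composing with $\iota$ and $\pi$: for $\lambda^2\otimes\mu^2$ one applies $\lambda^2_A$ and then $\mu^2_A$; for $\lambda^1\bar\otimes\mu^1$ one applies $\lambda^1_A$ and then $c_{A,Y}$ or, with the same result, $c_{X,A}^{-1}$ and then $\mu^1_A$. * *Tensor product of morphisms:* $\pi\,(f\otimes g)\,\iota$. * *Associator:* the associator of $\mathcal C$, composed with the inclusions $\iota$ of the iterated images on its source side and the projections $\pi$ onto those on its target side. * *Unit object:* $\mathcal I_1(\mathbf 1,\mathrm{id})=(\bigoplus_jX_j\otimes X_j^*,\Gamma,\Omega)$. The component of $\Gamma_A$ from $A X_iX_i^*$ to $X_jX_j^*A$ is $\sqrt{d_i}\sqrt{d_j}\sum_\alpha\varphi_\alpha\otimes\varphi^\alpha$, where $(\varphi_\alpha)$, $(\varphi^\alpha)$ are bases of $\mathrm{Hom}(A\otimes X_i,X_j)$ and $\mathrm{Hom}(X_i^*,X_j^*\otimes A)$ dual for the pairing $\langle\varphi,\psi\rangle=\mathrm{tr}_A\big((\widetilde{\mathrm{ev}}_{X_j}\otimes\mathrm{id}_A)(\varphi\otimes\psi)(\mathrm{id}_A\otimes\mathrm{coev}_{X_i})\big)$.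 On $AX_jX_j^*$, $\Omega_A$ is $c_{A,X_j}$ followed by $c_{X_j^*,A}^{-1}$. * *Left unit constraint at $(Y,\mu^1,\mu^2)$:* $\kappa\sum_j\sqrt{d_j}\,\big(X_jX_j^*Y\to X_jYX_j^*\to YX_jX_j^*\to Y\big)$, given by $c_{X_j^*,Y}$, $\mu^1_{X_j}$, $\widetilde{\mathrm{ev}}_{X_j}$, precomposed with $\iota$. * *Right unit constraint at $(Y,\mu^1,\mu^2)$:* $\kappa\sum_j\sqrt{d_j}\,\big(YX_jX_j^*\to X_jYX_j^*\to YX_jX_j^*\to Y\big)$, given by $c_{Y,X_j}$, $\mu^1_{X_j}$, $\widetilde{\mathrm{ev}}_{X_j}$, precomposed with $\iota$. -/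

import Mathlib

open CategoryTheory MonoidalCategory Limits

universe w x v u

noncomputable section

namespace EllipticCenter

attribute [local instance] Abelian.hasFiniteBiproducts

/-! ### Premodular categories

`Xᘁ` is the dual written `X^*` in the text: `ε_ X Xᘁ : Xᘁ ⊗ X ⟶ 𝟙_ C` is the evaluation and
`η_ X Xᘁ : 𝟙_ C ⟶ X ⊗ Xᘁ` the coevaluation; `β_ A B : A ⊗ B ≅ B ⊗ A` is the braiding `c_{A,B}`.
(A braided category with these duals is rigid on both sides.) -/

/-- A ribbon structure on a braided rigid category: a natural twist `θ` with
`θ_{X ⊗ Y} = c_{Y,X} c_{X,Y} (θ_X ⊗ θ_Y)` and `(θ_X)^* = θ_{X^*}`. -/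
class RibbonCategory (C : Type u) [Category.{v} C] [MonoidalCategory C] [BraidedCategory C]
    [RightRigidCategory C] where
  twist : ∀ X : C, X ≅ X
  twist_naturality : ∀ {X Y : C} (f : X ⟶ Y), f ≫ (twist Y).hom = (twist X).hom ≫ f
  twist_tensor : ∀ X Y : C, (twist (X ⊗ Y)).hom =
    ((twist X).hom ⊗ₘ (twist Y).hom) ≫ (β_ X Y).hom ≫ (β_ Y X).hom
  twist_dual : ∀ X : C, rightAdjointMate (twist X).hom = (twist (Xᘁ)).hom

/-- The finiteness and semisimplicity conditions in the definition of a fusion category over `k`;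
linearity, bilinearity of the tensor product and rigidity are the other type classes. -/
class IsFusion (k : Type w) [Field k] (C : Type u) [Category.{v} C] [Abelian C] [Linear k C]
    [MonoidalCategory C] : Prop where
  finiteDimensional_hom : ∀ X Y : C, FiniteDimensional k (X ⟶ Y)
  simple_unit : Simple (𝟙_ C)
  semisimple : ∀ X : C, ∃ (n : ℕ) (S : Fin n → C), (∀ i, Simple (S i)) ∧ Nonempty (X ≅ ⨁ S)
  finite_simples : ∃ (n : ℕ) (S : Fin n → C), ∀ X : C, Simple X → ∃ i, Nonempty (X ≅ S i)

/-- Representatives `X_j`, `j ∈ J`, of the isomorphism classes of simple objects. -/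
structure SimpleReps (C : Type u) [Category.{v} C] [HasZeroMorphisms C] (J : Type x) where
  obj : J → C
  simple : ∀ j, Simple (obj j)
  exhaustive : ∀ X : C, Simple X → ∃ j, Nonempty (X ≅ obj j)
  injective : ∀ i j, Nonempty (obj i ≅ obj j) → i = j

section Elliptic

variable {C : Type u} [Category.{v} C] [MonoidalCategory C]

/-- The half-braiding as a map `λ_A : A ⊗ X ⟶ X ⊗ A`. (Mathlib's `HalfBraiding` records the
inverses `X ⊗ A ≅ A ⊗ X`.) -/
def cross {X : C} (l : HalfBraiding X) (A : C) : A ⊗ X ⟶ X ⊗ A := (l.β A).inv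

/-- `f : X ⟶ Y` intertwines the half-braidings `l` and `m`. -/
def Intertwines {X Y : C} (l : HalfBraiding X) (m : HalfBraiding Y) (f : X ⟶ Y) : Prop :=
  ∀ A : C, cross l A ≫ f ▷ A = A ◁ f ≫ cross m A

theorem intertwines_id {X : C} (l : HalfBraiding X) : Intertwines l l (𝟙 X) := by
  intro A; simp

theorem Intertwines.comp {X Y Z : C} {l : HalfBraiding X} {m : HalfBraiding Y}
    {n : HalfBraiding Z} {f : X ⟶ Y} {g : Y ⟶ Z} (hf : Intertwines l m f)
    (hg : Intertwines m n g) : Intertwines l n (f ≫ g) := by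
  intro A
  rw [comp_whiskerRight, ← Category.assoc, hf A, Category.assoc, hg A,
    MonoidalCategory.whiskerLeft_comp, Category.assoc]

variable [BraidedCategory C]

/-- The condition COMM on an ordered pair of half-braidings, as an equality of maps
`A ⊗ B ⊗ X ⟶ X ⊗ B ⊗ A`. -/
def COMM {X : C} (l₁ l₂ : HalfBraiding X) : Prop :=
  ∀ A B : C,
    (A ◁ cross l₂ B ⊗≫ cross l₁ A ▷ B ⊗≫ X ◁ (β_ A B).hom : A ⊗ (B ⊗ X) ⟶ X ⊗ (B ⊗ A)) =
      𝟙 _ ⊗≫ (β_ B A).inv ▷ X ⊗≫ B ◁ cross l₁ A ⊗≫ cross l₂ B ▷ A ⊗≫ 𝟙 _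

variable (C) in
/-- Objects `(X, λ¹, λ²)` of the elliptic Drinfeld center of a braided monoidal category. -/
structure ZEl where
  X : C
  hb₁ : HalfBraiding X
  hb₂ : HalfBraiding X
  comm : COMM hb₁ hb₂

/-- Morphisms of the elliptic Drinfeld center: those of `C` intertwining both half-braidings. -/
@[ext]
structure ZEl.Hom (P R : ZEl C) where
  f : P.X ⟶ R.X
  comm₁ : Intertwines P.hb₁ R.hb₁ f
  comm₂ : Intertwines P.hb₂ R.hb₂ f

instance : Category (ZEl C) where
  Hom := ZEl.Hom
  id P := ⟨𝟙 P.X, intertwines_id _, intertwines_id _⟩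
  comp f g := ⟨f.f ≫ g.f, f.comm₁.comp g.comm₁, f.comm₂.comp g.comm₂⟩

/-- `(λ ⊗ μ)_A`: first `λ_A`, then `μ_A`. -/
def crossTensor {X Y : C} (l : HalfBraiding X) (m : HalfBraiding Y) (A : C) :
    A ⊗ (X ⊗ Y) ⟶ (X ⊗ Y) ⊗ A :=
  𝟙 _ ⊗≫ cross l A ▷ Y ⊗≫ X ◁ cross m A ⊗≫ 𝟙 _

/-- Move `A` past `X` by `λ_A`, then past `Y` by the braiding `c_{A,Y}`. -/
def crossLeft {X : C} (l : HalfBraiding X) (Y A : C) : A ⊗ (X ⊗ Y) ⟶ (X ⊗ Y) ⊗ A :=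
  𝟙 _ ⊗≫ cross l A ▷ Y ⊗≫ X ◁ (β_ A Y).hom ⊗≫ 𝟙 _

/-- Move `A` past `X` by the reverse braiding `c_{X,A}⁻¹`, then past `Y` by `μ_A`. -/
def crossRight (X : C) {Y : C} (m : HalfBraiding Y) (A : C) : A ⊗ (X ⊗ Y) ⟶ (X ⊗ Y) ⊗ A :=
  𝟙 _ ⊗≫ (β_ X A).inv ▷ Y ⊗≫ X ◁ cross m A ⊗≫ 𝟙 _

variable [RightRigidCategory C] [RibbonCategory C]

/-- The evaluation `X ⊗ X^* ⟶ 𝟙` given by the ribbon structure. -/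
def evTilde (X : C) : X ⊗ Xᘁ ⟶ 𝟙_ C :=
  (RibbonCategory.twist X).hom ▷ (Xᘁ) ≫ (β_ X (Xᘁ)).hom ≫ ε_ X (Xᘁ)

/-- The categorical trace of an endomorphism. -/
def trace {X : C} (f : X ⟶ X) : 𝟙_ C ⟶ 𝟙_ C :=
  η_ X (Xᘁ) ≫ f ▷ (Xᘁ) ≫ evTilde X

/-- The loop coloured by `S` encircling `X` and `Y`:
`XY → S S^* X Y → S X S^* Y → X S S^* Y → X S Y S^* → X Y S S^* → XY`,
where `S^*` crosses `X` by `λ`, `S` crosses `X` by the reverse braiding, `S^*` crosses `Y` by the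
braiding, and `S` crosses `Y` by `μ`. -/
def loop {X Y : C} (l : HalfBraiding X) (m : HalfBraiding Y) (S : C) : X ⊗ Y ⟶ X ⊗ Y :=
  𝟙 _ ⊗≫ η_ S (Sᘁ) ▷ (X ⊗ Y) ⊗≫
    S ◁ cross l (Sᘁ) ▷ Y ⊗≫
    (β_ X S).inv ▷ (Sᘁ ⊗ Y) ⊗≫
    (X ⊗ S) ◁ (β_ (Sᘁ) Y).hom ⊗≫
    X ◁ cross m S ▷ (Sᘁ) ⊗≫
    (X ⊗ Y) ◁ evTilde S ⊗≫ 𝟙 _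

end Elliptic

section Premodular

theorem exists_scalar (k : Type w) [Field k] [IsAlgClosed k] {C : Type u} [Category.{v} C]
    [Abelian C] [Linear k C] [MonoidalCategory C] [IsFusion k C] (f : 𝟙_ C ⟶ 𝟙_ C) :
    ∃ c : k, c • 𝟙 (𝟙_ C) = f :=
  haveI : Simple (𝟙_ C) := IsFusion.simple_unit k
  haveI : FiniteDimensional k (𝟙_ C ⟶ 𝟙_ C) := IsFusion.finiteDimensional_hom _ _
  endomorphism_simple_eq_smul_id k f

variable (k : Type w) [Field k] [IsAlgClosed k]
  {C : Type u} [Category.{v} C] [Abelian C] [Linear k C] [MonoidalCategory C]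
  [BraidedCategory C] [RightRigidCategory C] [RibbonCategory C] [IsFusion k C]

/-- The identification of `End(𝟙)` with `k`. -/
def scalar (f : 𝟙_ C ⟶ 𝟙_ C) : k := (exists_scalar k f).choose

/-- The categorical dimension, as an element of `k`. -/
def dim (X : C) : k := scalar k (trace (𝟙 X))

variable {J : Type x} [Fintype J] (Xs : SimpleReps C J)

/-- `𝒟 = ∑ d_j²`. -/
def globalDim : k := ∑ j, dim k (Xs.obj j) ^ 2

/-- `Q_{λ,μ} = 𝒟⁻¹ ∑ d_j (loop coloured by X_j)`. -/
def Q {X Y : C} (l : HalfBraiding X) (m : HalfBraiding Y) : X ⊗ Y ⟶ X ⊗ Y :=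
  (globalDim k Xs)⁻¹ • ∑ j, dim k (Xs.obj j) • loop l m (Xs.obj j)

/-- A choice of reduced tensor product of `X` and `Y`: an object with maps exhibiting it as the
image of `Q_{λ,μ}`. -/
structure ReducedTensor {X Y : C} (l : HalfBraiding X) (m : HalfBraiding Y) where
  I : C
  ι : I ⟶ X ⊗ Y
  π : X ⊗ Y ⟶ I
  ι_π : ι ≫ π = 𝟙 I
  π_ι : π ≫ ι = Q k Xs l m

/-- The pairing of `Hom(A ⊗ S, T)` with `Hom(S^*, T^* ⊗ A)`: the value of the closed diagram
obtained by joining the `A`-, `S`- and `T`-strands of the two maps. -/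
def pairing {A S T : C} (φ : A ⊗ S ⟶ T) (ψ : Sᘁ ⟶ Tᘁ ⊗ A) : k :=
  scalar k (trace (𝟙 A ⊗≫ A ◁ η_ S (Sᘁ) ⊗≫ (φ ⊗ₘ ψ) ⊗≫ evTilde T ▷ A ⊗≫ 𝟙 A))

/-- `g = ∑_α φ_α ⊗ φ^α` for a pair of dual bases of `Hom(A ⊗ S, T)` and `Hom(S^*, T^* ⊗ A)`. -/
def IsDualBasisSum {A S T : C} (g : A ⊗ (S ⊗ Sᘁ) ⟶ (T ⊗ Tᘁ) ⊗ A) : Prop :=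
  ∃ (n : ℕ) (φ : Module.Basis (Fin n) k (A ⊗ S ⟶ T)) (ψ : Module.Basis (Fin n) k (Sᘁ ⟶ Tᘁ ⊗ A)),
    (∀ a b, pairing k (φ a) (ψ b) = if a = b then 1 else 0) ∧
    g = 𝟙 _ ⊗≫ (∑ a, (φ a ⊗ₘ ψ a)) ⊗≫ 𝟙 _

/-- The object `⨁_j X_j ⊗ X_j^*`. -/
def unitObj : C := ⨁ fun j => Xs.obj j ⊗ (Xs.obj j)ᘁ

def unitι (j : J) : Xs.obj j ⊗ (Xs.obj j)ᘁ ⟶ unitObj Xs :=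
  biproduct.ι (fun j => Xs.obj j ⊗ (Xs.obj j)ᘁ) j

def unitπ (j : J) : unitObj Xs ⟶ Xs.obj j ⊗ (Xs.obj j)ᘁ :=
  biproduct.π (fun j => Xs.obj j ⊗ (Xs.obj j)ᘁ) j

/-- `l` is the half-braiding `Γ` on `⨁_j X_j ⊗ X_j^*`: its component from `i` to `j` is
`√d_i √d_j ∑_α φ_α ⊗ φ^α`, where `s j = √d_j`. -/
def IsGamma (s : J → k) (l : HalfBraiding (unitObj Xs)) : Prop :=
  ∀ A : C, ∃ g : ∀ i j : J, A ⊗ (Xs.obj i ⊗ (Xs.obj i)ᘁ) ⟶ (Xs.obj j ⊗ (Xs.obj j)ᘁ) ⊗ A,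
    (∀ i j, IsDualBasisSum k (g i j)) ∧
    cross l A = ∑ i, ∑ j, (s i * s j) • (A ◁ unitπ Xs i ≫ g i j ≫ unitι Xs j ▷ A)

/-- `Ω_A`: the object `A` crosses each `X_j` by `c_{A,X_j}` and then `X_j^*` by
`c_{X_j^*,A}⁻¹`. -/
def omega (A : C) : A ⊗ unitObj Xs ⟶ unitObj Xs ⊗ A :=
  ∑ j, A ◁ unitπ Xs j ≫
    (𝟙 _ ⊗≫ (β_ A (Xs.obj j)).hom ▷ (Xs.obj j)ᘁ ⊗≫ Xs.obj j ◁ (β_ ((Xs.obj j)ᘁ) A).inv ⊗≫ 𝟙 _) ≫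
    unitι Xs j ▷ A

/-- `∑_j √d_j (X_j X_j^* Y → X_j Y X_j^* → Y X_j X_j^* → Y)`: first `X_j^*` crosses `Y` by the
braiding, then `X_j` crosses `Y` by `μ`, then evaluation. -/
def leftUnitMap (s : J → k) {Y : C} (m : HalfBraiding Y) : unitObj Xs ⊗ Y ⟶ Y :=
  ∑ j, s j • (unitπ Xs j ▷ Y ≫
    (𝟙 _ ⊗≫ Xs.obj j ◁ (β_ ((Xs.obj j)ᘁ) Y).hom ⊗≫ cross m (Xs.obj j) ▷ (Xs.obj j)ᘁ ⊗≫
      Y ◁ evTilde (Xs.obj j) ⊗≫ 𝟙 _))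

/-- `∑_j √d_j (Y X_j X_j^* → X_j Y X_j^* → Y X_j X_j^* → Y)`: first `Y` crosses `X_j` by the
braiding, then `X_j` crosses back by `λ`, then evaluation. -/
def rightUnitMap (s : J → k) {Y : C} (l : HalfBraiding Y) : Y ⊗ unitObj Xs ⟶ Y :=
  ∑ j, s j • (Y ◁ unitπ Xs j ≫
    (𝟙 _ ⊗≫ (β_ Y (Xs.obj j)).hom ▷ (Xs.obj j)ᘁ ⊗≫ cross l (Xs.obj j) ▷ (Xs.obj j)ᘁ ⊗≫
      Y ◁ evTilde (Xs.obj j) ⊗≫ 𝟙 _))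

/-- The objects of the tensor structure on the elliptic center: half-braidings on the chosen
reduced tensor products `T P R` and on `⨁_j X_j ⊗ X_j^*`, given by the stated formulas and
satisfying COMM. -/
structure TensorObjects (s : J → k)
    (T : ∀ P R : ZEl C, ReducedTensor k Xs P.hb₁ R.hb₁) where
  tensor₁ : ∀ P R : ZEl C, HalfBraiding (T P R).I
  tensor₁_left : ∀ (P R : ZEl C) (A : C), cross (tensor₁ P R) A =
    A ◁ (T P R).ι ≫ crossLeft P.hb₁ R.X A ≫ (T P R).π ▷ A
  tensor₁_right : ∀ (P R : ZEl C) (A : C), cross (tensor₁ P R) A =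
    A ◁ (T P R).ι ≫ crossRight P.X R.hb₁ A ≫ (T P R).π ▷ A
  tensor₂ : ∀ P R : ZEl C, HalfBraiding (T P R).I
  tensor₂_eq : ∀ (P R : ZEl C) (A : C), cross (tensor₂ P R) A =
    A ◁ (T P R).ι ≫ crossTensor P.hb₂ R.hb₂ A ≫ (T P R).π ▷ A
  tensor_comm : ∀ P R : ZEl C, COMM (tensor₁ P R) (tensor₂ P R)
  unit₁ : HalfBraiding (unitObj Xs)
  unit₁_eq : IsGamma k Xs s unit₁
  unit₂ : HalfBraiding (unitObj Xs)
  unit₂_eq : ∀ A : C, cross unit₂ A = omega Xs A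
  unit_comm : COMM unit₁ unit₂

namespace TensorObjects

variable {k Xs} {s : J → k} {T : ∀ P R : ZEl C, ReducedTensor k Xs P.hb₁ R.hb₁}

/-- `(X, λ¹, λ²) ⊗ (Y, μ¹, μ²)`. -/
def tensor (O : TensorObjects k Xs s T) (P R : ZEl C) : ZEl C :=
  ⟨(T P R).I, O.tensor₁ P R, O.tensor₂ P R, O.tensor_comm P R⟩

/-- The unit object `(⨁_j X_j ⊗ X_j^*, Γ, Ω)`. -/
def unit (O : TensorObjects k Xs s T) : ZEl C :=
  ⟨unitObj Xs, O.unit₁, O.unit₂, O.unit_comm⟩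

end TensorObjects

/-- The morphisms of the tensor structure. Each is the stated morphism of `C`, composed with the
inclusions into and projections onto the reduced tensor products; `κ` is an overall scalar in the
unit constraints. -/
structure TensorMorphisms {k : Type w} [Field k] [IsAlgClosed k] {C : Type u} [Category.{v} C]
    [Abelian C] [Linear k C] [MonoidalCategory C] [BraidedCategory C] [RightRigidCategory C]
    [RibbonCategory C] [IsFusion k C] {J : Type x} [Fintype J] {Xs : SimpleReps C J} {s : J → k}
    {T : ∀ P R : ZEl C, ReducedTensor k Xs P.hb₁ R.hb₁} (O : TensorObjects k Xs s T) (κ : k)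
    where
  hom : ∀ {P P' R R' : ZEl C}, (P ⟶ P') → (R ⟶ R') → (O.tensor P R ⟶ O.tensor P' R')
  hom_f : ∀ {P P' R R' : ZEl C} (f : P ⟶ P') (g : R ⟶ R'),
    (hom f g).f = (T P R).ι ≫ (f.f ⊗ₘ g.f) ≫ (T P' R').π
  assoc : ∀ P R V : ZEl C, O.tensor (O.tensor P R) V ≅ O.tensor P (O.tensor R V)
  assoc_f : ∀ P R V : ZEl C, (assoc P R V).hom.f =
    (T (O.tensor P R) V).ι ≫ (T P R).ι ▷ V.X ≫ (α_ P.X R.X V.X).hom ≫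
      P.X ◁ (T R V).π ≫ (T P (O.tensor R V)).π
  leftUnit : ∀ P : ZEl C, O.tensor O.unit P ≅ P
  leftUnit_f : ∀ P : ZEl C, (leftUnit P).hom.f =
    (T O.unit P).ι ≫ (κ • leftUnitMap k Xs s P.hb₁)
  rightUnit : ∀ P : ZEl C, O.tensor P O.unit ≅ P
  rightUnit_f : ∀ P : ZEl C, (rightUnit P).hom.f =
    (T P O.unit).ι ≫ (κ • rightUnitMap k Xs s P.hb₁)

/-- The data of a monoidal structure assembled from the above (whiskering is the tensor product
with an identity). -/
abbrev TensorMorphisms.toStruct {k : Type w} [Field k] [IsAlgClosed k] {C : Type u} [Category.{v} C]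
    [Abelian C] [Linear k C] [MonoidalCategory C] [BraidedCategory C] [RightRigidCategory C]
    [RibbonCategory C] [IsFusion k C] {J : Type x} [Fintype J] {Xs : SimpleReps C J} {s : J → k}
    {T : ∀ P R : ZEl C, ReducedTensor k Xs P.hb₁ R.hb₁} {O : TensorObjects k Xs s T} {κ : k}
    (M : TensorMorphisms O κ) : MonoidalCategoryStruct (ZEl C) where
  tensorObj := O.tensor
  whiskerLeft P _ _ g := M.hom (𝟙 P) g
  whiskerRight f R := M.hom f (𝟙 R)
  tensorHom f g := M.hom f g
  tensorUnit := O.unit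
  associator := M.assoc
  leftUnitor := M.leftUnit
  rightUnitor := M.rightUnit

end Premodular

end EllipticCenter

end

noncomputable section

namespace EllipticCenter

/-! ### Half-braidings and the calculus of their crossings. -/

section HalfBraidings

variable {C : Type u} [Category.{v} C] [MonoidalCategory C]

/-! Averaging. Let `W` carry two half-braidings `L` and `R`. Encircle `W` by a loop coloured `S`
whose strand `Sᘁ` crosses by `L` and whose strand `S` crosses by `R`; `average` is the sum of these
loops over the simple colours, weighted by `d_j` and divided by `𝒟`. The weighted loop admits handle
slides, so the average turns `L` into `R` (`cross_average`). If moreover `L` and `R` slide past each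
other, the average commutes with each of them, hence `L` and `R` agree on its image. Conversely, on
a map where they agree each loop closes up to the scalar `d_j`, and the average acts as the identity
(`comp_average`). So the average is the projector onto the largest part of `W` where `L` and `R`
coincide. `Q` is the average for the two ways of carrying `A` past `X ⊗ Y`: `λ` then braiding, or
reverse braiding then `μ`.

The coend. Write `U` for `⨁ X_j ⊗ X_j^*`. It is the coend of `S ⊗ S^*`: a map out of `F U` is a
dinatural family indexed by pairings `e : Z ⊗ S ⟶ 𝟙` (`Dinatural.fac`, `unit_hom_ext`). On the test
maps `inc e`, `Γ_A` absorbs `A` and its dual into the pairing, `Ω` is a braiding, and `U` acts on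
`W` by moving `Z` and `S` past `W` and pairing them. Identities about `U` thus become diagrams
without sums over simple objects. The handle slide is the `Γ`-invariance of `∑ d_j coev_j`
(`kirby_gamma`); it comes from the fusion identity `sum_absorb_bend`.

The monoidal structure. Iterated reduced products embed in those of `C` as the parts where
consecutive crossings agree, and the associator of `C` respects these parts (`assocMap_inclR`).
Functoriality, naturality of the associator and the pentagon are then checked after the inclusions.
For the unit, `U` is generated under `Γ` by a map `𝟙 ⟶ U` (`inc_eq_gamma`), so a map out of `U ⊗ Y`
that equalises the two crossings is determined by its restriction to `Y` (`actU_unitIn`). Hence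
acting and inserting the unit are inverse to each other on the reduced product. The triangle holds
because `U` acts in the same way on either factor of `X ⊗ Y` after projection
(`rightUnitMap_leftUnitMap`). -/

instance {X : C} (l : HalfBraiding X) (A : C) : IsIso (cross l A) := by
  unfold cross; infer_instance

theorem cross_naturality {X : C} (l : HalfBraiding X) {A B : C} (f : A ⟶ B) :
    f ▷ X ≫ cross l B = cross l A ≫ X ◁ f := by
  rw [cross, cross, Iso.comp_inv_eq, Category.assoc, l.naturality, Iso.inv_hom_id_assoc]

theorem cross_naturality_assoc {X : C} (l : HalfBraiding X) {A B Z : C} (f : A ⟶ B)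
    (h : X ⊗ B ⟶ Z) : f ▷ X ≫ cross l B ≫ h = cross l A ≫ X ◁ f ≫ h := by
  rw [← Category.assoc, cross_naturality, Category.assoc]

theorem cross_tensor {X : C} (l : HalfBraiding X) (A B : C) :
    cross l (A ⊗ B) = 𝟙 _ ⊗≫ A ◁ cross l B ⊗≫ cross l A ▷ B ⊗≫ 𝟙 _ := by
  rw [← cancel_epi (l.β (A ⊗ B)).hom, cross, Iso.hom_inv_id, l.monoidal]
  simp [monoidalComp, cross]

/-- Multiplicativity on `𝟙 ⊗ 𝟙` together with naturality at its unitor makes the crossing by `𝟙`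
idempotent up to unitors, and an invertible idempotent is the identity. -/
theorem cross_unit {X : C} (l : HalfBraiding X) :
    cross l (𝟙_ C) = 𝟙 _ ⊗≫ 𝟙 _ := by
  have h := cross_tensor l (𝟙_ C) (𝟙_ C)
  have h2 := cross_naturality l (λ_ (𝟙_ C)).hom
  rw [h] at h2
  have h3 : 𝟙 _ ⊗≫ cross l (𝟙_ C) ⊗≫ 𝟙 _ =
    (𝟙 _ ⊗≫ cross l (𝟙_ C) ⊗≫ cross l (𝟙_ C) ⊗≫ 𝟙 _ : 𝟙_ C ⊗ X ⟶ X ⊗ 𝟙_ C) := by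
    calc _ = (λ_ _).inv ≫ (α_ _ _ _).inv ≫ ((λ_ (𝟙_ C)).hom ▷ X ≫ cross l (𝟙_ C)) := by monoidal
      _ = _ := by rw [h2]; monoidal
  simp [monoidalComp] at h3
  have h4 := (cancel_epi (cross l (𝟙_ C))).1 ((Category.comp_id _).trans h3)
  rw [← cancel_epi ((ρ_ X).hom ≫ (λ_ X).inv)]
  simp [monoidalComp]
  simpa using h4.symm

/-- A half-braiding from its crossings. -/
def ofCross {X : C} (c : ∀ A : C, A ⊗ X ⟶ X ⊗ A) [∀ A, IsIso (c A)]
    (hnat : ∀ {A B : C} (f : A ⟶ B), f ▷ X ≫ c B = c A ≫ X ◁ f)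
    (htensor : ∀ A B : C, c (A ⊗ B) = 𝟙 _ ⊗≫ A ◁ c B ⊗≫ c A ▷ B ⊗≫ 𝟙 _) : HalfBraiding X where
  β A := (asIso (c A)).symm
  monoidal A B := by
    rw [← cancel_epi (c (A ⊗ B))]
    simp [htensor, monoidalComp]
  naturality f := by
    change X ◁ f ≫ inv (c _) = inv (c _) ≫ f ▷ X
    rw [IsIso.comp_inv_eq, Category.assoc, hnat, IsIso.inv_hom_id_assoc]

/-- With duals, invertibility of crossings is automatic: the inverse is the crossing by `Aᘁ` with
its ends bent round. In each composite the two crossings merge into one by `Aᘁ ⊗ A` or `A ⊗ Aᘁ`,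
which naturality pulls off through `ε` or `η`. -/
theorem isIso_of_lax [RightRigidCategory C] {X : C} (c : ∀ A : C, A ⊗ X ⟶ X ⊗ A)
    (hnat : ∀ {A B : C} (f : A ⟶ B), f ▷ X ≫ c B = c A ≫ X ◁ f)
    (htensor : ∀ A B : C, c (A ⊗ B) = 𝟙 _ ⊗≫ A ◁ c B ⊗≫ c A ▷ B ⊗≫ 𝟙 _)
    (hunit : c (𝟙_ C) = 𝟙 _ ⊗≫ 𝟙 _) (A : C) : IsIso (c A) := by
  refine ⟨𝟙 _ ⊗≫ η_ A (Aᘁ) ▷ (X ⊗ A) ⊗≫ A ◁ c (Aᘁ) ▷ A ⊗≫ (A ⊗ X) ◁ ε_ A (Aᘁ) ⊗≫ 𝟙 _, ?_, ?_⟩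
  · calc
      _ = 𝟙 _ ⊗≫ (𝟙_ C ◁ c A ≫ η_ A (Aᘁ) ▷ (X ⊗ A)) ⊗≫ A ◁ c (Aᘁ) ▷ A ⊗≫
          (A ⊗ X) ◁ ε_ A (Aᘁ) ⊗≫ 𝟙 _ := by monoidal
      _ = 𝟙 _ ⊗≫ η_ A (Aᘁ) ▷ (A ⊗ X) ⊗≫ A ◁ (𝟙 ((Aᘁ ⊗ A) ⊗ X) ⊗≫ Aᘁ ◁ c A ⊗≫ c (Aᘁ) ▷ A ⊗≫ 𝟙 (X ⊗ Aᘁ ⊗ A)) ⊗≫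
          (A ⊗ X) ◁ ε_ A (Aᘁ) ⊗≫ 𝟙 _ := by rw [whisker_exchange]; monoidal
      _ = 𝟙 _ ⊗≫ η_ A (Aᘁ) ▷ (A ⊗ X) ⊗≫ A ◁ (c (Aᘁ ⊗ A) ≫ X ◁ ε_ A (Aᘁ)) ⊗≫ 𝟙 _ := by
        rw [← htensor]; monoidal
      _ = 𝟙 _ ⊗≫ (η_ A (Aᘁ) ▷ A ⊗≫ A ◁ ε_ A (Aᘁ)) ▷ X ⊗≫ A ◁ c (𝟙_ C) ⊗≫ 𝟙 _ := by
        rw [← hnat]; monoidal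
      _ = _ := by rw [ExactPairing.evaluation_coevaluation'', hunit]; monoidal
  · calc
      _ = 𝟙 _ ⊗≫ η_ A (Aᘁ) ▷ (X ⊗ A) ⊗≫ A ◁ c (Aᘁ) ▷ A ⊗≫ ((A ⊗ X) ◁ ε_ A (Aᘁ) ≫ c A ▷ 𝟙_ C)
          ⊗≫ 𝟙 _ := by monoidal
      _ = 𝟙 _ ⊗≫ η_ A (Aᘁ) ▷ (X ⊗ A) ⊗≫ (𝟙 ((A ⊗ Aᘁ) ⊗ X) ⊗≫ A ◁ c (Aᘁ) ⊗≫ c A ▷ Aᘁ ⊗≫ 𝟙 (X ⊗ A ⊗ Aᘁ)) ▷ A ⊗≫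
          (X ⊗ A) ◁ ε_ A (Aᘁ) ⊗≫ 𝟙 _ := by rw [whisker_exchange]; monoidal
      _ = 𝟙 _ ⊗≫ (η_ A (Aᘁ) ▷ X ≫ c (A ⊗ Aᘁ)) ▷ A ⊗≫ (X ⊗ A) ◁ ε_ A (Aᘁ) ⊗≫ 𝟙 _ := by
        rw [← htensor]; monoidal
      _ = 𝟙 _ ⊗≫ c (𝟙_ C) ▷ A ⊗≫ X ◁ (η_ A (Aᘁ) ▷ A ⊗≫ A ◁ ε_ A (Aᘁ)) ⊗≫ 𝟙 _ := by
        rw [hnat]; monoidal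
      _ = _ := by rw [ExactPairing.evaluation_coevaluation'', hunit]; monoidal

/-- The half-braiding on `X ⊗ Y` with crossings `crossTensor l m`. -/
def hbTensor {X Y : C} (l : HalfBraiding X) (m : HalfBraiding Y) : HalfBraiding (X ⊗ Y) :=
  (Center.tensorObj ⟨X, l⟩ ⟨Y, m⟩).2

theorem cross_hbTensor {X Y : C} (l : HalfBraiding X) (m : HalfBraiding Y) (A : C) :
    cross (hbTensor l m) A = 𝟙 _ ⊗≫ cross l A ▷ Y ⊗≫ X ◁ cross m A ⊗≫ 𝟙 _ := by
  change (α_ X Y A ≪≫ whiskerLeftIso X (m.β A) ≪≫ (α_ X A Y).symm ≪≫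
    whiskerRightIso (l.β A) Y ≪≫ α_ A X Y).inv = _
  simp [cross, monoidalComp]

theorem Intertwines.tensor {X X' Y Y' : C} {l : HalfBraiding X} {l' : HalfBraiding X'}
    {m : HalfBraiding Y} {m' : HalfBraiding Y'} {f : X ⟶ X'} {g : Y ⟶ Y'}
    (hf : Intertwines l l' f) (hg : Intertwines m m' g) :
    Intertwines (hbTensor l m) (hbTensor l' m') (f ⊗ₘ g) := by
  intro A
  rw [cross_hbTensor, cross_hbTensor]
  calc
    _ = 𝟙 _ ⊗≫ cross l A ▷ Y ⊗≫ X ◁ (cross m A ≫ g ▷ A) ⊗≫ f ▷ (Y' ⊗ A) ⊗≫ 𝟙 _ := by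
      rw [tensorHom_def']; monoidal
    _ = 𝟙 _ ⊗≫ cross l A ▷ Y ⊗≫ (X ⊗ A) ◁ g ⊗≫ (X ◁ cross m' A ≫ f ▷ (Y' ⊗ A)) ⊗≫ 𝟙 _ := by
      rw [hg]; monoidal
    _ = 𝟙 _ ⊗≫ (cross l A ▷ Y ≫ (X ⊗ A) ◁ g) ⊗≫ f ▷ (A ⊗ Y') ⊗≫ X' ◁ cross m' A ⊗≫ 𝟙 _ := by
      rw [whisker_exchange]; monoidal
    _ = 𝟙 _ ⊗≫ (A ⊗ X) ◁ g ⊗≫ (cross l A ≫ f ▷ A) ▷ Y' ⊗≫ X' ◁ cross m' A ⊗≫ 𝟙 _ := by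
      rw [← whisker_exchange]; monoidal
    _ = _ := by rw [hf, tensorHom_def']; monoidal

theorem Intertwines.associator {X Y Z : C} (l : HalfBraiding X) (m : HalfBraiding Y)
    (n : HalfBraiding Z) : Intertwines (hbTensor (hbTensor l m) n)
      (hbTensor l (hbTensor m n)) (α_ X Y Z).hom := by
  intro A
  simp only [cross_hbTensor]
  monoidal

theorem Intertwines.associator_inv {X Y Z : C} (l : HalfBraiding X) (m : HalfBraiding Y)
    (n : HalfBraiding Z) : Intertwines (hbTensor l (hbTensor m n))
      (hbTensor (hbTensor l m) n) (α_ X Y Z).inv := by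
  intro A
  simp only [cross_hbTensor]
  monoidal

variable [BraidedCategory C]

/-- The half-braiding on `Y` whose crossings are `c_{A,Y}`. -/
def hbPos (Y : C) : HalfBraiding Y where
  β A := (β_ A Y).symm
  monoidal A B := by simp [BraidedCategory.braiding_tensor_left_inv]
  naturality f := by simp

/-- The half-braiding on `X` whose crossings are `c_{X,A}⁻¹`. -/
def hbNeg (X : C) : HalfBraiding X where
  β A := β_ X A

theorem cross_hbPos (Y A : C) : cross (hbPos Y) A = (β_ A Y).hom := rfl

theorem cross_hbNeg (X A : C) : cross (hbNeg X) A = (β_ X A).inv := rfl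

theorem Intertwines.hbPos {X Y : C} (f : X ⟶ Y) : Intertwines (hbPos X) (hbPos Y) f := by
  intro A; simp [cross_hbPos]

theorem Intertwines.hbNeg {X Y : C} (f : X ⟶ Y) : Intertwines (hbNeg X) (hbNeg Y) f := by
  intro A; simp [cross_hbNeg]

theorem cross_hbTensor_hbPos (X Y A : C) :
    cross (hbTensor (hbPos X) (hbPos Y)) A = cross (hbPos (X ⊗ Y)) A := by
  rw [cross_hbTensor]; simp [cross_hbPos, monoidalComp, BraidedCategory.braiding_tensor_right_hom]

theorem cross_hbTensor_hbNeg (X Y A : C) :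
    cross (hbTensor (hbNeg X) (hbNeg Y)) A = cross (hbNeg (X ⊗ Y)) A := by
  rw [cross_hbTensor]; simp [cross_hbNeg, monoidalComp, BraidedCategory.braiding_tensor_left_inv]

end HalfBraidings

/-! ### The twist, pairings read from the other side, and duals adapted to them. -/

section Ribbon

open RibbonCategory

variable {C : Type u} [Category.{v} C] [MonoidalCategory C] [BraidedCategory C]
  [RightRigidCategory C] [RibbonCategory C]

/-- The braiding of `𝟙` with itself is trivial, so `twist_tensor` gives `θ_𝟙 = θ_𝟙 ≫ θ_𝟙`, and `θ_𝟙`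
is invertible. -/
theorem twist_unit : (twist (𝟙_ C)).hom = 𝟙 _ := by
  have h := twist_tensor (𝟙_ C) (𝟙_ C)
  have h2 := twist_naturality (λ_ (𝟙_ C)).hom
  rw [h] at h2
  have hb : (β_ (𝟙_ C) (𝟙_ C)).hom = 𝟙 _ := by
    rw [braiding_tensorUnit_left, unitors_equal, Iso.hom_inv_id]
  rw [hb, MonoidalCategory.tensorHom_def, Category.comp_id, Category.comp_id, Category.assoc,
    leftUnitor_naturality, unitors_equal, rightUnitor_naturality_assoc] at h2
  have h3 := h2
  rw [cancel_epi] at h3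
  rw [← cancel_epi (twist (𝟙_ C)).hom, ← h3, Category.comp_id]

/-- The map `S ⊗ Z ⟶ 𝟙` obtained from `e : Z ⊗ S ⟶ 𝟙` by the ribbon structure. -/
def tilde {S Z : C} (e : Z ⊗ S ⟶ 𝟙_ C) : S ⊗ Z ⟶ 𝟙_ C :=
  (twist S).hom ▷ Z ≫ (β_ S Z).hom ≫ e

theorem evTilde_eq (X : C) : evTilde X = tilde (ε_ X (Xᘁ)) := rfl

theorem whiskerRight_tilde {S T Z : C} (f : S ⟶ T) (e : Z ⊗ T ⟶ 𝟙_ C) :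
    f ▷ Z ≫ tilde e = tilde (Z ◁ f ≫ e) := by
  simp only [tilde]
  rw [← comp_whiskerRight_assoc, twist_naturality, comp_whiskerRight_assoc]
  simp

theorem whiskerLeft_tilde {S Z Z' : C} (g : Z' ⟶ Z) (e : Z ⊗ S ⟶ 𝟙_ C) :
    S ◁ g ≫ tilde e = tilde (g ▷ S ≫ e) := by
  simp only [tilde]
  rw [whisker_exchange_assoc]
  simp

/-- Nesting of pairings: `Z ⊗ A' ⊗ A ⊗ S ⟶ Z ⊗ S ⟶ 𝟙`. -/
def nest {A A' S Z : C} (a : A' ⊗ A ⟶ 𝟙_ C) (e : Z ⊗ S ⟶ 𝟙_ C) :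
    (Z ⊗ A') ⊗ (A ⊗ S) ⟶ 𝟙_ C :=
  𝟙 _ ⊗≫ Z ◁ a ▷ S ⊗≫ e

/-- Seen from the other side, inner and outer pairings change places. The twist of `A ⊗ S` is `θ_A ⊗
θ_S` with a double braiding; one of its crossings frees `S` from the pair `A, A'`, the other frees
`A` from the pair `S, Z`. -/
theorem tilde_nest {A A' S Z : C} (a : A' ⊗ A ⟶ 𝟙_ C) (e : Z ⊗ S ⟶ 𝟙_ C) :
    tilde (nest a e) = 𝟙 _ ⊗≫ A ◁ tilde e ▷ A' ⊗≫ tilde a := by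
  -- `S` passes freely across the paired strands `A`, `A'`.
  have key1 : (𝟙 (S ⊗ A ⊗ A') ⊗≫ (β_ S A).hom ▷ A' ⊗≫ A ◁ (β_ S A').hom ⊗≫ (β_ A A').hom ▷ S ⊗≫ a ▷ S)
      = 𝟙 _ ⊗≫ S ◁ ((β_ A A').hom ≫ a) ⊗≫ 𝟙 _ := by
    calc
      _ = (β_ S (A ⊗ A')).hom ⊗≫ ((β_ A A').hom ≫ a) ▷ S ⊗≫ 𝟙 _ := by
        rw [BraidedCategory.braiding_tensor_right_hom]; monoidal
      _ = ((β_ S (A ⊗ A')).hom ≫ ((β_ A A').hom ≫ a) ▷ S) ⊗≫ 𝟙 _ := by monoidal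
      _ = _ := by
        rw [← BraidedCategory.braiding_naturality_right]; simp [monoidalComp]
  -- `A` passes freely across the paired strands `S`, `Z`.
  have key2 : (𝟙 (A ⊗ S ⊗ Z) ⊗≫ A ◁ (β_ S Z).hom ⊗≫ (β_ A Z).hom ▷ S ⊗≫ Z ◁ (β_ A S).hom ⊗≫ e ▷ A)
      = 𝟙 _ ⊗≫ A ◁ ((β_ S Z).hom ≫ e) ⊗≫ 𝟙 _ := by
    calc
      _ = A ◁ (β_ S Z).hom ≫ (β_ A (Z ⊗ S)).hom ⊗≫ e ▷ A ⊗≫ 𝟙 _ := by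
        rw [BraidedCategory.braiding_tensor_right_hom]; monoidal
      _ = A ◁ (β_ S Z).hom ≫ ((β_ A (Z ⊗ S)).hom ≫ e ▷ A) ⊗≫ 𝟙 _ := by monoidal
      _ = _ := by
        rw [← BraidedCategory.braiding_naturality_right]; simp [monoidalComp]
  have key3 : ((β_ A S).hom ≫ (β_ S A).hom) ▷ (Z ⊗ A') ≫ (β_ (A ⊗ S) (Z ⊗ A')).hom =
      𝟙 _ ⊗≫ A ◁ (β_ S Z).hom ▷ A' ⊗≫ (β_ A Z).hom ▷ (S ⊗ A') ⊗≫
      Z ◁ ((β_ A S).hom ≫ (β_ S A).hom) ▷ A' ⊗≫ Z ◁ A ◁ (β_ S A').hom ⊗≫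
      Z ◁ (β_ A A').hom ▷ S ⊗≫ 𝟙 _ := by
    rw [BraidedCategory.braiding_tensor_right_hom]
    calc
      _ = 𝟙 _ ⊗≫ (((β_ A S).hom ≫ (β_ S A).hom) ▷ Z ≫ (β_ (A ⊗ S) Z).hom) ▷ A' ⊗≫
          Z ◁ (β_ (A ⊗ S) A').hom ⊗≫ 𝟙 _ := by monoidal
      _ = _ := by
        rw [BraidedCategory.braiding_naturality_left]
        simp only [BraidedCategory.braiding_tensor_left_hom]
        monoidal
  calc
    _ = ((twist A).hom ⊗ₘ (twist S).hom) ▷ (Z ⊗ A') ≫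
        (((β_ A S).hom ≫ (β_ S A).hom) ▷ (Z ⊗ A') ≫ (β_ (A ⊗ S) (Z ⊗ A')).hom) ≫ nest a e := by
      rw [tilde, twist_tensor]; simp only [comp_whiskerRight, Category.assoc]
    _ = ((twist A).hom ⊗ₘ (twist S).hom) ▷ (Z ⊗ A') ⊗≫ A ◁ (β_ S Z).hom ▷ A' ⊗≫
        (β_ A Z).hom ▷ (S ⊗ A') ⊗≫ Z ◁ (β_ A S).hom ▷ A' ⊗≫
        Z ◁ (𝟙 (S ⊗ A ⊗ A') ⊗≫ (β_ S A).hom ▷ A' ⊗≫ A ◁ (β_ S A').hom ⊗≫ (β_ A A').hom ▷ S ⊗≫ a ▷ S)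
        ⊗≫ e := by
      rw [key3, nest]; monoidal
    _ = ((twist A).hom ⊗ₘ (twist S).hom) ▷ (Z ⊗ A') ⊗≫ A ◁ (β_ S Z).hom ▷ A' ⊗≫
        (β_ A Z).hom ▷ (S ⊗ A') ⊗≫ Z ◁ (β_ A S).hom ▷ A' ⊗≫
        ((Z ⊗ S) ◁ ((β_ A A').hom ≫ a) ≫ e ▷ 𝟙_ C) ⊗≫ 𝟙 _ := by
      rw [key1]; monoidal
    _ = ((twist A).hom ⊗ₘ (twist S).hom) ▷ (Z ⊗ A') ⊗≫
        (𝟙 (A ⊗ S ⊗ Z) ⊗≫ A ◁ (β_ S Z).hom ⊗≫ (β_ A Z).hom ▷ S ⊗≫ Z ◁ (β_ A S).hom ⊗≫ e ▷ A) ▷ A' ⊗≫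
        ((β_ A A').hom ≫ a) ⊗≫ 𝟙 _ := by
      rw [whisker_exchange]; monoidal
    _ = ((twist A).hom ⊗ₘ (twist S).hom) ▷ (Z ⊗ A') ⊗≫ A ◁ ((β_ S Z).hom ≫ e) ▷ A' ⊗≫
        ((β_ A A').hom ≫ a) := by rw [key2]; monoidal
    _ = 𝟙 _ ⊗≫ ((twist A).hom ▷ (S ⊗ Z) ≫ A ◁ ((twist S).hom ▷ Z ≫ (β_ S Z).hom ≫ e)) ▷ A' ⊗≫
        ((β_ A A').hom ≫ a) := by rw [MonoidalCategory.tensorHom_def]; monoidal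
    _ = _ := by rw [← whisker_exchange]; simp only [tilde]; monoidal

theorem tilde_unit : tilde (λ_ (𝟙_ C)).hom = (λ_ (𝟙_ C)).hom := by
  simp only [tilde, twist_unit, id_whiskerRight, braiding_tensorUnit_left]
  rw [unitors_equal]; monoidal

/-- The coevaluation `𝟙 ⟶ X^* ⊗ X` given by the ribbon structure. -/
def coevTilde (X : C) : 𝟙_ C ⟶ Xᘁ ⊗ X :=
  η_ X (Xᘁ) ≫ (twist X).hom ▷ Xᘁ ≫ (β_ X (Xᘁ)).hom

/-- Naturality of the twist at `η` gives that `θ_{X ⊗ Xᘁ}` fixes `η`. Expanding it by `twist_tensor`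
and moving `θ_{Xᘁ}` across `η` by `twist_dual` trades the positive twist and braiding for their
inverses. -/
theorem coevTilde_eq (X : C) :
    coevTilde X = η_ X (Xᘁ) ≫ (twist X).inv ▷ Xᘁ ≫ (β_ (Xᘁ) X).inv := by
  have h1 : η_ X (Xᘁ) ≫ (twist (X ⊗ Xᘁ)).hom = η_ X (Xᘁ) := by
    rw [twist_naturality, twist_unit, Category.id_comp]
  have h2 : η_ X (Xᘁ) ≫ X ◁ (twist (Xᘁ)).hom = η_ X (Xᘁ) ≫ (twist X).hom ▷ Xᘁ := by
    rw [← twist_dual, coevaluation_comp_rightAdjointMate]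
  rw [twist_tensor] at h1
  rw [← cancel_mono (β_ (Xᘁ) X).hom, ← cancel_mono ((twist X).hom ▷ Xᘁ)]
  rw [tensorHom_def', Category.assoc, reassoc_of% h2] at h1
  simp only [coevTilde, Category.assoc, Iso.inv_hom_id, Category.comp_id,
    ← comp_whiskerRight, id_whiskerRight]
  rw [← BraidedCategory.braiding_naturality_right, ← BraidedCategory.braiding_naturality_left_assoc]
  exact h1

/-- With `coevTilde` in its inverse form the two twists cancel, leaving the zigzag of the duality
exchanged by the braiding. -/
theorem coevTilde_evTilde (X : C) :
    X ◁ coevTilde X ⊗≫ evTilde X ▷ X = 𝟙 _ ⊗≫ 𝟙 _ := by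
  have h : X ◁ (η_ X (Xᘁ) ≫ (β_ (Xᘁ) X).inv) ≫ (α_ _ _ _).inv ≫
      ((β_ X (Xᘁ)).hom ≫ ε_ X (Xᘁ)) ▷ X = (ρ_ _).hom ≫ (λ_ _).inv :=
    (BraidedCategory.exactPairing_swap X (Xᘁ)).coevaluation_evaluation'
  rw [coevTilde_eq, evTilde]
  calc
    _ = X ◁ (η_ X (Xᘁ) ≫ (β_ (Xᘁ) X).inv) ⊗≫ ((X ⊗ Xᘁ) ◁ (twist X).inv ≫
        ((twist X).hom ▷ (Xᘁ) ≫ (β_ X (Xᘁ)).hom ≫ ε_ X (Xᘁ)) ▷ X) := by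
      rw [BraidedCategory.braiding_inv_naturality_left]; monoidal
    _ = (X ◁ (η_ X (Xᘁ) ≫ (β_ (Xᘁ) X).inv) ≫ (twist X).hom ▷ (Xᘁ ⊗ X)) ⊗≫
        ((β_ X (Xᘁ)).hom ≫ ε_ X (Xᘁ)) ▷ X ⊗≫ 𝟙_ C ◁ (twist X).inv := by
      rw [whisker_exchange]; monoidal
    _ = (twist X).hom ▷ 𝟙_ C ≫ (X ◁ (η_ X (Xᘁ) ≫ (β_ (Xᘁ) X).inv) ≫ (α_ _ _ _).inv ≫
        ((β_ X (Xᘁ)).hom ≫ ε_ X (Xᘁ)) ▷ X) ≫ 𝟙_ C ◁ (twist X).inv := by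
      rw [whisker_exchange]; monoidal
    _ = (twist X).hom ▷ 𝟙_ C ≫ ((ρ_ _).hom ≫ (λ_ _).inv) ≫ 𝟙_ C ◁ (twist X).inv := by rw [h]
    _ = 𝟙 _ ⊗≫ ((twist X).hom ≫ (twist X).inv) ⊗≫ 𝟙 _ := by monoidal
    _ = _ := by rw [Iso.hom_inv_id]; monoidal

theorem evTilde_coevTilde (X : C) :
    coevTilde X ▷ Xᘁ ⊗≫ Xᘁ ◁ evTilde X = 𝟙 _ ⊗≫ 𝟙 _ := by
  have h : (η_ X (Xᘁ) ≫ (β_ (Xᘁ) X).inv) ▷ Xᘁ ≫ (α_ _ _ _).hom ≫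
      Xᘁ ◁ ((β_ X (Xᘁ)).hom ≫ ε_ X (Xᘁ)) = (λ_ _).hom ≫ (ρ_ _).inv :=
    (BraidedCategory.exactPairing_swap X (Xᘁ)).evaluation_coevaluation'
  rw [coevTilde_eq, evTilde]
  calc
    _ = (η_ X (Xᘁ) ≫ (β_ (Xᘁ) X).inv) ▷ Xᘁ ⊗≫ Xᘁ ◁ ((twist X).inv ≫ (twist X).hom) ▷ Xᘁ ⊗≫
        Xᘁ ◁ ((β_ X (Xᘁ)).hom ≫ ε_ X (Xᘁ)) := by
      rw [BraidedCategory.braiding_inv_naturality_left]; monoidal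
    _ = (η_ X (Xᘁ) ≫ (β_ (Xᘁ) X).inv) ▷ Xᘁ ≫ (α_ _ _ _).hom ≫
      Xᘁ ◁ ((β_ X (Xᘁ)).hom ≫ ε_ X (Xᘁ)) := by
      rw [Iso.inv_hom_id]; monoidal
    _ = _ := by rw [h]; monoidal

/-- `A'` is dual to `A`, with coevaluation inverse to the evaluation `A ⊗ A' ⟶ 𝟙` given by the
ribbon structure. -/
structure TwistedDual (A A' : C) where
  ev : A' ⊗ A ⟶ 𝟙_ C
  coev : 𝟙_ C ⟶ A' ⊗ A
  zigzag : A ◁ coev ⊗≫ tilde ev ▷ A = 𝟙 _ ⊗≫ 𝟙 _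

/-- The chosen dual. -/
def twistedDual (A : C) : TwistedDual A (Aᘁ) := ⟨ε_ A (Aᘁ), coevTilde A, coevTilde_evTilde A⟩

/-- The unit is its own dual. -/
def twistedDualUnit : TwistedDual (𝟙_ C) (𝟙_ C) where
  ev := (λ_ _).hom
  coev := (λ_ _).inv
  zigzag := by rw [tilde_unit]; monoidal

/-- The dual of a tensor product. -/
def TwistedDual.tensor {A A' B B' : C} (a : TwistedDual A A') (b : TwistedDual B B') :
    TwistedDual (A ⊗ B) (B' ⊗ A') where
  ev := nest a.ev b.ev
  coev := b.coev ⊗≫ B' ◁ a.coev ▷ B ⊗≫ 𝟙 _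
  zigzag := by
    rw [tilde_nest]
    calc
      _ = 𝟙 _ ⊗≫ (A ⊗ B) ◁ b.coev ⊗≫ A ◁ ((B ⊗ B') ◁ a.coev ≫ tilde b.ev ▷ (A' ⊗ A)) ▷ B ⊗≫
          tilde a.ev ▷ A ▷ B ⊗≫ 𝟙 _ := by monoidal
      _ = 𝟙 _ ⊗≫ A ◁ (B ◁ b.coev ⊗≫ tilde b.ev ▷ B) ⊗≫
          (A ◁ a.coev ⊗≫ tilde a.ev ▷ A) ▷ B ⊗≫ 𝟙 _ := by
        rw [whisker_exchange]; monoidal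
      _ = _ := by rw [a.zigzag, b.zigzag]; monoidal

/-- Uniqueness of twisted duals: the mate of `ev` carries `coev` to the standard one. -/
theorem TwistedDual.coev_mate {A A' : C} (a : TwistedDual A A') :
    ∃ z : A' ⟶ Aᘁ, z ▷ A ≫ ε_ A (Aᘁ) = a.ev ∧ a.coev ≫ z ▷ A = coevTilde A := by
  let z : A' ⟶ Aᘁ := 𝟙 _ ⊗≫ A' ◁ η_ A (Aᘁ) ⊗≫ a.ev ▷ Aᘁ ⊗≫ 𝟙 _
  have hz : z ▷ A ≫ ε_ A (Aᘁ) = a.ev := by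
    calc
      _ = 𝟙 _ ⊗≫ A' ◁ η_ A (Aᘁ) ▷ A ⊗≫ (a.ev ▷ (Aᘁ ⊗ A) ≫ (𝟙_ C) ◁ ε_ A (Aᘁ)) ⊗≫ 𝟙 _ := by
        monoidal
      _ = 𝟙 _ ⊗≫ A' ◁ (η_ A (Aᘁ) ▷ A ⊗≫ A ◁ ε_ A (Aᘁ)) ⊗≫ a.ev ⊗≫ 𝟙 _ := by
        rw [← whisker_exchange]; monoidal
      _ = _ := by rw [ExactPairing.evaluation_coevaluation'']; monoidal
  refine ⟨z, hz, ?_⟩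
  have h1 : A ◁ (a.coev ≫ z ▷ A) ⊗≫ evTilde A ▷ A = 𝟙 _ ⊗≫ 𝟙 _ := by
    rw [← a.zigzag, ← hz, evTilde_eq, ← whiskerLeft_tilde]; monoidal
  calc
    _ = 𝟙 (𝟙_ C) ⊗≫ (𝟙_ C) ◁ (a.coev ≫ z ▷ A) ⊗≫ (𝟙 ((𝟙_ C) ⊗ Aᘁ) ⊗≫ 𝟙 (Aᘁ ⊗ 𝟙_ C)) ▷ A ⊗≫ 𝟙 (Aᘁ ⊗ A) := by monoidal
    _ = 𝟙 (𝟙_ C) ⊗≫ ((𝟙_ C) ◁ (a.coev ≫ z ▷ A) ≫ coevTilde A ▷ (Aᘁ ⊗ A)) ⊗≫ Aᘁ ◁ evTilde A ▷ A ⊗≫ 𝟙 (Aᘁ ⊗ A) := by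
      rw [← evTilde_coevTilde]; monoidal
    _ = coevTilde A ⊗≫ Aᘁ ◁ (A ◁ (a.coev ≫ z ▷ A) ⊗≫ evTilde A ▷ A) ⊗≫ 𝟙 _ := by
      rw [whisker_exchange]; monoidal
    _ = _ := by rw [h1]; monoidal

theorem coevTilde_naturality {A B : C} (f : A ⟶ B) :
    coevTilde A ≫ Aᘁ ◁ f = coevTilde B ≫ (fᘁ) ▷ B := by
  simp only [coevTilde, Category.assoc]
  rw [← BraidedCategory.braiding_naturality_left, ← comp_whiskerRight_assoc, ← twist_naturality,
    ← BraidedCategory.braiding_naturality_right, comp_whiskerRight_assoc,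
    ← coevaluation_comp_rightAdjointMate_assoc, whisker_exchange_assoc]

end Ribbon

/-! ### Crossings that slide past one another, and pairs of strands acting on an object. -/

section Actions

variable {C : Type u} [Category.{v} C] [MonoidalCategory C]

/-- The crossings of `L` past `W` commute with the crossing of `B` by `N`, where `B` crosses the
other objects by `b₁` before and by `b₂` after. -/
def ExchAt {W B : C} (b₁ b₂ : HalfBraiding B) (L N : HalfBraiding W) : Prop :=
  ∀ A : C, (A ◁ cross N B ⊗≫ cross L A ▷ B ⊗≫ W ◁ cross b₂ A : A ⊗ (B ⊗ W) ⟶ W ⊗ (B ⊗ A)) =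
      𝟙 _ ⊗≫ cross b₁ A ▷ W ⊗≫ B ◁ cross L A ⊗≫ cross N B ▷ A ⊗≫ 𝟙 _

/-- Passing `X` changes the half-braiding of `B` from `b₁` to `b₂`, and passing `Y` from `b₂` to
`b₃`. This chaining is why `ExchAt` records one half-braiding before and one after: COMM goes from
`hbNeg` to `hbPos`. -/
theorem ExchAt.tensor {X Y B : C} {b₁ b₂ b₃ : HalfBraiding B} {l n : HalfBraiding X}
    {l' n' : HalfBraiding Y} (h : ExchAt b₁ b₂ l n) (h' : ExchAt b₂ b₃ l' n') :
    ExchAt b₁ b₃ (hbTensor l l') (hbTensor n n') := by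
  intro A
  simp only [cross_hbTensor]
  calc
    _ = 𝟙 _ ⊗≫ A ◁ cross n B ▷ Y ⊗≫ (A ⊗ X) ◁ cross n' B ⊗≫ cross l A ▷ (Y ⊗ B) ⊗≫
        X ◁ cross l' A ▷ B ⊗≫ (X ⊗ Y) ◁ cross b₃ A := by monoidal
    _ = 𝟙 _ ⊗≫ A ◁ cross n B ▷ Y ⊗≫ ((A ⊗ X) ◁ cross n' B ≫ cross l A ▷ (Y ⊗ B)) ⊗≫
        X ◁ cross l' A ▷ B ⊗≫ (X ⊗ Y) ◁ cross b₃ A := by monoidal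
    _ = 𝟙 _ ⊗≫ A ◁ cross n B ▷ Y ⊗≫ cross l A ▷ (B ⊗ Y) ⊗≫
        X ◁ (A ◁ cross n' B ⊗≫ cross l' A ▷ B ⊗≫ Y ◁ cross b₃ A) ⊗≫ 𝟙 _ := by
      rw [whisker_exchange]; monoidal
    _ = 𝟙 _ ⊗≫ (A ◁ cross n B ⊗≫ cross l A ▷ B ⊗≫ X ◁ cross b₂ A) ▷ Y ⊗≫
        (X ⊗ B) ◁ cross l' A ⊗≫ X ◁ cross n' B ▷ A ⊗≫ 𝟙 _ := by
      rw [h']; monoidal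
    _ = 𝟙 _ ⊗≫ cross b₁ A ▷ (X ⊗ Y) ⊗≫ B ◁ cross l A ▷ Y ⊗≫
        (cross n B ▷ (A ⊗ Y) ≫ (X ⊗ B) ◁ cross l' A) ⊗≫ X ◁ cross n' B ▷ A ⊗≫ 𝟙 _ := by
      rw [h]; monoidal
    _ = _ := by rw [← whisker_exchange]; monoidal

theorem ExchAt.of_mono {V W B : C} {b₁ b₂ : HalfBraiding B} {L N : HalfBraiding W}
    {L' N' : HalfBraiding V} (h : ExchAt b₁ b₂ L N) {f : V ⟶ W} {g : W ⟶ V} (hfg : f ≫ g = 𝟙 V)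
    (hL : Intertwines L' L f) (hN : Intertwines N' N f) : ExchAt b₁ b₂ L' N' := by
  intro A
  have hm : ∀ {P : C} {a b : P ⟶ V ⊗ (B ⊗ A)}, a ≫ f ▷ (B ⊗ A) = b ≫ f ▷ (B ⊗ A) → a = b := by
    intro P a b hab
    have := congrArg (· ≫ g ▷ (B ⊗ A)) hab
    simpa only [Category.assoc, ← comp_whiskerRight, hfg, id_whiskerRight, Category.comp_id] using this
  apply hm
  calc
    _ = A ◁ cross N' B ⊗≫ cross L' A ▷ B ⊗≫ (V ◁ cross b₂ A ≫ f ▷ (B ⊗ A)) := by monoidal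
    _ = A ◁ cross N' B ⊗≫ (cross L' A ≫ f ▷ A) ▷ B ⊗≫ W ◁ cross b₂ A := by
      rw [whisker_exchange]; monoidal
    _ = A ◁ (cross N' B ≫ f ▷ B) ⊗≫ cross L A ▷ B ⊗≫ W ◁ cross b₂ A := by
      rw [hL]; monoidal
    _ = A ◁ B ◁ f ⊗≫ (A ◁ cross N B ⊗≫ cross L A ▷ B ⊗≫ W ◁ cross b₂ A) := by
      rw [hN]; monoidal
    _ = 𝟙 _ ⊗≫ ((A ⊗ B) ◁ f ≫ cross b₁ A ▷ W) ⊗≫ B ◁ cross L A ⊗≫ cross N B ▷ A ⊗≫ 𝟙 _ := by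
      rw [h]; monoidal
    _ = 𝟙 _ ⊗≫ cross b₁ A ▷ V ⊗≫ B ◁ (A ◁ f ≫ cross L A) ⊗≫ cross N B ▷ A ⊗≫ 𝟙 _ := by
      rw [whisker_exchange]; monoidal
    _ = 𝟙 _ ⊗≫ cross b₁ A ▷ V ⊗≫ B ◁ cross L' A ⊗≫ (B ◁ f ≫ cross N B) ▷ A ⊗≫ 𝟙 _ := by
      rw [← hL]; monoidal
    _ = _ := by rw [← hN]; monoidal

/-- A closed-off strand may be pulled across `B`: naturality of the half-braiding at `t`, plus
triviality of the unit crossing. -/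
theorem cross_pairing {B P : C} (b : HalfBraiding B) (t : P ⟶ 𝟙_ C) :
    t ▷ B = cross b P ≫ B ◁ t ⊗≫ 𝟙 _ := by
  calc
    _ = (t ▷ B ≫ cross b (𝟙_ C)) ⊗≫ 𝟙 _ := by rw [cross_unit]; monoidal
    _ = _ := by rw [cross_naturality]; monoidal

theorem cross_copairing {B P : C} (b : HalfBraiding B) (t : 𝟙_ C ⟶ P) :
    t ▷ B ≫ cross b P = 𝟙 _ ⊗≫ B ◁ t := by
  rw [cross_naturality, cross_unit]; monoidal

variable [BraidedCategory C]

theorem comm_iff {X : C} (l₁ l₂ : HalfBraiding X) :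
    COMM l₁ l₂ ↔ ∀ B, ExchAt (hbNeg B) (hbPos B) l₁ l₂ :=
  ⟨fun h B A => h A B, fun h A B => h B A⟩

/-- This and the next relations hold for every half-braiding. When one of the two crossings of `Y`
is a braiding, naturality of the braiding slides it past the other crossing; when both are the same
half-braiding `L`, naturality of `L` at the braiding of `A` and `B` does. -/
theorem exchAt_hbPos_left {Y : C} (n : HalfBraiding Y) (B : C) :
    ExchAt (hbPos B) (hbPos B) (hbPos Y) n := by
  intro A
  simp only [cross_hbPos]
  calc
    _ = (A ◁ cross n B ≫ (β_ A (Y ⊗ B)).hom) ⊗≫ 𝟙 _ := by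
      rw [BraidedCategory.braiding_tensor_right_hom]; monoidal
    _ = _ := by
      rw [BraidedCategory.braiding_naturality_right, BraidedCategory.braiding_tensor_right_hom]
      monoidal

theorem exchAt_hbNeg_left {Y : C} (n : HalfBraiding Y) (B : C) :
    ExchAt (hbNeg B) (hbNeg B) (hbNeg Y) n := by
  intro A
  simp only [cross_hbNeg]
  calc
    _ = (A ◁ cross n B ≫ (β_ (Y ⊗ B) A).inv) ⊗≫ 𝟙 _ := by
      rw [BraidedCategory.braiding_tensor_left_inv]; monoidal
    _ = _ := by
      rw [BraidedCategory.braiding_inv_naturality_right, BraidedCategory.braiding_tensor_left_inv]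
      monoidal

theorem exchAt_hbNeg_right {Y : C} (l : HalfBraiding Y) (B : C) :
    ExchAt (hbPos B) (hbPos B) l (hbNeg Y) := by
  intro A
  simp only [cross_hbPos, cross_hbNeg]
  have h : cross l A ▷ B ≫ (β_ (Y ⊗ A) B).hom = (β_ (A ⊗ Y) B).hom ≫ B ◁ cross l A :=
    BraidedCategory.braiding_naturality_left _ _
  simp only [BraidedCategory.braiding_tensor_left_hom] at h
  calc
    _ = 𝟙 _ ⊗≫ A ◁ (β_ Y B).inv ⊗≫ (cross l A ▷ B ≫ (α_ Y A B).hom ≫ Y ◁ (β_ A B).hom ≫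
        (α_ Y B A).inv ≫ (β_ Y B).hom ▷ A ≫ (α_ B Y A).hom) ⊗≫ (β_ Y B).inv ▷ A ⊗≫ 𝟙 _ := by
      calc
        _ = A ◁ (β_ Y B).inv ⊗≫ cross l A ▷ B ⊗≫ Y ◁ (β_ A B).hom ⊗≫
            ((β_ Y B).hom ≫ (β_ Y B).inv) ▷ A ⊗≫ 𝟙 _ := by rw [Iso.hom_inv_id]; monoidal
        _ = _ := by monoidal
    _ = 𝟙 _ ⊗≫ A ◁ ((β_ Y B).inv ≫ (β_ Y B).hom) ⊗≫ (β_ A B).hom ▷ Y ⊗≫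
        B ◁ cross l A ⊗≫ (β_ Y B).inv ▷ A ⊗≫ 𝟙 _ := by
      rw [h]; monoidal
    _ = _ := by rw [Iso.inv_hom_id]; monoidal

theorem exchAt_hbPos_self {W : C} (L : HalfBraiding W) (B : C) :
    ExchAt (hbPos B) (hbPos B) L L := by
  intro A
  simp only [cross_hbPos]
  calc
    _ = 𝟙 _ ⊗≫ (cross L (A ⊗ B) ≫ W ◁ (β_ A B).hom) := by rw [cross_tensor]; monoidal
    _ = _ := by rw [← cross_naturality, cross_tensor]; monoidal

theorem exchAt_hbNeg_self {W : C} (L : HalfBraiding W) (B : C) :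
    ExchAt (hbNeg B) (hbNeg B) L L := by
  intro A
  simp only [cross_hbNeg]
  calc
    _ = 𝟙 _ ⊗≫ (cross L (A ⊗ B) ≫ W ◁ (β_ B A).inv) := by rw [cross_tensor]; monoidal
    _ = _ := by rw [← cross_naturality, cross_tensor]; monoidal

/-- Exchanging the roles of the two half-braidings reverses the braiding. -/
theorem ExchAt.swap {W : C} {L R : HalfBraiding W}
    (h : ∀ B, ExchAt (hbPos B) (hbPos B) L R) (B : C) : ExchAt (hbNeg B) (hbNeg B) R L := by
  intro A
  have h1 := h A B
  simp only [cross_hbPos] at h1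
  simp only [cross_hbNeg]
  calc
    _ = 𝟙 _ ⊗≫ ((β_ B A).inv ≫ (β_ B A).hom) ▷ W ⊗≫ A ◁ cross L B ⊗≫ cross R A ▷ B ⊗≫
        W ◁ (β_ B A).inv := by rw [Iso.inv_hom_id]; monoidal
    _ = 𝟙 _ ⊗≫ (β_ B A).inv ▷ W ⊗≫ (𝟙 (B ⊗ (A ⊗ W)) ⊗≫ (β_ B A).hom ▷ W ⊗≫ A ◁ cross L B ⊗≫
        cross R A ▷ B ⊗≫ 𝟙 (W ⊗ (A ⊗ B))) ⊗≫ W ◁ (β_ B A).inv := by monoidal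
    _ = 𝟙 _ ⊗≫ (β_ B A).inv ▷ W ⊗≫ B ◁ cross R A ⊗≫ cross L B ▷ A ⊗≫
        W ◁ ((β_ B A).hom ≫ (β_ B A).inv) ⊗≫ 𝟙 _ := by rw [← h1]; monoidal
    _ = _ := by rw [Iso.hom_inv_id]; monoidal

variable [RightRigidCategory C] [RibbonCategory C]

/-- `S` and `Z` are moved past `W` by `R` and `L` and then paired. -/
def act {S Z W : C} (e : Z ⊗ S ⟶ 𝟙_ C) (L R : HalfBraiding W) : (S ⊗ Z) ⊗ W ⟶ W :=
  𝟙 _ ⊗≫ S ◁ cross L Z ⊗≫ cross R S ▷ Z ⊗≫ W ◁ tilde e ⊗≫ 𝟙 _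

/-- With `whiskerLeft_act`, the dinaturality that lets `act` descend to the coend `⨁ X_j ⊗ X_j^*`.
-/
theorem whiskerRight_act {S T Z W : C} (f : S ⟶ T) (e : Z ⊗ T ⟶ 𝟙_ C) (L R : HalfBraiding W) :
    f ▷ Z ▷ W ≫ act e L R = act (Z ◁ f ≫ e) L R := by
  simp only [act]
  calc
    _ = 𝟙 _ ⊗≫ (f ▷ (Z ⊗ W) ≫ T ◁ cross L Z) ⊗≫ cross R T ▷ Z ⊗≫ W ◁ tilde e ⊗≫ 𝟙 _ := by monoidal
    _ = 𝟙 _ ⊗≫ S ◁ cross L Z ⊗≫ (f ▷ W ≫ cross R T) ▷ Z ⊗≫ W ◁ tilde e ⊗≫ 𝟙 _ := by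
      rw [← whisker_exchange]; monoidal
    _ = _ := by rw [cross_naturality, ← whiskerRight_tilde]; monoidal

theorem whiskerLeft_act {S Z Z' W : C} (g : Z' ⟶ Z) (e : Z ⊗ S ⟶ 𝟙_ C) (L R : HalfBraiding W) :
    (S ◁ g) ▷ W ≫ act e L R = act (g ▷ S ≫ e) L R := by
  simp only [act]
  calc
    _ = 𝟙 _ ⊗≫ S ◁ (g ▷ W ≫ cross L Z) ⊗≫ cross R S ▷ Z ⊗≫ W ◁ tilde e ⊗≫ 𝟙 _ := by monoidal
    _ = 𝟙 _ ⊗≫ S ◁ cross L Z' ⊗≫ ((S ⊗ W) ◁ g ≫ cross R S ▷ Z) ⊗≫ W ◁ tilde e ⊗≫ 𝟙 _ := by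
      rw [cross_naturality]; monoidal
    _ = _ := by rw [whisker_exchange, ← whiskerLeft_tilde]; monoidal

/-- A crossing `N` of `W` compatible with `L` and `R` passes through `act e L R`. -/
theorem act_exchange {S Z W B : C} (e : Z ⊗ S ⟶ 𝟙_ C) {L R N : HalfBraiding W}
    {bL bR b : HalfBraiding B} (hL : ExchAt bL b L N) (hR : ExchAt bR b R N) :
    ((S ⊗ Z) ◁ cross N B ⊗≫ act e L R ▷ B : (S ⊗ Z) ⊗ (B ⊗ W) ⟶ W ⊗ B) =
      𝟙 _ ⊗≫ S ◁ cross bL Z ▷ W ⊗≫ cross bR S ▷ (Z ⊗ W) ⊗≫ B ◁ act e L R ≫ cross N B := by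
  simp only [act]
  calc
    _ = 𝟙 _ ⊗≫ S ◁ (Z ◁ cross N B ⊗≫ cross L Z ▷ B) ⊗≫ cross R S ▷ (Z ⊗ B) ⊗≫
        W ◁ (tilde e ▷ B) ⊗≫ 𝟙 _ := by monoidal
    _ = 𝟙 _ ⊗≫ S ◁ (Z ◁ cross N B ⊗≫ cross L Z ▷ B) ⊗≫ (cross R S ▷ (Z ⊗ B) ≫
        (W ⊗ S) ◁ cross b Z) ⊗≫ W ◁ cross b S ▷ Z ⊗≫ W ◁ B ◁ tilde e ⊗≫ 𝟙 _ := by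
      rw [cross_pairing b (tilde e), cross_tensor]; monoidal
    _ = 𝟙 _ ⊗≫ S ◁ (Z ◁ cross N B ⊗≫ cross L Z ▷ B ⊗≫ W ◁ cross b Z) ⊗≫
        cross R S ▷ (B ⊗ Z) ⊗≫ W ◁ cross b S ▷ Z ⊗≫ W ◁ B ◁ tilde e ⊗≫ 𝟙 _ := by
      rw [← whisker_exchange]; monoidal
    _ = 𝟙 _ ⊗≫ S ◁ cross bL Z ▷ W ⊗≫ S ◁ B ◁ cross L Z ⊗≫
        (S ◁ cross N B ⊗≫ cross R S ▷ B ⊗≫ W ◁ cross b S) ▷ Z ⊗≫ W ◁ B ◁ tilde e ⊗≫ 𝟙 _ := by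
      rw [hL]; monoidal
    _ = 𝟙 _ ⊗≫ S ◁ cross bL Z ▷ W ⊗≫ ((S ⊗ B) ◁ cross L Z ≫ cross bR S ▷ (W ⊗ Z)) ⊗≫
        B ◁ cross R S ▷ Z ⊗≫ (cross N B ▷ (S ⊗ Z) ≫ (W ⊗ B) ◁ tilde e) ⊗≫ 𝟙 _ := by
      rw [hR]; monoidal
    _ = _ := by
      rw [whisker_exchange (cross bR S) (cross L Z), ← whisker_exchange (cross N B) (tilde e)]
      monoidal

/-- Absorbing an object `A` into the acting pair. -/
theorem act_nest {A A' S Z W : C} (a : TwistedDual A A') (e : Z ⊗ S ⟶ 𝟙_ C)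
    (L R : HalfBraiding W) :
    (𝟙 _ ⊗≫ (A ⊗ S ⊗ Z) ◁ a.coev ▷ W ⊗≫ ((A ⊗ S) ⊗ (Z ⊗ A')) ◁ cross L A ⊗≫
      act (nest a.ev e) L R ▷ A : A ⊗ ((S ⊗ Z) ⊗ W) ⟶ W ⊗ A) =
      A ◁ act e L R ≫ cross R A := by
  simp only [act, cross_tensor, tilde_nest]
  calc
    _ = 𝟙 _ ⊗≫ (A ⊗ S ⊗ Z) ◁ (a.coev ▷ W ≫ (𝟙 ((A' ⊗ A) ⊗ W) ⊗≫ A' ◁ cross L A ⊗≫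
          cross L A' ▷ A ⊗≫ 𝟙 (W ⊗ A' ⊗ A))) ⊗≫ A ◁ S ◁ cross L Z ▷ (A' ⊗ A) ⊗≫
        A ◁ cross R S ▷ (Z ⊗ A' ⊗ A) ⊗≫ cross R A ▷ (S ⊗ Z ⊗ A' ⊗ A) ⊗≫
        (W ⊗ A) ◁ tilde e ▷ (A' ⊗ A) ⊗≫ W ◁ tilde a.ev ▷ A ⊗≫ 𝟙 _ := by monoidal
    -- The pair `A'`, `A` born to the left of `W` has crossed it by `L` as a whole, so it may as
    -- well be born to its right.
    _ = 𝟙 _ ⊗≫ ((A ⊗ S ⊗ Z ⊗ W) ◁ a.coev ≫ (A ◁ (𝟙 (S ⊗ Z ⊗ W) ⊗≫ S ◁ cross L Z ⊗≫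
          cross R S ▷ Z ⊗≫ 𝟙 (W ⊗ S ⊗ Z))) ▷ (A' ⊗ A)) ⊗≫
        (cross R A ▷ (S ⊗ Z) ≫ (W ⊗ A) ◁ tilde e) ▷ (A' ⊗ A) ⊗≫ W ◁ tilde a.ev ▷ A ⊗≫ 𝟙 _ := by
      rw [← cross_tensor, cross_copairing]; monoidal
    _ = 𝟙 _ ⊗≫ A ◁ (𝟙 (S ⊗ Z ⊗ W) ⊗≫ S ◁ cross L Z ⊗≫
          cross R S ▷ Z ⊗≫ 𝟙 (W ⊗ S ⊗ Z)) ⊗≫ ((A ⊗ W ⊗ S ⊗ Z) ◁ a.coev ≫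
        (𝟙 (A ⊗ W ⊗ S ⊗ Z) ⊗≫ (A ⊗ W) ◁ tilde e ⊗≫ cross R A ▷ 𝟙_ C) ▷ (A' ⊗ A)) ⊗≫
        W ◁ tilde a.ev ▷ A ⊗≫ 𝟙 _ := by
      rw [whisker_exchange _ a.coev, ← whisker_exchange (cross R A) (tilde e)]; monoidal
    _ = 𝟙 _ ⊗≫ A ◁ (𝟙 (S ⊗ Z ⊗ W) ⊗≫ S ◁ cross L Z ⊗≫
          cross R S ▷ Z ⊗≫ 𝟙 (W ⊗ S ⊗ Z)) ⊗≫
        (𝟙 (A ⊗ W ⊗ S ⊗ Z) ⊗≫ (A ⊗ W) ◁ tilde e ⊗≫ cross R A ▷ 𝟙_ C) ⊗≫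
        W ◁ (A ◁ a.coev ⊗≫ tilde a.ev ▷ A) ⊗≫ 𝟙 _ := by
      rw [whisker_exchange]; monoidal
    -- What remains of the absorbed strand is a zigzag, so only the crossing of `A` by `R` survives.
    _ = _ := by rw [a.zigzag]; monoidal

end Actions

/-! ### Loops around an object with two half-braidings. -/

section Loops

variable {C : Type u} [Category.{v} C] [MonoidalCategory C] [BraidedCategory C]
  [RightRigidCategory C] [RibbonCategory C]

/-- The loop coloured by `S` around `W`, crossing by `L` and returning by `R`. -/
def encircle {W : C} (L R : HalfBraiding W) (S : C) : W ⟶ W :=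
  (λ_ W).inv ≫ η_ S (Sᘁ) ▷ W ≫ act (ε_ S (Sᘁ)) L R

/-- The two middle crossings of the loop involve disjoint strands and commute. Afterwards `X ⊗ Y` is
a single object with two half-braidings, and `Q` becomes an instance of a general averaging
construction. -/
theorem loop_eq_encircle {X Y : C} (l : HalfBraiding X) (m : HalfBraiding Y) (S : C) :
    loop l m S = encircle (hbTensor l (hbPos Y)) (hbTensor (hbNeg X) m) S := by
  simp only [loop, encircle, act, cross_hbTensor, cross_hbPos, cross_hbNeg, evTilde_eq]
  calc
    _ = 𝟙 _ ⊗≫ η_ S (Sᘁ) ▷ (X ⊗ Y) ⊗≫ S ◁ cross l (Sᘁ) ▷ Y ⊗≫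
        ((β_ X S).inv ▷ (Sᘁ ⊗ Y) ≫ (X ⊗ S) ◁ (β_ (Sᘁ) Y).hom) ⊗≫
        X ◁ cross m S ▷ (Sᘁ) ⊗≫ (X ⊗ Y) ◁ tilde (ε_ S (Sᘁ)) ⊗≫ 𝟙 _ := by monoidal
    _ = _ := by rw [← whisker_exchange]; monoidal

/-- Both strands of the loop cross `X` in the same way, so the loop slides off `X`. With
`encircle_hbPos` this lets a `Q` on two neighbouring factors be read as an average on a triple
product. -/
theorem encircle_hbNeg (X : C) {W : C} (L R : HalfBraiding W) (S : C) :
    encircle (hbTensor (hbNeg X) L) (hbTensor (hbNeg X) R) S = X ◁ encircle L R S := by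
  simp only [encircle, act, cross_hbTensor]
  calc
    _ = 𝟙 _ ⊗≫ η_ S (Sᘁ) ▷ (X ⊗ W) ⊗≫ S ◁ cross (hbNeg X) (Sᘁ) ▷ W ⊗≫
        ((S ⊗ X) ◁ cross L (Sᘁ) ≫ cross (hbNeg X) S ▷ (W ⊗ Sᘁ)) ⊗≫ X ◁ cross R S ▷ Sᘁ ⊗≫
        (X ⊗ W) ◁ tilde (ε_ S (Sᘁ)) ⊗≫ 𝟙 _ := by monoidal
    _ = 𝟙 _ ⊗≫ (η_ S (Sᘁ) ▷ X ≫ (𝟙 ((S ⊗ Sᘁ) ⊗ X) ⊗≫ S ◁ cross (hbNeg X) (Sᘁ) ⊗≫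
          cross (hbNeg X) S ▷ Sᘁ ⊗≫ 𝟙 (X ⊗ S ⊗ Sᘁ))) ▷ W ⊗≫
        X ◁ S ◁ cross L (Sᘁ) ⊗≫ X ◁ cross R S ▷ Sᘁ ⊗≫
        (X ⊗ W) ◁ tilde (ε_ S (Sᘁ)) ⊗≫ 𝟙 _ := by rw [whisker_exchange]; monoidal
    _ = _ := by rw [← cross_tensor, cross_copairing]; monoidal

theorem encircle_hbPos (Z : C) {W : C} (L R : HalfBraiding W) (S : C) :
    encircle (hbTensor L (hbPos Z)) (hbTensor R (hbPos Z)) S = encircle L R S ▷ Z := by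
  simp only [encircle, act, cross_hbTensor]
  calc
    _ = 𝟙 _ ⊗≫ η_ S (Sᘁ) ▷ (W ⊗ Z) ⊗≫ S ◁ cross L (Sᘁ) ▷ Z ⊗≫
        ((S ⊗ W) ◁ cross (hbPos Z) (Sᘁ) ≫ cross R S ▷ (Z ⊗ Sᘁ)) ⊗≫ W ◁ cross (hbPos Z) S ▷ Sᘁ ⊗≫
        W ◁ Z ◁ tilde (ε_ S (Sᘁ)) ⊗≫ 𝟙 _ := by monoidal
    _ = 𝟙 _ ⊗≫ η_ S (Sᘁ) ▷ (W ⊗ Z) ⊗≫ S ◁ cross L (Sᘁ) ▷ Z ⊗≫ cross R S ▷ (Sᘁ ⊗ Z) ⊗≫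
        W ◁ ((𝟙 ((S ⊗ Sᘁ) ⊗ Z) ⊗≫ S ◁ cross (hbPos Z) (Sᘁ) ⊗≫ cross (hbPos Z) S ▷ Sᘁ ⊗≫
          𝟙 (Z ⊗ S ⊗ Sᘁ)) ≫ Z ◁ tilde (ε_ S (Sᘁ)) ⊗≫ 𝟙 ((𝟙_ C) ⊗ Z)) ⊗≫ 𝟙 _ := by
      rw [whisker_exchange]; monoidal
    _ = _ := by rw [← cross_tensor, ← cross_pairing]; monoidal

/-- Maps on which `L` and `R` agree absorb loops. -/
theorem comp_encircle {V W : C} (L R : HalfBraiding W) (f : V ⟶ W)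
    (h : ∀ A : C, A ◁ f ≫ cross L A = A ◁ f ≫ cross R A) (S : C) :
    f ≫ encircle L R S = 𝟙 _ ⊗≫ trace (𝟙 S) ▷ V ⊗≫ f := by
  simp only [encircle, act, trace, evTilde_eq]
  calc
    _ = 𝟙 _ ⊗≫ ((𝟙_ C) ◁ f ≫ η_ S (Sᘁ) ▷ W) ⊗≫ S ◁ cross L (Sᘁ) ⊗≫ cross R S ▷ Sᘁ ⊗≫
        W ◁ tilde (ε_ S (Sᘁ)) ⊗≫ 𝟙 _ := by monoidal
    _ = 𝟙 _ ⊗≫ η_ S (Sᘁ) ▷ V ⊗≫ S ◁ (Sᘁ ◁ f ≫ cross L (Sᘁ)) ⊗≫ cross R S ▷ Sᘁ ⊗≫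
        W ◁ tilde (ε_ S (Sᘁ)) ⊗≫ 𝟙 _ := by rw [whisker_exchange]; monoidal
    _ = 𝟙 _ ⊗≫ η_ S (Sᘁ) ▷ V ⊗≫ (S ⊗ Sᘁ) ◁ f ⊗≫ (𝟙 ((S ⊗ Sᘁ) ⊗ W) ⊗≫ S ◁ cross R (Sᘁ) ⊗≫
        cross R S ▷ Sᘁ ⊗≫ 𝟙 (W ⊗ S ⊗ Sᘁ)) ≫ W ◁ tilde (ε_ S (Sᘁ)) ⊗≫ 𝟙 _ := by
      rw [h]; monoidal
    _ = 𝟙 _ ⊗≫ η_ S (Sᘁ) ▷ V ⊗≫ ((S ⊗ Sᘁ) ◁ f ≫ tilde (ε_ S (Sᘁ)) ▷ W) ⊗≫ 𝟙 _ := by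
      rw [← cross_tensor, cross_pairing R (tilde _)]; monoidal
    _ = _ := by rw [whisker_exchange]; monoidal

/-- Maps after which `L` and `R` agree absorb loops. -/
theorem encircle_comp {V W : C} (L R : HalfBraiding W) (g : W ⟶ V)
    (h : ∀ A : C, cross L A ≫ g ▷ A = cross R A ≫ g ▷ A) (S : C) :
    encircle L R S ≫ g = g ⊗≫ trace (𝟙 S) ▷ V ⊗≫ 𝟙 _ := by
  simp only [encircle, act, trace, evTilde_eq]
  calc
    _ = 𝟙 _ ⊗≫ η_ S (Sᘁ) ▷ W ⊗≫ S ◁ cross L (Sᘁ) ⊗≫ cross R S ▷ Sᘁ ⊗≫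
        (W ◁ tilde (ε_ S (Sᘁ)) ≫ g ▷ 𝟙_ C) ⊗≫ 𝟙 _ := by monoidal
    _ = 𝟙 _ ⊗≫ η_ S (Sᘁ) ▷ W ⊗≫ S ◁ cross L (Sᘁ) ⊗≫ (cross R S ≫ g ▷ S) ▷ Sᘁ ⊗≫
        V ◁ tilde (ε_ S (Sᘁ)) ⊗≫ 𝟙 _ := by rw [whisker_exchange]; monoidal
    _ = 𝟙 _ ⊗≫ (η_ S (Sᘁ) ▷ W ≫ (𝟙 ((S ⊗ Sᘁ) ⊗ W) ⊗≫ S ◁ cross L (Sᘁ) ⊗≫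
        cross L S ▷ Sᘁ ⊗≫ 𝟙 (W ⊗ S ⊗ Sᘁ))) ⊗≫ g ▷ (S ⊗ Sᘁ) ⊗≫ V ◁ tilde (ε_ S (Sᘁ)) ⊗≫ 𝟙 _ := by
      rw [← h]; monoidal
    _ = 𝟙 _ ⊗≫ (W ◁ η_ S (Sᘁ) ≫ g ▷ (S ⊗ Sᘁ)) ⊗≫ V ◁ tilde (ε_ S (Sᘁ)) ⊗≫ 𝟙 _ := by
      rw [← cross_tensor, cross_copairing]; monoidal
    _ = 𝟙 _ ⊗≫ g ⊗≫ (𝟙 (V ⊗ 𝟙_ C) ⊗≫ 𝟙 (𝟙_ C ⊗ V)) ⊗≫ (V ◁ (η_ S (Sᘁ) ≫ tilde (ε_ S (Sᘁ)))) ⊗≫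
        𝟙 _ := by rw [whisker_exchange]; monoidal
    -- The closed loop stands to the right of `V`; naturality of the braiding carries this
    -- endomorphism of `𝟙` to the left.
    _ = 𝟙 _ ⊗≫ g ⊗≫ ((η_ S (Sᘁ) ≫ tilde (ε_ S (Sᘁ))) ▷ V ≫ cross (hbPos V) (𝟙_ C)) ⊗≫
        𝟙 _ := by rw [cross_naturality, cross_unit]; monoidal
    _ = _ := by rw [cross_unit]; monoidal

end Loops

/-! ### Traces: left and right, cyclic, partial. -/

section Traces

variable {C : Type u} [Category.{v} C] [MonoidalCategory C] [BraidedCategory C]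
  [RightRigidCategory C] [RibbonCategory C]

/-- Left and right traces are built from the same `η`, twist, braiding and `ε`; `f` only has to
slide through the twist and the braiding. -/
theorem trace_eq_left {A : C} (f : A ⟶ A) : trace f = coevTilde A ≫ Aᘁ ◁ f ≫ ε_ A (Aᘁ) := by
  simp only [trace, evTilde, coevTilde, Category.assoc]
  rw [← BraidedCategory.braiding_naturality_left_assoc, ← comp_whiskerRight_assoc,
    ← comp_whiskerRight_assoc, RibbonCategory.twist_naturality]

/-- Cyclicity of the trace, with respect to any choices of duals. -/
theorem trace_cyclic {S S' T T' : C} [ExactPairing S S'] [ExactPairing T T'] (f : S ⟶ T)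
    (g : T ⟶ S) : η_ S S' ≫ f ▷ S' ≫ g ▷ S' ≫ tilde (ε_ S S') =
      η_ T T' ≫ g ▷ T' ≫ f ▷ T' ≫ tilde (ε_ T T') := by
  -- The transpose of `f` for the given duals; `h1` and `h2` move `f` across a coevaluation and
  -- across an evaluation.
  let z : T' ⟶ S' := 𝟙 _ ⊗≫ T' ◁ (η_ S S' ≫ f ▷ S') ⊗≫ ε_ T T' ▷ S' ⊗≫ 𝟙 _
  have h1 : η_ S S' ≫ f ▷ S' = η_ T T' ≫ T ◁ z := by
    calc
      _ = 𝟙 _ ⊗≫ (η_ S S' ≫ f ▷ S') ⊗≫ (𝟙 (𝟙_ C ⊗ T) ⊗≫ 𝟙 (T ⊗ 𝟙_ C)) ▷ S' ⊗≫ 𝟙 _ := by monoidal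
      _ = 𝟙 _ ⊗≫ (𝟙_ C ◁ (η_ S S' ≫ f ▷ S') ≫ η_ T T' ▷ (T ⊗ S')) ⊗≫ T ◁ ε_ T T' ▷ S' ⊗≫ 𝟙 _ := by
        have h := ExactPairing.evaluation_coevaluation'' T T'
        have h' : (𝟙 (𝟙_ C ⊗ T) ⊗≫ 𝟙 (T ⊗ 𝟙_ C)) = η_ T T' ▷ T ⊗≫ T ◁ ε_ T T' := by
          rw [h]; monoidal
        rw [h']; monoidal
      _ = _ := by rw [whisker_exchange]; monoidal
  have h2 : z ▷ S ≫ ε_ S S' = T' ◁ f ≫ ε_ T T' := by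
    calc
      _ = 𝟙 _ ⊗≫ T' ◁ (η_ S S' ≫ f ▷ S') ▷ S ⊗≫ (ε_ T T' ▷ (S' ⊗ S) ≫ 𝟙_ C ◁ ε_ S S') ⊗≫ 𝟙 _ := by
        monoidal
      _ = 𝟙 _ ⊗≫ T' ◁ (η_ S S' ▷ S ⊗≫ (f ▷ (S' ⊗ S) ≫ T ◁ ε_ S S')) ⊗≫ ε_ T T' ⊗≫ 𝟙 _ := by
        rw [← whisker_exchange]; monoidal
      _ = 𝟙 _ ⊗≫ T' ◁ (η_ S S' ▷ S ⊗≫ S ◁ ε_ S S') ⊗≫ T' ◁ f ⊗≫ ε_ T T' ⊗≫ 𝟙 _ := by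
        rw [← whisker_exchange]; monoidal
      _ = _ := by rw [ExactPairing.evaluation_coevaluation'']; monoidal
  rw [reassoc_of% h1, whiskerRight_tilde, whiskerLeft_tilde, whiskerRight_tilde, whiskerRight_tilde]
  rw [← whisker_exchange_assoc, h2]

/-- The partial trace over the second factor. -/
def partialTrace {A S : C} (f : A ⊗ S ⟶ A ⊗ S) : A ⟶ A :=
  𝟙 _ ⊗≫ A ◁ η_ S (Sᘁ) ⊗≫ f ▷ Sᘁ ⊗≫ A ◁ evTilde S ⊗≫ 𝟙 _

/-- Cyclicity is applied with `Sᘁ ⊗ Aᘁ` as the dual of `A ⊗ S`. For it `tilde_nest` splits the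
evaluation into two nested ones, which is a trace of a partial trace. -/
theorem trace_partialTrace {A S T : C} (f : A ⊗ S ⟶ T) (g : T ⟶ A ⊗ S) :
    trace (partialTrace (f ≫ g)) = trace (g ≫ f) := by
  have h := trace_cyclic (S' := Sᘁ ⊗ Aᘁ) (T' := Tᘁ) f g
  have h2 : trace (g ≫ f) = η_ T (Tᘁ) ≫ g ▷ Tᘁ ≫ f ▷ Tᘁ ≫ tilde (ε_ T (Tᘁ)) := by
    rw [trace, comp_whiskerRight, Category.assoc, evTilde_eq]
  rw [h2, ← h]
  have h3 : ε_ (A ⊗ S) (Sᘁ ⊗ Aᘁ) = nest (ε_ A (Aᘁ)) (ε_ S (Sᘁ)) := by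
    rw [ExactPairing.tensor_evaluation, nest]
  rw [h3, tilde_nest, ExactPairing.tensor_coevaluation, trace, partialTrace, evTilde_eq, evTilde_eq]
  monoidal

/-- Two ways of closing a pair of maps `X ⟶ A^* ⊗ Y` and `Y ⟶ A ⊗ X`. -/
theorem trace_rotate {A X Y : C} (v : X ⟶ Aᘁ ⊗ Y) (q : Y ⟶ A ⊗ X) :
    trace (v ⊗≫ Aᘁ ◁ q ⊗≫ ε_ A (Aᘁ) ▷ X ⊗≫ 𝟙 _) =
      trace (q ⊗≫ A ◁ v ⊗≫ evTilde A ▷ Y ⊗≫ 𝟙 _) := by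
  let f : A ⊗ X ⟶ Y := A ◁ v ⊗≫ evTilde A ▷ Y ⊗≫ 𝟙 _
  have hv : v = 𝟙 _ ⊗≫ coevTilde A ▷ X ⊗≫ Aᘁ ◁ f := by
    calc
      _ = 𝟙 _ ⊗≫ v ⊗≫ (𝟙 (𝟙_ C ⊗ Aᘁ) ⊗≫ 𝟙 (Aᘁ ⊗ 𝟙_ C)) ▷ Y ⊗≫ 𝟙 _ := by monoidal
      _ = 𝟙 _ ⊗≫ (𝟙_ C ◁ v ≫ coevTilde A ▷ (Aᘁ ⊗ Y)) ⊗≫ Aᘁ ◁ evTilde A ▷ Y ⊗≫ 𝟙 _ := by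
        rw [← evTilde_coevTilde]; monoidal
      _ = _ := by rw [whisker_exchange]; monoidal
  have hq : q ⊗≫ A ◁ v ⊗≫ evTilde A ▷ Y ⊗≫ 𝟙 _ = q ≫ f := by monoidal
  clear_value f
  rw [hq, ← trace_partialTrace, trace_eq_left (partialTrace _), partialTrace, trace, hv]
  calc
    _ = η_ X (Xᘁ) ⊗≫ (coevTilde A ▷ X ⊗≫ Aᘁ ◁ (f ≫ q)) ▷ Xᘁ ⊗≫
        (ε_ A (Aᘁ) ▷ (X ⊗ Xᘁ) ≫ (𝟙_ C) ◁ evTilde X) ⊗≫ 𝟙 _ := by monoidal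
    _ = 𝟙 _ ⊗≫ ((𝟙_ C) ◁ η_ X (Xᘁ) ≫ coevTilde A ▷ (X ⊗ Xᘁ)) ⊗≫ Aᘁ ◁ (f ≫ q) ▷ Xᘁ ⊗≫
        Aᘁ ◁ A ◁ evTilde X ⊗≫ ε_ A (Aᘁ) ⊗≫ 𝟙 _ := by rw [← whisker_exchange]; monoidal
    _ = _ := by rw [whisker_exchange]; monoidal

end Traces

/-! ### Schur's lemma and decompositions into simple objects. -/

section Schur

theorem SimpleReps.eq_zero {C : Type u} [Category.{v} C] [Abelian C] {J : Type x}
    (Xs : SimpleReps C J) {i j : J} (h : i ≠ j) (f : Xs.obj i ⟶ Xs.obj j) : f = 0 := by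
  have := Xs.simple i
  have := Xs.simple j
  by_contra hf
  have := isIso_of_hom_simple hf
  exact h (Xs.injective i j ⟨asIso f⟩)

end Schur

section Semisimple

variable (k : Type w) [Field k] [IsAlgClosed k]
  {C : Type u} [Category.{v} C] [Abelian C] [Linear k C] [MonoidalCategory C] [IsFusion k C]

theorem scalar_smul (f : 𝟙_ C ⟶ 𝟙_ C) : scalar k f • 𝟙 (𝟙_ C) = f := (exists_scalar k f).choose_spec

theorem scalar_smul_id (c : k) : scalar k (c • 𝟙 (𝟙_ C)) = c := by
  have : Simple (𝟙_ C) := IsFusion.simple_unit k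
  have h := scalar_smul k (c • 𝟙 (𝟙_ C))
  rw [← sub_eq_zero, ← sub_smul, smul_eq_zero] at h
  exact sub_eq_zero.1 (h.resolve_right (id_nonzero _))

variable {J : Type x} (Xs : SimpleReps C J)

theorem SimpleReps.exists_smul {j : J} (f : Xs.obj j ⟶ Xs.obj j) : ∃ c : k, f = c • 𝟙 _ := by
  have := Xs.simple j
  have : FiniteDimensional k (Xs.obj j ⟶ Xs.obj j) := IsFusion.finiteDimensional_hom _ _
  obtain ⟨c, hc⟩ := endomorphism_simple_eq_smul_id k f
  exact ⟨c, hc.symm⟩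

variable [Fintype J]

/-- A decomposition of `S` into simple objects: dual bases of `Hom(S, X_j)` and `Hom(X_j, S)`. -/
structure Decomp (S : C) where
  n : J → ℕ
  p : ∀ j, Fin (n j) → (S ⟶ Xs.obj j)
  q : ∀ j, Fin (n j) → (Xs.obj j ⟶ S)
  orth : ∀ j a b, q j a ≫ p j b = if a = b then 𝟙 _ else 0
  complete : ∑ j, ∑ a, p j a ≫ q j a = 𝟙 S

open Classical in
-- The simple summands of `S` are grouped by the class `τ i` of the `i`-th summand; completeness is
-- the biproduct identity, re-indexed along the fibres of `τ`.
theorem exists_decomp (k : Type w) [Field k] {C : Type u} [Category.{v} C] [Abelian C]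
    [Linear k C] [MonoidalCategory C] [IsFusion k C] {J : Type x} [Fintype J]
    (Xs : SimpleReps C J) (S : C) : Nonempty (Decomp Xs S) := by
  have := Abelian.hasFiniteBiproducts (C := C)
  obtain ⟨n, T, hT, ⟨e⟩⟩ := IsFusion.semisimple k S
  choose τ hτ using fun i => Xs.exhaustive (T i) (hT i)
  let f := fun i => (hτ i).some
  let m : J → ℕ := fun j => Fintype.card {i // τ i = j}
  let E : ∀ j, Fin (m j) ≃ {i // τ i = j} := fun j => (Fintype.equivFin _).symm
  let p : ∀ j, {i // τ i = j} → (S ⟶ Xs.obj j) := fun j i =>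
    e.hom ≫ biproduct.π T i ≫ (f i).hom ≫ eqToHom (congrArg Xs.obj i.2)
  let q : ∀ j, {i // τ i = j} → (Xs.obj j ⟶ S) := fun j i =>
    eqToHom (congrArg Xs.obj i.2.symm) ≫ (f i).inv ≫ biproduct.ι T i ≫ e.inv
  refine ⟨⟨m, fun j a => p j (E j a), fun j a => q j (E j a), fun j a b => ?_, ?_⟩⟩
  · generalize ha : E j a = a'
    generalize hb : E j b = b'
    have hab : a = b ↔ a' = b' := by rw [← ha, ← hb, (E j).injective.eq_iff]
    simp only [hab]
    simp only [p, q, Category.assoc, Iso.inv_hom_id_assoc]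
    by_cases h : a' = b'
    · subst h; simp
    · have h' : a'.1 ≠ b'.1 := fun h' => h (Subtype.ext h')
      rw [biproduct.ι_π_ne_assoc _ h']; simp [h]
  · have h1 : ∀ j, ∑ a, p j (E j a) ≫ q j (E j a) = ∑ i : {i // τ i = j}, p j i ≫ q j i :=
      fun j => (E j).sum_comp fun i => p j i ≫ q j i
    simp only [h1]
    rw [← Fintype.sum_sigma' (fun j (i : {i // τ i = j}) => p j i ≫ q j i)]
    rw [← (Equiv.sigmaFiberEquiv τ).symm.sum_comp]
    have h2 : ∀ i, p ((Equiv.sigmaFiberEquiv τ).symm i).1 ((Equiv.sigmaFiberEquiv τ).symm i).2 ≫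
        q ((Equiv.sigmaFiberEquiv τ).symm i).1 ((Equiv.sigmaFiberEquiv τ).symm i).2 =
        e.hom ≫ (biproduct.π T i ≫ biproduct.ι T i) ≫ e.inv := by
      intro i
      simp [p, q, Equiv.sigmaFiberEquiv]
    simp only [h2]
    rw [← Preadditive.comp_sum, ← Preadditive.sum_comp, biproduct.total]
    simp

/-- A chosen decomposition. -/
def dec (S : C) : Decomp Xs S := (exists_decomp k Xs S).some

variable {k Xs}

namespace Decomp

variable {S : C} (D : Decomp Xs S)

/-- Expansion of a map to a simple object. -/
theorem comp_expand {j : J} (f : S ⟶ Xs.obj j) : f = ∑ a, D.p j a ≫ (D.q j a ≫ f) := by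
  conv_lhs => rw [← Category.id_comp f, ← D.complete, Preadditive.sum_comp]
  rw [Finset.sum_eq_single j]
  · simp [Preadditive.sum_comp]
  · intro i _ hij
    rw [Preadditive.sum_comp]
    refine Finset.sum_eq_zero fun a _ => ?_
    rw [Category.assoc, Xs.eq_zero hij (D.q i a ≫ f), comp_zero]
  · simp

/-- Expansion of a map from a simple object. -/
theorem expand_comp {j : J} (f : Xs.obj j ⟶ S) : f = ∑ a, (f ≫ D.p j a) ≫ D.q j a := by
  conv_lhs => rw [← Category.comp_id f, ← D.complete, Preadditive.comp_sum]
  rw [Finset.sum_eq_single j]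
  · simp [Preadditive.comp_sum]
  · intro i _ hij
    rw [Preadditive.comp_sum]
    refine Finset.sum_eq_zero fun a _ => ?_
    rw [← Category.assoc, Xs.eq_zero hij.symm (f ≫ D.p i a), zero_comp]
  · simp

variable (k)

/-- The maps `p j` form a basis of `Hom(S, X_j)`. -/
def basisP (j : J) : Module.Basis (Fin (D.n j)) k (S ⟶ Xs.obj j) :=
  Module.Basis.mk (v := D.p j)
    (by
      have := Xs.simple j
      rw [Fintype.linearIndependent_iff]
      intro c hc a
      have h := congrArg (D.q j a ≫ ·) hc
      simp only [Preadditive.comp_sum, Linear.comp_smul, D.orth, comp_zero, smul_ite, smul_zero,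
        Finset.sum_ite_eq, Finset.mem_univ, if_true, smul_eq_zero] at h
      exact h.resolve_right (id_nonzero _))
    (by
      intro f _
      rw [D.comp_expand f]
      refine Submodule.sum_mem _ fun a _ => ?_
      obtain ⟨c, hc⟩ := Xs.exists_smul k (D.q j a ≫ f)
      rw [hc, Linear.comp_smul, Category.comp_id]
      exact Submodule.smul_mem _ _ (Submodule.subset_span ⟨a, rfl⟩))

theorem basisP_apply (j : J) (a : Fin (D.n j)) : D.basisP k j a = D.p j a :=
  Module.Basis.mk_apply _ _ a

/-- The maps `q j` form a basis of `Hom(X_j, S)`. -/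
def basisQ (j : J) : Module.Basis (Fin (D.n j)) k (Xs.obj j ⟶ S) :=
  Module.Basis.mk (v := D.q j)
    (by
      have := Xs.simple j
      rw [Fintype.linearIndependent_iff]
      intro c hc a
      have h := congrArg (· ≫ D.p j a) hc
      simp only [Preadditive.sum_comp, Linear.smul_comp, D.orth, zero_comp, smul_ite, smul_zero,
        Finset.sum_ite_eq', Finset.mem_univ, if_true, smul_eq_zero] at h
      exact h.resolve_right (id_nonzero _))
    (by
      intro f _
      rw [D.expand_comp f]
      refine Submodule.sum_mem _ fun a _ => ?_
      obtain ⟨c, hc⟩ := Xs.exists_smul k (f ≫ D.p j a)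
      rw [hc, Linear.smul_comp, Category.id_comp]
      exact Submodule.smul_mem _ _ (Submodule.subset_span ⟨a, rfl⟩))

theorem basisQ_apply (j : J) (a : Fin (D.n j)) : D.basisQ k j a = D.q j a :=
  Module.Basis.mk_apply _ _ a

end Decomp

end Semisimple

/-! ### Nonvanishing of the dimensions of simple objects. -/

section Dimension

variable (k : Type w) [Field k] [IsAlgClosed k]
  {C : Type u} [Category.{v} C] [Abelian C] [Linear k C] [MonoidalCategory C]
  [MonoidalPreadditive C] [MonoidalLinear k C]
  [BraidedCategory C] [RightRigidCategory C] [RibbonCategory C] [IsFusion k C]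

theorem trace_id (X : C) : trace (𝟙 X) = dim k X • 𝟙 _ := (scalar_smul k _).symm

theorem trace_smul {X : C} (c : k) (f : X ⟶ X) : trace (c • f) = c • trace f := by
  simp [trace, MonoidalLinear.smul_whiskerRight]

variable {J : Type x} [Fintype J] (Xs : SimpleReps C J)

/-- By a zigzag `evTilde X` is nonzero, so by semisimplicity it has a section `g : 𝟙 ⟶ X ⊗ Xᘁ`.
Duality turns `g` into an endomorphism of `X` with trace `1`; that endomorphism is a scalar `c`, so
`c * dim X = 1`. -/
theorem dim_ne_zero (j : J) : dim k (Xs.obj j) ≠ 0 := by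
  have : Simple (𝟙_ C) := IsFusion.simple_unit k
  have := Xs.simple j
  set X := Xs.obj j with hX
  obtain ⟨o, ⟨eo⟩⟩ := Xs.exhaustive (𝟙_ C) (IsFusion.simple_unit k)
  have hev : evTilde X ≠ 0 := by
    intro h
    have h1 := coevTilde_evTilde X
    rw [h] at h1
    have h2 : 𝟙 X = 0 := by
      calc
        𝟙 X = 𝟙 _ ⊗≫ (𝟙 (X ⊗ 𝟙_ C) ⊗≫ 𝟙 (𝟙_ C ⊗ X)) ⊗≫ 𝟙 _ := by monoidal
        _ = 0 := by rw [← h1]; simp [monoidalComp]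
    exact id_nonzero X h2
  let D := dec k Xs (X ⊗ Xᘁ)
  -- Some copy of the unit inside `X ⊗ Xᘁ` is not killed; by Schur the evaluation is then invertible
  -- on it.
  obtain ⟨a, ha⟩ : ∃ a, D.q o a ≫ evTilde X ≠ 0 := by
    by_contra hcon
    push Not at hcon
    have h := D.comp_expand (evTilde X ≫ eo.hom)
    simp only [← Category.assoc] at h
    apply hev
    rw [← cancel_mono eo.hom, h, zero_comp]
    refine Finset.sum_eq_zero fun a _ => ?_
    rw [Category.assoc, Category.assoc, ← Category.assoc (D.q o a), hcon a]
    simp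
  have : Simple (Xs.obj o) := Xs.simple o
  have := isIso_of_hom_simple ha
  let g : 𝟙_ C ⟶ X ⊗ Xᘁ := inv (D.q o a ≫ evTilde X) ≫ D.q o a
  have hg : g ≫ evTilde X = 𝟙 _ := by simp [g]
  let f : X ⟶ X := 𝟙 _ ⊗≫ g ▷ X ⊗≫ X ◁ ε_ X (Xᘁ) ⊗≫ 𝟙 _
  have hf : η_ X (Xᘁ) ≫ f ▷ Xᘁ = g := by
    calc
      _ = 𝟙 _ ⊗≫ ((𝟙_ C) ◁ η_ X (Xᘁ) ≫ g ▷ (X ⊗ Xᘁ)) ⊗≫ X ◁ ε_ X (Xᘁ) ▷ Xᘁ ⊗≫ 𝟙 _ := by monoidal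
      _ = 𝟙 _ ⊗≫ g ⊗≫ X ◁ (Xᘁ ◁ η_ X (Xᘁ) ⊗≫ ε_ X (Xᘁ) ▷ Xᘁ) ⊗≫ 𝟙 _ := by
        rw [whisker_exchange]; monoidal
      _ = _ := by rw [ExactPairing.coevaluation_evaluation'']; monoidal
  obtain ⟨c, hc⟩ := Xs.exists_smul k f
  intro h0
  have h3 : trace f = 𝟙 _ := by
    rw [trace, ← Category.assoc, hf, hg]
  rw [hc, trace_smul, trace_id k, h0, zero_smul, smul_zero] at h3
  exact id_nonzero (𝟙_ C) h3.symm

end Dimension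

/-! ### Maps to a dual object obtained from pairings. -/

section Mates

variable {C : Type u} [Category.{v} C] [MonoidalCategory C] [RightRigidCategory C]

/-- The map `Z ⟶ X^*` corresponding to a pairing `Z ⊗ X ⟶ 𝟙`. -/
def mate {X Z : C} (e : Z ⊗ X ⟶ 𝟙_ C) : Z ⟶ Xᘁ := 𝟙 _ ⊗≫ Z ◁ η_ X (Xᘁ) ⊗≫ e ▷ Xᘁ ⊗≫ 𝟙 _

theorem mate_ev {X Z : C} (e : Z ⊗ X ⟶ 𝟙_ C) : mate e ▷ X ≫ ε_ X (Xᘁ) = e := by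
  simp only [mate]
  calc
    _ = 𝟙 _ ⊗≫ Z ◁ η_ X (Xᘁ) ▷ X ⊗≫ (e ▷ (Xᘁ ⊗ X) ≫ (𝟙_ C) ◁ ε_ X (Xᘁ)) ⊗≫ 𝟙 _ := by monoidal
    _ = 𝟙 _ ⊗≫ Z ◁ (η_ X (Xᘁ) ▷ X ⊗≫ X ◁ ε_ X (Xᘁ)) ⊗≫ e ⊗≫ 𝟙 _ := by
      rw [← whisker_exchange]; monoidal
    _ = _ := by rw [ExactPairing.evaluation_coevaluation'']; monoidal

theorem mate_of_ev (X : C) : mate (ε_ X (Xᘁ)) = 𝟙 _ := by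
  rw [mate]
  calc
    _ = 𝟙 _ ⊗≫ ((Xᘁ : C) ◁ η_ X (Xᘁ) ⊗≫ ε_ X (Xᘁ) ▷ (Xᘁ : C)) ⊗≫ 𝟙 _ := by monoidal
    _ = _ := by rw [ExactPairing.coevaluation_evaluation'']; monoidal

theorem comp_mate {X Z Z' : C} (g : Z' ⟶ Z) (e : Z ⊗ X ⟶ 𝟙_ C) :
    g ≫ mate e = mate (g ▷ X ≫ e) := by
  rw [mate, mate]
  calc
    _ = 𝟙 _ ⊗≫ (g ▷ 𝟙_ C ≫ Z ◁ η_ X (Xᘁ)) ⊗≫ e ▷ Xᘁ ⊗≫ 𝟙 _ := by monoidal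
    _ = _ := by rw [← whisker_exchange]; monoidal

theorem mate_add [Preadditive C] [MonoidalPreadditive C] {X Z : C} (e e' : Z ⊗ X ⟶ 𝟙_ C) :
    mate (e + e') = mate e + mate e' := by
  simp [mate, monoidalComp]

theorem mate_sum [Preadditive C] [MonoidalPreadditive C] {X Z : C} {I : Type*} (t : Finset I)
    (e : I → (Z ⊗ X ⟶ 𝟙_ C)) : mate (∑ i ∈ t, e i) = ∑ i ∈ t, mate (e i) := by
  simp [mate, monoidalComp, sum_whiskerRight, Preadditive.comp_sum, Preadditive.sum_comp]

theorem mate_smul {k : Type w} [Field k] [Preadditive C] [Linear k C] [MonoidalPreadditive C]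
    [MonoidalLinear k C] {X Z : C} (c : k) (e : Z ⊗ X ⟶ 𝟙_ C) : mate (c • e) = c • mate e := by
  simp [mate, monoidalComp, MonoidalLinear.smul_whiskerRight]

end Mates

/-! ### The object `⨁ X_j ⊗ X_j^*` as a coend. -/

section UnitObject

section Biproduct

variable {C : Type u} [Category.{v} C] [Abelian C] [MonoidalCategory C] [RightRigidCategory C]
  {J : Type x} [Fintype J] (Xs : SimpleReps C J)

theorem unitι_unitπ_self (j : J) : unitι Xs j ≫ unitπ Xs j = 𝟙 _ := by
  have := Abelian.hasFiniteBiproducts (C := C)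
  exact biproduct.ι_π_self _ j

theorem unitι_unitπ_ne {i j : J} (h : i ≠ j) : unitι Xs i ≫ unitπ Xs j = 0 := by
  have := Abelian.hasFiniteBiproducts (C := C)
  exact biproduct.ι_π_ne _ h

theorem unit_total : ∑ j, unitπ Xs j ≫ unitι Xs j = 𝟙 (unitObj Xs) := by
  have := Abelian.hasFiniteBiproducts (C := C)
  have h : ∀ j, (∑ i, unitπ Xs i ≫ unitι Xs i) ≫ unitπ Xs j = unitπ Xs j := by
    intro j
    rw [Preadditive.sum_comp, Finset.sum_eq_single j]
    · rw [Category.assoc, unitι_unitπ_self, Category.comp_id]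
    · intro i _ hij
      rw [Category.assoc, unitι_unitπ_ne Xs hij, comp_zero]
    · simp
  exact biproduct.hom_ext (f := fun j => Xs.obj j ⊗ (Xs.obj j)ᘁ) _ _ fun j =>
    (h j).trans (Category.id_comp _).symm

end Biproduct

variable {k : Type w} [Field k] [IsAlgClosed k]
  {C : Type u} [Category.{v} C] [Abelian C] [Linear k C] [MonoidalCategory C]
  [MonoidalPreadditive C] [MonoidalLinear k C] [RightRigidCategory C] [IsFusion k C]
  {J : Type x} [Fintype J] (Xs : SimpleReps C J) (s : J → k)

/-- The map `S ⊗ Z ⟶ ⨁_j X_j ⊗ X_j^*` associated with a pairing `Z ⊗ S ⟶ 𝟙`; these exhibit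
the target as a coend. -/
def inc {S Z : C} (e : Z ⊗ S ⟶ 𝟙_ C) : S ⊗ Z ⟶ unitObj Xs :=
  ∑ j, ∑ a, (s j)⁻¹ • (((dec k Xs S).p j a ▷ Z ≫ Xs.obj j ◁ mate (Z ◁ (dec k Xs S).q j a ≫ e)) ≫
    unitι Xs j)

theorem whiskerLeft_inc {S Z Z' : C} (g : Z' ⟶ Z) (e : Z ⊗ S ⟶ 𝟙_ C) :
    S ◁ g ≫ inc Xs s e = inc Xs s (g ▷ S ≫ e) := by
  simp only [inc, Preadditive.comp_sum, Linear.comp_smul]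
  refine Finset.sum_congr rfl fun j _ => Finset.sum_congr rfl fun a _ => ?_
  rw [← Category.assoc, ← Category.assoc, whisker_exchange, Category.assoc (_ ▷ Z'),
    ← MonoidalCategory.whiskerLeft_comp, comp_mate, ← whisker_exchange_assoc]

/-- Expand `f` in the chosen bases for `S` and `T`. The matrix entries are endomorphisms of simple
objects, hence scalars, and can be moved from the factor `X_j` to the factor `X_j^*`. -/
theorem whiskerRight_inc {S T Z : C} (f : S ⟶ T) (e : Z ⊗ T ⟶ 𝟙_ C) :
    f ▷ Z ≫ inc Xs s e = inc Xs s (Z ◁ f ≫ e) := by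
  let D := dec k Xs S
  let E := dec k Xs T
  have h1 : ∀ j b, f ≫ E.p j b = ∑ a, D.p j a ≫ (D.q j a ≫ f ≫ E.p j b) := fun j b =>
    D.comp_expand (f ≫ E.p j b)
  have h2 : ∀ j a, D.q j a ≫ f = ∑ b, (D.q j a ≫ f ≫ E.p j b) ≫ E.q j b := fun j a => by
    have := E.expand_comp (D.q j a ≫ f)
    simpa only [Category.assoc] using this
  simp only [inc, Preadditive.comp_sum, Linear.comp_smul]
  refine Finset.sum_congr rfl fun j _ => ?_
  have h3 : ∀ b, f ▷ Z ≫ (E.p j b ▷ Z ≫ Xs.obj j ◁ mate (Z ◁ E.q j b ≫ e)) =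
      ∑ a, D.p j a ▷ Z ≫ (D.q j a ≫ f ≫ E.p j b) ▷ Z ≫ Xs.obj j ◁ mate (Z ◁ E.q j b ≫ e) := by
    intro b
    have h5 := congrArg (fun t => t ▷ Z ≫ Xs.obj j ◁ mate (Z ◁ E.q j b ≫ e)) (h1 j b)
    simp only [sum_whiskerRight, Preadditive.sum_comp] at h5
    rw [comp_whiskerRight, Category.assoc] at h5
    rw [h5]
    refine Finset.sum_congr rfl fun a _ => ?_
    rw [comp_whiskerRight (D.p j a), Category.assoc]
  have h4 : ∀ a, D.p j a ▷ Z ≫ Xs.obj j ◁ mate (Z ◁ D.q j a ≫ Z ◁ f ≫ e) =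
      ∑ b, D.p j a ▷ Z ≫ (D.q j a ≫ f ≫ E.p j b) ▷ Z ≫ Xs.obj j ◁ mate (Z ◁ E.q j b ≫ e) := by
    intro a
    rw [← MonoidalCategory.whiskerLeft_comp_assoc, h2, whiskerLeft_sum, Preadditive.sum_comp,
      mate_sum, whiskerLeft_sum, Preadditive.comp_sum]
    refine Finset.sum_congr rfl fun b _ => ?_
    obtain ⟨c, hc⟩ := Xs.exists_smul k (D.q j a ≫ f ≫ E.p j b)
    rw [hc]
    simp [mate_smul, MonoidalLinear.smul_whiskerRight]
  change ∑ b, (s j)⁻¹ • (f ▷ Z ≫ (E.p j b ▷ Z ≫ Xs.obj j ◁ mate (Z ◁ E.q j b ≫ e)) ≫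
    unitι Xs j) = ∑ a, (s j)⁻¹ • ((D.p j a ▷ Z ≫ Xs.obj j ◁ mate (Z ◁ D.q j a ≫ Z ◁ f ≫ e)) ≫
    unitι Xs j)
  have h5 : ∀ b, f ▷ Z ≫ (E.p j b ▷ Z ≫ Xs.obj j ◁ mate (Z ◁ E.q j b ≫ e)) ≫ unitι Xs j =
      (∑ a, D.p j a ▷ Z ≫ (D.q j a ≫ f ≫ E.p j b) ▷ Z ≫ Xs.obj j ◁ mate (Z ◁ E.q j b ≫ e)) ≫
        unitι Xs j := by
    intro b
    rw [← h3]; simp only [Category.assoc]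
  simp only [h5, h4, Preadditive.sum_comp, Finset.smul_sum]
  exact Finset.sum_comm

theorem inc_add {S Z : C} (e e' : Z ⊗ S ⟶ 𝟙_ C) :
    inc Xs s (e + e') = inc Xs s e + inc Xs s e' := by
  simp only [inc, Preadditive.comp_add, mate_add, MonoidalPreadditive.whiskerLeft_add,
    Preadditive.add_comp, smul_add, Finset.sum_add_distrib]

open Classical in
-- By Schur only the summand `j` survives, and there the bases resum to the identity. The factor `(s
-- j)⁻¹` in `inc` cancels the weight `s j` in `Dinatural.desc`; it is the normalisation that puts
-- weights `√d_j` into the unit constraints.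
theorem inc_ev (j : J) :
    inc Xs s (ε_ (Xs.obj j) ((Xs.obj j)ᘁ)) = (s j)⁻¹ • unitι Xs j := by
  set X := Xs.obj j
  let D := dec k Xs X
  have h : ∀ i, ∑ a, (s i)⁻¹ • ((D.p i a ▷ Xᘁ ≫ Xs.obj i ◁ mate (Xᘁ ◁ D.q i a ≫ ε_ X (Xᘁ))) ≫
    unitι Xs i) = if i = j then (s j)⁻¹ • unitι Xs j else 0 := by
    intro i
    split_ifs with hij
    · subst hij
      rw [← Finset.smul_sum, ← Preadditive.sum_comp]
      have h2 : ∑ a, D.p i a ▷ Xᘁ ≫ X ◁ mate (Xᘁ ◁ D.q i a ≫ ε_ X (Xᘁ)) = 𝟙 _ := by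
        have h3 : ∀ a, D.p i a ▷ Xᘁ ≫ X ◁ mate (Xᘁ ◁ D.q i a ≫ ε_ X (Xᘁ)) =
            X ◁ mate (Xᘁ ◁ (D.p i a ≫ D.q i a) ≫ ε_ X (Xᘁ)) := by
          intro a
          obtain ⟨c, hc⟩ := Xs.exists_smul k (D.p i a)
          rw [hc]
          simp [mate_smul, MonoidalLinear.smul_whiskerRight, X]
        simp only [h3]
        have h4 := D.comp_expand (𝟙 X)
        simp only [Category.comp_id] at h4
        rw [← whiskerLeft_sum, ← mate_sum, ← Preadditive.sum_comp, ← whiskerLeft_sum, ← h4]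
        simp [mate_of_ev]
      rw [h2, Category.id_comp]
    · refine Finset.sum_eq_zero fun a _ => ?_
      rw [Xs.eq_zero (Ne.symm hij) (D.p i a)]
      simp
  rw [inc, Finset.sum_congr rfl fun i _ => h i]
  simp

variable {Xs s}

/-- A dinatural family of maps out of `F (S ⊗ Z)`, indexed by pairings `Z ⊗ S ⟶ 𝟙`. -/
structure Dinatural (F : C ⥤ C) (V : C) where
  app : ∀ {S Z : C}, (Z ⊗ S ⟶ 𝟙_ C) → (F.obj (S ⊗ Z) ⟶ V)
  right : ∀ {S T Z : C} (f : S ⟶ T) (e : Z ⊗ T ⟶ 𝟙_ C),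
    F.map (f ▷ Z) ≫ app e = app (Z ◁ f ≫ e)
  left : ∀ {S Z Z' : C} (g : Z' ⟶ Z) (e : Z ⊗ S ⟶ 𝟙_ C),
    F.map (S ◁ g) ≫ app e = app (g ▷ S ≫ e)
  add : ∀ {S Z : C} (e e' : Z ⊗ S ⟶ 𝟙_ C), app (e + e') = app e + app e'

variable {F : C ⥤ C} [F.Additive] {V : C}

theorem Dinatural.sum (t : Dinatural F V) {S Z : C} {I : Type*} (u : Finset I)
    (e : I → (Z ⊗ S ⟶ 𝟙_ C)) : t.app (∑ i ∈ u, e i) = ∑ i ∈ u, t.app (e i) :=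
  map_sum (AddMonoidHom.mk' (fun e => t.app e) fun a b => t.add a b) _ _

variable (Xs s) in
/-- The induced map out of `F (⨁_j X_j ⊗ X_j^*)`. -/
def Dinatural.desc (t : Dinatural F V) : F.obj (unitObj Xs) ⟶ V :=
  ∑ j, s j • (F.map (unitπ Xs j) ≫ t.app (ε_ (Xs.obj j) ((Xs.obj j)ᘁ)))

/-- Each term of `inc e` factors through one `X_j ⊗ X_j^*`. Dinaturality moves its maps back into
the pairing, where they form `p ≫ q`, and the sum of these is the identity of `S`. -/
theorem Dinatural.fac [F.Linear k] (hs : ∀ j, s j ≠ 0) (t : Dinatural F V) {S Z : C}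
    (e : Z ⊗ S ⟶ 𝟙_ C) :
    F.map (inc Xs s e) ≫ t.desc Xs s = t.app e := by
  let D := dec k Xs S
  have h1 : ∀ j, F.map (unitι Xs j) ≫ t.desc Xs s =
      s j • t.app (ε_ (Xs.obj j) ((Xs.obj j)ᘁ)) := by
    intro j
    rw [Dinatural.desc, Preadditive.comp_sum, Finset.sum_eq_single j]
    · rw [Linear.comp_smul, ← Functor.map_comp_assoc, unitι_unitπ_self, F.map_id, Category.id_comp]
    · intro i _ hij
      rw [Linear.comp_smul, ← Functor.map_comp_assoc, unitι_unitπ_ne Xs hij.symm, F.map_zero,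
        zero_comp, smul_zero]
    · simp
  have h2 : ∀ j a, F.map ((s j)⁻¹ • ((D.p j a ▷ Z ≫ Xs.obj j ◁ mate (Z ◁ D.q j a ≫ e)) ≫
      unitι Xs j)) ≫ t.desc Xs s = t.app (Z ◁ (D.p j a ≫ D.q j a) ≫ e) := by
    intro j a
    rw [F.map_smul, F.map_comp, Linear.smul_comp, Category.assoc, h1, Linear.comp_smul, smul_smul,
      inv_mul_cancel₀ (hs j), one_smul, F.map_comp, Category.assoc, t.left, t.right, mate_ev]
    simp
  rw [inc, F.map_sum, Preadditive.sum_comp]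
  simp only [F.map_sum, Preadditive.sum_comp]
  refine (Finset.sum_congr rfl fun j _ => Finset.sum_congr rfl fun a _ => h2 j a).trans ?_
  simp only [← t.sum, ← Preadditive.sum_comp, ← whiskerLeft_sum]
  rw [D.complete]
  simp

/-- The evaluations of the simple objects already suffice, since `inc` sends them to nonzero
multiples of the biproduct inclusions. Testing against every pairing keeps later computations free
of decompositions. -/
theorem unit_hom_ext [F.Linear k] (hs : ∀ j, s j ≠ 0) {f g : F.obj (unitObj Xs) ⟶ V}
    (h : ∀ {S Z : C} (e : Z ⊗ S ⟶ 𝟙_ C), F.map (inc Xs s e) ≫ f = F.map (inc Xs s e) ≫ g) :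
    f = g := by
  have h1 : ∀ j, F.map (unitι Xs j) ≫ f = F.map (unitι Xs j) ≫ g := by
    intro j
    have h2 := h (ε_ (Xs.obj j) ((Xs.obj j)ᘁ))
    rw [inc_ev, F.map_smul, Linear.smul_comp, Linear.smul_comp] at h2
    have h3 := congrArg (s j • ·) h2
    simpa only [smul_smul, mul_inv_cancel₀ (hs j), one_smul] using h3
  have h4 : ∀ f : F.obj (unitObj Xs) ⟶ V,
      f = ∑ j, F.map (unitπ Xs j) ≫ F.map (unitι Xs j) ≫ f := by
    intro f
    simp only [← Functor.map_comp_assoc, ← Preadditive.sum_comp, ← F.map_sum]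
    rw [unit_total, F.map_id, Category.id_comp]
  rw [h4 f, h4 g]
  simp only [h1]

end UnitObject

section Nest

variable {C : Type u} [Category.{v} C] [MonoidalCategory C]

theorem nest_comp_right {A A' S T Z : C} (a : A' ⊗ A ⟶ 𝟙_ C) (f : S ⟶ T) (e : Z ⊗ T ⟶ 𝟙_ C) :
    nest a (Z ◁ f ≫ e) = (Z ⊗ A') ◁ (A ◁ f) ≫ nest a e := by
  simp only [nest]
  calc
    _ = 𝟙 _ ⊗≫ Z ◁ (a ▷ S ≫ (𝟙_ C) ◁ f) ⊗≫ e := by monoidal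
    _ = _ := by rw [← whisker_exchange]; monoidal

theorem nest_comp_left {A A' S Z Z' : C} (a : A' ⊗ A ⟶ 𝟙_ C) (g : Z' ⟶ Z) (e : Z ⊗ S ⟶ 𝟙_ C) :
    nest a (g ▷ S ≫ e) = (g ▷ A') ▷ (A ⊗ S) ≫ nest a e := by
  simp only [nest]
  calc
    _ = 𝟙 _ ⊗≫ (Z' ◁ a ≫ g ▷ 𝟙_ C) ▷ S ⊗≫ e := by monoidal
    _ = _ := by rw [whisker_exchange]; monoidal

end Nest

/-! ### The half-braidings `Γ` and `Ω` on the coend, and COMM for them. -/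

section HalfBraidings

variable {k : Type w} [Field k] [IsAlgClosed k]
  {C : Type u} [Category.{v} C] [Abelian C] [Linear k C] [MonoidalCategory C]
  [MonoidalPreadditive C] [MonoidalLinear k C] [BraidedCategory C]
  [RightRigidCategory C] [RibbonCategory C] [IsFusion k C]
  {J : Type x} [Fintype J] (Xs : SimpleReps C J) (s : J → k)

theorem inc_comp {S Z T Z' : C} (f : T ⟶ S) (g : Z' ⟶ Z) (e : Z ⊗ S ⟶ 𝟙_ C)
    (e' : Z' ⊗ T ⟶ 𝟙_ C) (h : e' = (g ⊗ₘ f) ≫ e) :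
    inc Xs s e' = (f ⊗ₘ g) ≫ inc Xs s e := by
  rw [h, tensorHom_def', MonoidalCategory.tensorHom_def, Category.assoc, Category.assoc,
    whiskerLeft_inc, whiskerRight_inc]

/-- The crossing of `A` past `S ⊗ Z ⟶ ⨁_j X_j ⊗ X_j^*`: `A` is created to the right of `Z`, and
its dual is absorbed into the pairing. -/
def gammaApp {A A' S Z : C} (a : TwistedDual A A') (e : Z ⊗ S ⟶ 𝟙_ C) :
    A ⊗ (S ⊗ Z) ⟶ unitObj Xs ⊗ A :=
  𝟙 _ ⊗≫ (A ⊗ S ⊗ Z) ◁ a.coev ⊗≫ inc Xs s (nest a.ev e) ▷ A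

/-- The dinatural family defining `Γ`. -/
def gammaDin (A : C) : Dinatural (tensorLeft A) (unitObj Xs ⊗ A) where
  app e := gammaApp Xs s (twistedDual A) e
  right {S T Z} f e := by
    change A ◁ (f ▷ Z) ≫ gammaApp Xs s (twistedDual A) e = _
    rw [gammaApp, gammaApp, nest_comp_right, ← whiskerRight_inc]
    calc
      _ = 𝟙 _ ⊗≫ ((A ◁ f ▷ Z) ▷ 𝟙_ C ≫ (A ⊗ T ⊗ Z) ◁ (twistedDual A).coev) ⊗≫
          inc Xs s (nest (twistedDual A).ev e) ▷ A := by monoidal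
      _ = _ := by rw [← whisker_exchange]; monoidal
  left {S Z Z'} g e := by
    change A ◁ (S ◁ g) ≫ gammaApp Xs s (twistedDual A) e = _
    rw [gammaApp, gammaApp, nest_comp_left, ← whiskerLeft_inc]
    calc
      _ = 𝟙 _ ⊗≫ ((A ◁ S ◁ g) ▷ 𝟙_ C ≫ (A ⊗ S ⊗ Z) ◁ (twistedDual A).coev) ⊗≫
          inc Xs s (nest (twistedDual A).ev e) ▷ A := by monoidal
      _ = _ := by rw [← whisker_exchange]; monoidal
  add e e' := by
    have h : nest (twistedDual A).ev (e + e') = nest (twistedDual A).ev e +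
      nest (twistedDual A).ev e' := by simp [nest, monoidalComp]
    simp only [gammaApp, h, inc_add, monoidalComp, MonoidalPreadditive.add_whiskerRight,
      Preadditive.comp_add]

/-- The crossings of `Γ`. -/
def gamma (A : C) : A ⊗ unitObj Xs ⟶ unitObj Xs ⊗ A := (gammaDin Xs s A).desc Xs s

variable {s}

/-- `Γ` can be computed with any dual of `A`. -/
theorem inc_gamma (hs : ∀ j, s j ≠ 0) {A A' S Z : C} (a : TwistedDual A A') (e : Z ⊗ S ⟶ 𝟙_ C) :
    A ◁ inc Xs s e ≫ gamma Xs s A = gammaApp Xs s a e := by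
  have h : A ◁ inc Xs s e ≫ gamma Xs s A = gammaApp Xs s (twistedDual A) e :=
    Dinatural.fac (F := tensorLeft A) hs (gammaDin Xs s A) e
  -- `z` compares the given dual with `Aᘁ`; it passes through `inc` by dinaturality and turns one
  -- coevaluation into the other.
  obtain ⟨z, hz, hz'⟩ := a.coev_mate
  have hn : inc Xs s (nest a.ev e) = (A ⊗ S) ◁ (Z ◁ z) ≫ inc Xs s (nest (ε_ A (Aᘁ)) e) := by
    rw [whiskerLeft_inc, ← hz]
    congr 1
    simp only [nest]
    monoidal
  rw [h, gammaApp, gammaApp, hn]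
  change _ ⊗≫ _ ◁ coevTilde A ⊗≫ inc Xs s (nest (ε_ A (Aᘁ)) e) ▷ A = _
  rw [← hz']
  monoidal

/-- Tested on `inc e`, `f` moves through the pairing to `fᘁ`, and then through the coevaluation back
to `f` on the emerging strand. -/
theorem gamma_naturality (hs : ∀ j, s j ≠ 0) {A B : C} (f : A ⟶ B) :
    f ▷ unitObj Xs ≫ gamma Xs s B = gamma Xs s A ≫ unitObj Xs ◁ f := by
  refine unit_hom_ext (F := tensorLeft A) (Xs := Xs) hs fun {S Z} e => ?_
  change A ◁ inc Xs s e ≫ f ▷ _ ≫ _ = A ◁ inc Xs s e ≫ gamma Xs s A ≫ _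
  rw [whisker_exchange_assoc, inc_gamma Xs hs (twistedDual B),
    reassoc_of% inc_gamma Xs hs (twistedDual A)]
  simp only [gammaApp, twistedDual]
  have h1 : f ▷ S ▷ (Z ⊗ Bᘁ) ≫ inc Xs s (nest (ε_ B (Bᘁ)) e) =
      (A ⊗ S) ◁ (Z ◁ (fᘁ)) ≫ inc Xs s (nest (ε_ A (Aᘁ)) e) := by
    rw [whiskerLeft_inc, whiskerRight_inc]
    congr 1
    simp only [nest]
    calc
      _ = 𝟙 _ ⊗≫ Z ◁ (Bᘁ ◁ f ≫ ε_ B (Bᘁ)) ▷ S ⊗≫ e := by monoidal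
      _ = _ := by rw [← rightAdjointMate_comp_evaluation]; monoidal
  calc
    _ = 𝟙 _ ⊗≫ (f ▷ (S ⊗ Z ⊗ 𝟙_ C) ≫ B ◁ S ◁ Z ◁ coevTilde B) ⊗≫
        inc Xs s (nest (ε_ B (Bᘁ)) e) ▷ B := by monoidal
    _ = 𝟙 _ ⊗≫ A ◁ S ◁ Z ◁ coevTilde B ⊗≫
        (f ▷ S ▷ (Z ⊗ Bᘁ) ≫ inc Xs s (nest (ε_ B (Bᘁ)) e)) ▷ B := by
      rw [← whisker_exchange]; monoidal
    _ = 𝟙 _ ⊗≫ A ◁ S ◁ Z ◁ (coevTilde B ≫ (fᘁ) ▷ B) ⊗≫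
        inc Xs s (nest (ε_ A (Aᘁ)) e) ▷ B := by
      rw [h1]; monoidal
    _ = 𝟙 _ ⊗≫ A ◁ S ◁ Z ◁ coevTilde A ⊗≫ (((A ⊗ S) ⊗ Z ⊗ Aᘁ) ◁ f ≫
        inc Xs s (nest (ε_ A (Aᘁ)) e) ▷ B) := by
      rw [← coevTilde_naturality]; monoidal
    _ = _ := by rw [whisker_exchange]; monoidal

/-- `Γ` may be computed with the dual `Bᘁ ⊗ Aᘁ` of `A ⊗ B`; absorbing `A ⊗ B` at once is then
absorbing `B` and afterwards `A`, up to associators. -/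
theorem gamma_tensor (hs : ∀ j, s j ≠ 0) (A B : C) :
    gamma Xs s (A ⊗ B) = 𝟙 _ ⊗≫ A ◁ gamma Xs s B ⊗≫ gamma Xs s A ▷ B ⊗≫ 𝟙 _ := by
  refine unit_hom_ext (F := tensorLeft (A ⊗ B)) (Xs := Xs) hs fun {S Z} e => ?_
  let a := twistedDual A
  let b := twistedDual B
  change (A ⊗ B) ◁ inc Xs s e ≫ _ = (A ⊗ B) ◁ inc Xs s e ≫ _
  rw [inc_gamma Xs hs (a.tensor b)]
  symm
  calc
    _ = 𝟙 _ ⊗≫ A ◁ (B ◁ inc Xs s e ≫ gamma Xs s B) ⊗≫ gamma Xs s A ▷ B ⊗≫ 𝟙 _ := by monoidal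
    _ = 𝟙 _ ⊗≫ (A ⊗ B ⊗ S ⊗ Z) ◁ b.coev ⊗≫ (A ◁ inc Xs s (nest b.ev e) ≫ gamma Xs s A) ▷ B ⊗≫
        𝟙 _ := by rw [inc_gamma Xs hs b, gammaApp]; monoidal
    _ = 𝟙 _ ⊗≫ (A ⊗ B ⊗ S ⊗ Z) ◁ (b.coev ⊗≫ Bᘁ ◁ a.coev ▷ B) ⊗≫
        inc Xs s (nest a.ev (nest b.ev e)) ▷ A ▷ B ⊗≫ 𝟙 _ := by
      rw [inc_gamma Xs hs a, gammaApp]; monoidal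
    _ = _ := by
      have h : inc Xs s (nest a.ev (nest b.ev e)) =
          ((α_ A B S).inv ⊗ₘ (α_ Z (Bᘁ) (Aᘁ)).hom) ≫ inc Xs s (nest (a.tensor b).ev e) := by
        apply inc_comp
        simp only [nest, TwistedDual.tensor]
        monoidal
      rw [h, gammaApp]
      simp only [TwistedDual.tensor]
      monoidal

theorem gamma_unit (hs : ∀ j, s j ≠ 0) : gamma Xs s (𝟙_ C) = 𝟙 _ ⊗≫ 𝟙 _ := by
  refine unit_hom_ext (F := tensorLeft (𝟙_ C)) (Xs := Xs) hs fun {S Z} e => ?_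
  change (𝟙_ C) ◁ inc Xs s e ≫ _ = (𝟙_ C) ◁ inc Xs s e ≫ _
  rw [inc_gamma Xs hs twistedDualUnit]
  have h : inc Xs s (nest (twistedDualUnit (C := C)).ev e) =
      ((λ_ S).hom ⊗ₘ (ρ_ Z).hom) ≫ inc Xs s e := by
    apply inc_comp
    simp only [nest, twistedDualUnit]
    monoidal
  rw [gammaApp, h]
  simp only [twistedDualUnit]
  monoidal

/-- The half-braiding `Γ`. -/
def gammaHB (hs : ∀ j, s j ≠ 0) : HalfBraiding (unitObj Xs) :=
  have := isIso_of_lax (gamma Xs s) (gamma_naturality Xs hs) (gamma_tensor Xs hs)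
    (gamma_unit Xs hs)
  ofCross (gamma Xs s) (gamma_naturality Xs hs) (gamma_tensor Xs hs)

theorem cross_gammaHB (hs : ∀ j, s j ≠ 0) (A : C) : cross (gammaHB Xs hs) A = gamma Xs s A := rfl

/-- The dinatural family defining `Ω`. -/
def omegaDin (s : J → k) (A : C) : Dinatural (tensorLeft A) (unitObj Xs ⊗ A) where
  app {S Z} e := cross (hbTensor (hbPos S) (hbNeg Z)) A ≫ inc Xs s e ▷ A
  right {S T Z} f e := by
    have h := ((Intertwines.hbPos f).tensor (Intertwines.hbNeg (𝟙 Z))) A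
    rw [tensorHom_id] at h
    change A ◁ (f ▷ Z) ≫ _ = _
    rw [← reassoc_of% h, ← comp_whiskerRight, whiskerRight_inc]
  left {S Z Z'} g e := by
    have h := ((Intertwines.hbPos (𝟙 S)).tensor (Intertwines.hbNeg g)) A
    rw [id_tensorHom] at h
    change A ◁ (S ◁ g) ≫ _ = _
    rw [← reassoc_of% h, ← comp_whiskerRight, whiskerLeft_inc]
  add e e' := by
    rw [inc_add, MonoidalPreadditive.add_whiskerRight, Preadditive.comp_add]

theorem omega_eq_desc (hs : ∀ j, s j ≠ 0) (A : C) : omega Xs A = (omegaDin Xs s A).desc Xs s := by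
  rw [omega, Dinatural.desc]
  refine Finset.sum_congr rfl fun j _ => ?_
  simp only [omegaDin, inc_ev, cross_hbTensor, cross_hbPos, cross_hbNeg,
    MonoidalLinear.smul_whiskerRight, Linear.comp_smul, smul_smul, mul_inv_cancel₀ (hs j),
    one_smul]
  rfl

theorem inc_omega (hs : ∀ j, s j ≠ 0) (A : C) {S Z : C} (e : Z ⊗ S ⟶ 𝟙_ C) :
    A ◁ inc Xs s e ≫ omega Xs A = cross (hbTensor (hbPos S) (hbNeg Z)) A ≫ inc Xs s e ▷ A := by
  rw [omega_eq_desc Xs hs]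
  exact Dinatural.fac (F := tensorLeft A) hs (omegaDin Xs s A) e

theorem omega_naturality (hs : ∀ j, s j ≠ 0) {A B : C} (f : A ⟶ B) :
    f ▷ unitObj Xs ≫ omega Xs B = omega Xs A ≫ unitObj Xs ◁ f := by
  refine unit_hom_ext (F := tensorLeft A) (Xs := Xs) hs fun {S Z} e => ?_
  change A ◁ inc Xs s e ≫ f ▷ _ ≫ _ = A ◁ inc Xs s e ≫ omega Xs A ≫ _
  rw [whisker_exchange_assoc, inc_omega Xs hs, reassoc_of% inc_omega Xs hs A e,
    cross_naturality_assoc, whisker_exchange]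

theorem omega_tensor (hs : ∀ j, s j ≠ 0) (A B : C) :
    omega Xs (A ⊗ B) = 𝟙 _ ⊗≫ A ◁ omega Xs B ⊗≫ omega Xs A ▷ B ⊗≫ 𝟙 _ := by
  refine unit_hom_ext (F := tensorLeft (A ⊗ B)) (Xs := Xs) hs fun {S Z} e => ?_
  change (A ⊗ B) ◁ inc Xs s e ≫ _ = (A ⊗ B) ◁ inc Xs s e ≫ _
  rw [inc_omega Xs hs, cross_tensor]
  symm
  calc
    _ = 𝟙 _ ⊗≫ A ◁ (B ◁ inc Xs s e ≫ omega Xs B) ⊗≫ omega Xs A ▷ B ⊗≫ 𝟙 _ := by monoidal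
    _ = 𝟙 _ ⊗≫ A ◁ cross (hbTensor (hbPos S) (hbNeg Z)) B ⊗≫
        (A ◁ inc Xs s e ≫ omega Xs A) ▷ B ⊗≫ 𝟙 _ := by rw [inc_omega Xs hs]; monoidal
    _ = _ := by rw [inc_omega Xs hs]; monoidal

theorem omega_unit (hs : ∀ j, s j ≠ 0) : omega Xs (𝟙_ C) = 𝟙 _ ⊗≫ 𝟙 _ := by
  refine unit_hom_ext (F := tensorLeft (𝟙_ C)) (Xs := Xs) hs fun {S Z} e => ?_
  change (𝟙_ C) ◁ inc Xs s e ≫ _ = (𝟙_ C) ◁ inc Xs s e ≫ _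
  rw [inc_omega Xs hs, cross_unit]
  monoidal

/-- The half-braiding `Ω`. -/
def omegaHB (hs : ∀ j, s j ≠ 0) : HalfBraiding (unitObj Xs) :=
  have := isIso_of_lax (omega Xs) (omega_naturality Xs hs) (omega_tensor Xs hs)
    (omega_unit Xs hs)
  ofCross (omega Xs) (omega_naturality Xs hs) (omega_tensor Xs hs)

theorem cross_omegaHB (hs : ∀ j, s j ≠ 0) (A : C) : cross (omegaHB Xs hs) A = omega Xs A := rfl

/-- On `inc e`, `Γ_A` enlarges the pair `(S, Z)` to `(A ⊗ S, Z ⊗ Aᘁ)`, and `Ω_B` braids `B` past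
whatever pair is present. The two orders differ by the crossings of `B` with the new strands `A` and
`Aᘁ`, and these are the braidings in COMM. -/
theorem comm_gamma_omega (hs : ∀ j, s j ≠ 0) : COMM (gammaHB Xs hs) (omegaHB Xs hs) := by
  intro A B
  simp only [cross_gammaHB, cross_omegaHB]
  refine unit_hom_ext (F := tensorLeft B ⋙ tensorLeft A) (Xs := Xs) hs fun {S Z} e => ?_
  change A ◁ B ◁ inc Xs s e ≫ _ = A ◁ B ◁ inc Xs s e ≫ _
  let a := twistedDual A
  -- The pair created by `a.coev` can be pulled across `B` as a whole.
  have hc : a.coev ▷ B ⊗≫ Aᘁ ◁ (β_ A B).hom ⊗≫ (β_ (Aᘁ) B).hom ▷ A = 𝟙 _ ⊗≫ B ◁ a.coev ⊗≫ 𝟙 _ := by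
    have h := cross_copairing (hbPos B) a.coev
    rw [cross_tensor] at h
    simp only [cross_hbPos] at h
    calc
      _ = (a.coev ▷ B ≫ (𝟙 ((Aᘁ ⊗ A) ⊗ B) ⊗≫ Aᘁ ◁ (β_ A B).hom ⊗≫ (β_ (Aᘁ) B).hom ▷ A ⊗≫
          𝟙 (B ⊗ Aᘁ ⊗ A))) ⊗≫ 𝟙 _ := by monoidal
      _ = _ := by rw [h]; monoidal
  calc
    _ = A ◁ (B ◁ inc Xs s e ≫ omega Xs B) ⊗≫ gamma Xs s A ▷ B ⊗≫ unitObj Xs ◁ (β_ A B).hom := by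
      monoidal
    _ = A ◁ cross (hbTensor (hbPos S) (hbNeg Z)) B ⊗≫ (A ◁ inc Xs s e ≫ gamma Xs s A) ▷ B ⊗≫
        unitObj Xs ◁ (β_ A B).hom := by
      rw [inc_omega Xs hs]; monoidal
    _ = A ◁ cross (hbTensor (hbPos S) (hbNeg Z)) B ⊗≫ (A ⊗ S ⊗ Z) ◁ a.coev ▷ B ⊗≫
        (inc Xs s (nest a.ev e) ▷ (A ⊗ B) ≫ unitObj Xs ◁ (β_ A B).hom) := by
      rw [inc_gamma Xs hs a, gammaApp]; monoidal
    _ = A ◁ cross (hbTensor (hbPos S) (hbNeg Z)) B ⊗≫ (A ⊗ S ⊗ Z) ◁ (a.coev ▷ B ⊗≫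
          Aᘁ ◁ (β_ A B).hom) ⊗≫ inc Xs s (nest a.ev e) ▷ (B ⊗ A) := by
      rw [← whisker_exchange]; monoidal
    _ = A ◁ cross (hbTensor (hbPos S) (hbNeg Z)) B ⊗≫ (A ⊗ S ⊗ Z) ◁ (a.coev ▷ B ⊗≫
          Aᘁ ◁ (β_ A B).hom ⊗≫ ((β_ (Aᘁ) B).hom ≫ (β_ (Aᘁ) B).inv) ▷ A) ⊗≫
        inc Xs s (nest a.ev e) ▷ (B ⊗ A) := by
      rw [Iso.hom_inv_id]; monoidal
    _ = A ◁ cross (hbTensor (hbPos S) (hbNeg Z)) B ⊗≫ (A ⊗ S ⊗ Z) ◁ ((a.coev ▷ B ⊗≫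
          Aᘁ ◁ (β_ A B).hom ⊗≫ (β_ (Aᘁ) B).hom ▷ A) ⊗≫ (β_ (Aᘁ) B).inv ▷ A) ⊗≫
        inc Xs s (nest a.ev e) ▷ (B ⊗ A) := by monoidal
    _ = 𝟙 _ ⊗≫ (A ◁ cross (hbTensor (hbPos S) (hbNeg Z)) B) ▷ 𝟙_ C ⊗≫ (A ⊗ S ⊗ Z ⊗ B) ◁ a.coev ⊗≫
        (A ⊗ S ⊗ Z) ◁ (β_ (Aᘁ) B).inv ▷ A ⊗≫ inc Xs s (nest a.ev e) ▷ (B ⊗ A) := by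
      rw [hc]; monoidal
    _ = 𝟙 _ ⊗≫ ((A ◁ cross (hbTensor (hbPos S) (hbNeg Z)) B) ▷ 𝟙_ C ≫
        (A ⊗ (S ⊗ Z) ⊗ B) ◁ a.coev) ⊗≫
        (A ⊗ S ⊗ Z) ◁ (β_ (Aᘁ) B).inv ▷ A ⊗≫ inc Xs s (nest a.ev e) ▷ (B ⊗ A) := by
      monoidal
    _ = 𝟙 _ ⊗≫ (A ⊗ B ⊗ S ⊗ Z) ◁ a.coev ⊗≫
        A ◁ cross (hbTensor (hbPos S) (hbNeg Z)) B ▷ (Aᘁ ⊗ A) ⊗≫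
        (A ⊗ S ⊗ Z) ◁ (β_ (Aᘁ) B).inv ▷ A ⊗≫ inc Xs s (nest a.ev e) ▷ (B ⊗ A) := by
      rw [← whisker_exchange]; monoidal
    -- Inserting a cancelling pair of braidings of `A` and `B` completes the crossing of `B` past
    -- all of `A ⊗ S`, so that `inc_omega` applies to the enlarged pair.
    _ = 𝟙 _ ⊗≫ (A ⊗ B ⊗ S ⊗ Z) ◁ a.coev ⊗≫ ((β_ B A).inv ≫ (β_ B A).hom) ▷ (S ⊗ Z ⊗ Aᘁ ⊗ A) ⊗≫
        A ◁ cross (hbTensor (hbPos S) (hbNeg Z)) B ▷ (Aᘁ ⊗ A) ⊗≫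
        (A ⊗ S ⊗ Z) ◁ (β_ (Aᘁ) B).inv ▷ A ⊗≫ inc Xs s (nest a.ev e) ▷ (B ⊗ A) := by
      rw [Iso.inv_hom_id]; monoidal
    _ = 𝟙 _ ⊗≫ ((A ⊗ B) ◁ (S ⊗ Z) ◁ a.coev ≫ (β_ B A).inv ▷ ((S ⊗ Z) ⊗ Aᘁ ⊗ A)) ⊗≫
        (cross (hbTensor (hbPos (A ⊗ S)) (hbNeg (Z ⊗ Aᘁ))) B ≫ inc Xs s (nest a.ev e) ▷ B) ▷ A ⊗≫
        𝟙 _ := by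
      rw [cross_hbTensor, cross_hbTensor, ← cross_hbTensor_hbPos, ← cross_hbTensor_hbNeg]
      simp only [cross_hbTensor, cross_hbPos, cross_hbNeg]
      monoidal
    _ = 𝟙 _ ⊗≫ (β_ B A).inv ▷ (S ⊗ Z) ⊗≫ B ◁ (A ◁ inc Xs s e ≫ gamma Xs s A) ⊗≫
        omega Xs B ▷ A ⊗≫ 𝟙 _ := by
      rw [← inc_omega Xs hs, whisker_exchange, inc_gamma Xs hs a, gammaApp]; monoidal
    _ = 𝟙 _ ⊗≫ ((β_ B A).inv ▷ (S ⊗ Z) ≫ (B ⊗ A) ◁ inc Xs s e) ⊗≫ B ◁ gamma Xs s A ⊗≫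
        omega Xs B ▷ A ⊗≫ 𝟙 _ := by monoidal
    _ = _ := by rw [← whisker_exchange]; monoidal

end HalfBraidings

/-! ### Bending strands, the fusion identity and the handle slide. -/

section Bending

variable {C : Type u} [Category.{v} C] [MonoidalCategory C] [BraidedCategory C]
  [RightRigidCategory C] [RibbonCategory C]

/-- The map `A^* ⊗ Y ⟶ X` corresponding to `q : Y ⟶ A ⊗ X`. -/
def absorb {A X Y : C} (q : Y ⟶ A ⊗ X) : Aᘁ ⊗ Y ⟶ X := Aᘁ ◁ q ⊗≫ ε_ A (Aᘁ) ▷ X ⊗≫ 𝟙 _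

/-- The map `X ⟶ A^* ⊗ Y` corresponding to `p : A ⊗ X ⟶ Y`. -/
def bend {A X Y : C} (p : A ⊗ X ⟶ Y) : X ⟶ Aᘁ ⊗ Y := 𝟙 _ ⊗≫ coevTilde A ▷ X ⊗≫ Aᘁ ◁ p

theorem bend_evTilde {A X Y : C} (p : A ⊗ X ⟶ Y) :
    A ◁ bend p ⊗≫ evTilde A ▷ Y ⊗≫ 𝟙 _ = p := by
  simp only [bend]
  calc
    _ = 𝟙 _ ⊗≫ A ◁ coevTilde A ▷ X ⊗≫ ((A ⊗ Aᘁ) ◁ p ≫ evTilde A ▷ Y) ⊗≫ 𝟙 _ := by monoidal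
    _ = 𝟙 _ ⊗≫ (A ◁ coevTilde A ⊗≫ evTilde A ▷ A) ▷ X ⊗≫ p := by
      rw [whisker_exchange]; monoidal
    _ = _ := by rw [coevTilde_evTilde]; monoidal

theorem absorb_surjective {A X Y : C} (f : Aᘁ ⊗ Y ⟶ X) :
    absorb (𝟙 _ ⊗≫ η_ A (Aᘁ) ▷ Y ⊗≫ A ◁ f) = f := by
  simp only [absorb]
  calc
    _ = 𝟙 _ ⊗≫ (Aᘁ : C) ◁ η_ A (Aᘁ) ▷ Y ⊗≫ ((Aᘁ ⊗ A) ◁ f ≫ ε_ A (Aᘁ) ▷ X) ⊗≫ 𝟙 _ := by monoidal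
    _ = 𝟙 _ ⊗≫ ((Aᘁ : C) ◁ η_ A (Aᘁ) ⊗≫ ε_ A (Aᘁ) ▷ (Aᘁ : C)) ▷ Y ⊗≫ f := by
      rw [whisker_exchange]; monoidal
    _ = _ := by rw [ExactPairing.coevaluation_evaluation'']; monoidal

theorem absorb_comp {A X Y W : C} (r : W ⟶ Y) (q : Y ⟶ A ⊗ X) :
    absorb (r ≫ q) = Aᘁ ◁ r ≫ absorb q := by
  simp only [absorb]; monoidal

/-- An `X`-loop to the right of `A`, fused with `A` by `p` and `q`. -/
def fusedLoop {A X Y : C} (p : A ⊗ X ⟶ Y) (q : Y ⟶ A ⊗ X) : A ⟶ (Y ⊗ Yᘁ) ⊗ A :=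
  𝟙 _ ⊗≫ A ◁ η_ X (Xᘁ) ⊗≫ (A ⊗ X ⊗ Xᘁ) ◁ coevTilde A ⊗≫
    (p ▷ (Xᘁ ⊗ Aᘁ) ≫ Y ◁ mate ((Xᘁ ⊗ Aᘁ) ◁ q ≫ nest (ε_ A (Aᘁ)) (ε_ X (Xᘁ)))) ▷ A

/-- The strands of `X` straighten out, so that `p` and `q` enter only through the endomorphism
`absorb q ≫ bend p` of `Aᘁ ⊗ Y`. The sum over colours of `X` can then be taken inside this
endomorphism. -/
theorem fusedLoop_eq {A X Y : C} (p : A ⊗ X ⟶ Y) (q : Y ⟶ A ⊗ X) :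
    fusedLoop p q =
      𝟙 _ ⊗≫ A ◁ coevTilde A ⊗≫ (A ⊗ Aᘁ) ◁ η_ Y (Yᘁ) ▷ A ⊗≫
        A ◁ (absorb q ≫ bend p) ▷ (Yᘁ ⊗ A) ⊗≫ evTilde A ▷ (Y ⊗ Yᘁ ⊗ A) ⊗≫ 𝟙 _ := by
  simp only [fusedLoop, mate, nest]
  calc
    _ = 𝟙 _ ⊗≫ A ◁ η_ X (Xᘁ) ⊗≫ (A ⊗ X ⊗ Xᘁ) ◁ coevTilde A ⊗≫
        (p ▷ (Xᘁ ⊗ Aᘁ ⊗ A) ≫ Y ◁ (𝟙 (Xᘁ ⊗ Aᘁ ⊗ A) ⊗≫ (Xᘁ ⊗ Aᘁ) ◁ η_ Y (Yᘁ) ▷ A ⊗≫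
          Xᘁ ◁ (Aᘁ ◁ q ⊗≫ ε_ A (Aᘁ) ▷ X ⊗≫ 𝟙 X) ▷ (Yᘁ ⊗ A) ⊗≫ ε_ X (Xᘁ) ▷ (Yᘁ ⊗ A) ⊗≫
          𝟙 (Yᘁ ⊗ A))) ⊗≫ 𝟙 _ := by monoidal
    _ = 𝟙 _ ⊗≫ A ◁ (η_ X (Xᘁ) ▷ 𝟙_ C ≫ (X ⊗ Xᘁ) ◁ (coevTilde A ⊗≫ Aᘁ ◁ η_ Y (Yᘁ) ▷ A ⊗≫
          absorb q ▷ (Yᘁ ⊗ A))) ⊗≫ (A ⊗ X) ◁ ε_ X (Xᘁ) ▷ (Yᘁ ⊗ A) ⊗≫ p ▷ (Yᘁ ⊗ A) ⊗≫ 𝟙 _ := by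
      rw [← whisker_exchange, absorb]; monoidal
    _ = 𝟙 _ ⊗≫ A ◁ (coevTilde A ⊗≫ Aᘁ ◁ η_ Y (Yᘁ) ▷ A ⊗≫ absorb q ▷ (Yᘁ ⊗ A)) ⊗≫
        A ◁ (η_ X (Xᘁ) ▷ X ⊗≫ X ◁ ε_ X (Xᘁ)) ▷ (Yᘁ ⊗ A) ⊗≫ p ▷ (Yᘁ ⊗ A) ⊗≫ 𝟙 _ := by
      rw [← whisker_exchange]; monoidal
    _ = 𝟙 _ ⊗≫ A ◁ (coevTilde A ⊗≫ Aᘁ ◁ η_ Y (Yᘁ) ▷ A ⊗≫ absorb q ▷ (Yᘁ ⊗ A)) ⊗≫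
        (A ◁ bend p ⊗≫ evTilde A ▷ Y ⊗≫ 𝟙 Y) ▷ (Yᘁ ⊗ A) ⊗≫ 𝟙 _ := by
      rw [ExactPairing.evaluation_coevaluation'', bend_evTilde]; monoidal
    _ = _ := by monoidal

end Bending

section Kirby

variable (k : Type w) [Field k] [IsAlgClosed k]
  {C : Type u} [Category.{v} C] [Abelian C] [Linear k C] [MonoidalCategory C]
  [MonoidalPreadditive C] [MonoidalLinear k C] [BraidedCategory C]
  [RightRigidCategory C] [RibbonCategory C] [IsFusion k C]
  {J : Type x} [Fintype J] (Xs : SimpleReps C J)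

open Classical in
-- By Schur the composite is a scalar `c`. `trace_rotate` equates its trace `c * d_j` with the trace
-- of `q_b ≫ p_a`, which is `d_i` or `0`.
theorem bend_absorb (A : C) (i j : J) (D : Decomp Xs (A ⊗ Xs.obj j)) (a b : Fin (D.n i)) :
    dim k (Xs.obj j) • (bend (D.p i a) ≫ absorb (D.q i b)) =
      if a = b then dim k (Xs.obj i) • 𝟙 (Xs.obj j) else 0 := by
  obtain ⟨c, hc⟩ := Xs.exists_smul k (bend (D.p i a) ≫ absorb (D.q i b))
  have h := trace_rotate (bend (D.p i a)) (D.q i b)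
  have h1 : bend (D.p i a) ⊗≫ Aᘁ ◁ D.q i b ⊗≫ ε_ A (Aᘁ) ▷ Xs.obj j ⊗≫ 𝟙 _ =
      bend (D.p i a) ≫ absorb (D.q i b) := by simp only [absorb]; monoidal
  have h2 : D.q i b ⊗≫ A ◁ bend (D.p i a) ⊗≫ evTilde A ▷ Xs.obj i ⊗≫ 𝟙 _ =
      D.q i b ≫ D.p i a := by
    conv_rhs => rw [← bend_evTilde (D.p i a)]
    monoidal
  rw [h1, h2, hc, trace_smul, trace_id k, D.orth] at h
  have : Simple (𝟙_ C) := IsFusion.simple_unit k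
  have hinj : ∀ x y : k, x • 𝟙 (𝟙_ C) = y • 𝟙 (𝟙_ C) → x = y :=
    fun x y => smul_left_injective k (id_nonzero (𝟙_ C)) (a₁ := x) (a₂ := y)
  rw [hc, smul_smul]
  by_cases hab : a = b
  · subst hab
    rw [if_pos rfl, trace_id k, smul_smul] at h
    rw [if_pos rfl, mul_comm, hinj _ _ h]
  · rw [if_neg fun hba => hab hba.symm] at h
    have h0 : trace (0 : Xs.obj i ⟶ Xs.obj i) = 0 := by simp [trace]
    rw [h0, smul_smul] at h
    rw [if_neg hab, mul_comm, hinj _ 0 (h.trans (zero_smul _ _).symm), zero_smul]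

/-- The fusion identity: up to the factor `d_i / d_j`, the maps `absorb q` and `bend p` are dual
bases for the simple constituents of `Aᘁ ⊗ X_i`. The sum acts by `d_i` on each `absorb q`, hence on
every map to a simple object, hence on a complete decomposition. -/
theorem sum_absorb_bend (A : C) (i : J) :
    ∑ j, dim k (Xs.obj j) • ∑ a, absorb ((dec k Xs (A ⊗ Xs.obj j)).q i a) ≫
      bend ((dec k Xs (A ⊗ Xs.obj j)).p i a) = dim k (Xs.obj i) • 𝟙 (Aᘁ ⊗ Xs.obj i) := by
  classical
  set E := ∑ j, dim k (Xs.obj j) • ∑ a, absorb ((dec k Xs (A ⊗ Xs.obj j)).q i a) ≫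
      bend ((dec k Xs (A ⊗ Xs.obj j)).p i a) with hE
  have h1 : ∀ j a, E ≫ absorb ((dec k Xs (A ⊗ Xs.obj j)).q i a) =
      dim k (Xs.obj i) • absorb ((dec k Xs (A ⊗ Xs.obj j)).q i a) := by
    intro j b
    rw [hE, Preadditive.sum_comp, Finset.sum_eq_single j]
    · rw [Linear.smul_comp, Preadditive.sum_comp, Finset.smul_sum, Finset.sum_eq_single b]
      · rw [Category.assoc, ← Linear.comp_smul, bend_absorb k Xs A i j, if_pos rfl,
          Linear.comp_smul, Category.comp_id]
      · intro a _ hab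
        rw [Category.assoc, ← Linear.comp_smul, bend_absorb k Xs A i j, if_neg hab, comp_zero]
      · simp
    · intro l _ hlj
      rw [Linear.smul_comp, Preadditive.sum_comp, Finset.sum_eq_zero, smul_zero]
      intro a _
      rw [Category.assoc, Xs.eq_zero hlj (bend _ ≫ absorb _), comp_zero]
    · simp
  have h2 : ∀ j (f : Aᘁ ⊗ Xs.obj i ⟶ Xs.obj j), E ≫ f = dim k (Xs.obj i) • f := by
    intro j f
    -- Every map to `X_j` is an `absorb r`, and `r` expands in the basis `q`.
    have hf := absorb_surjective f
    set r : Xs.obj i ⟶ A ⊗ Xs.obj j := 𝟙 _ ⊗≫ η_ A (Aᘁ) ▷ Xs.obj i ⊗≫ A ◁ f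
    have hr := (dec k Xs (A ⊗ Xs.obj j)).expand_comp r
    have h3 : f = ∑ a, absorb ((r ≫ (dec k Xs (A ⊗ Xs.obj j)).p i a) ≫
        (dec k Xs (A ⊗ Xs.obj j)).q i a) := by
      rw [← hf]
      conv_lhs => rw [hr]
      simp [absorb, monoidalComp, whiskerLeft_sum, Preadditive.sum_comp]
    rw [h3, Preadditive.comp_sum, Finset.smul_sum]
    refine Finset.sum_congr rfl fun a _ => ?_
    obtain ⟨c, hc⟩ := Xs.exists_smul k (r ≫ (dec k Xs (A ⊗ Xs.obj j)).p i a)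
    rw [hc, absorb_comp, MonoidalLinear.whiskerLeft_smul, Linear.smul_comp, Linear.comp_smul,
      whiskerLeft_id, Category.id_comp, h1, smul_comm]
  have h4 : ∀ j b, E ≫ (dec k Xs (Aᘁ ⊗ Xs.obj i)).p j b ≫ (dec k Xs (Aᘁ ⊗ Xs.obj i)).q j b =
      dim k (Xs.obj i) • ((dec k Xs (Aᘁ ⊗ Xs.obj i)).p j b ≫
        (dec k Xs (Aᘁ ⊗ Xs.obj i)).q j b) := by
    intro j b
    rw [← Category.assoc, h2, Linear.smul_comp]
  rw [← Category.comp_id E, ← (dec k Xs (Aᘁ ⊗ Xs.obj i)).complete]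
  simp only [Preadditive.comp_sum, h4, Finset.smul_sum]

theorem sum_fusedLoop (A : C) (i : J) :
    ∑ j, dim k (Xs.obj j) • ∑ a, fusedLoop ((dec k Xs (A ⊗ Xs.obj j)).p i a)
      ((dec k Xs (A ⊗ Xs.obj j)).q i a) =
      dim k (Xs.obj i) • (𝟙 _ ⊗≫ η_ (Xs.obj i) ((Xs.obj i)ᘁ) ▷ A) := by
  set Y := Xs.obj i with hY
  -- The linear map that `fusedLoop_eq` applies to the endomorphism; on the identity the `A`-strands
  -- form a zigzag and only the coevaluation of `Y` is left.
  let G : (Aᘁ ⊗ Y ⟶ Aᘁ ⊗ Y) → (A ⟶ (Y ⊗ Yᘁ) ⊗ A) := fun t =>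
    𝟙 _ ⊗≫ A ◁ coevTilde A ⊗≫ (A ⊗ Aᘁ) ◁ η_ Y (Yᘁ) ▷ A ⊗≫
        A ◁ t ▷ (Yᘁ ⊗ A) ⊗≫ evTilde A ▷ (Y ⊗ Yᘁ ⊗ A) ⊗≫ 𝟙 _
  have hadd : ∀ {I : Type _} (u : Finset I) (t : I → (Aᘁ ⊗ Y ⟶ Aᘁ ⊗ Y)),
      G (∑ x ∈ u, t x) = ∑ x ∈ u, G (t x) := by
    intro I u t
    simp only [G, monoidalComp, whiskerLeft_sum, sum_whiskerRight, Preadditive.comp_sum,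
      Preadditive.sum_comp]
  have hadd' : ∀ {n : ℕ} (t : Fin n → (Aᘁ ⊗ Y ⟶ Aᘁ ⊗ Y)),
      G (∑ x, t x) = ∑ x, G (t x) := by
    intro n t
    simp only [G, monoidalComp, whiskerLeft_sum, sum_whiskerRight, Preadditive.comp_sum,
      Preadditive.sum_comp]
  have hsmul : ∀ (c : k) t, G (c • t) = c • G t := by
    intro c t
    simp only [G, monoidalComp, MonoidalLinear.whiskerLeft_smul, MonoidalLinear.smul_whiskerRight,
      Linear.comp_smul, Linear.smul_comp]
  have hid : G (𝟙 _) = 𝟙 _ ⊗≫ η_ Y (Yᘁ) ▷ A := by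
    simp only [G]
    calc
      _ = 𝟙 _ ⊗≫ A ◁ coevTilde A ⊗≫ ((A ⊗ Aᘁ) ◁ (η_ Y (Yᘁ) ▷ A) ≫ evTilde A ▷ ((Y ⊗ Yᘁ) ⊗ A)) ⊗≫
          𝟙 _ := by monoidal
      _ = 𝟙 _ ⊗≫ (A ◁ coevTilde A ⊗≫ evTilde A ▷ A) ⊗≫ η_ Y (Yᘁ) ▷ A := by
        rw [whisker_exchange]; monoidal
      _ = _ := by rw [coevTilde_evTilde]; monoidal
  have h := congrArg G (sum_absorb_bend k Xs A i)
  rw [hadd, hsmul, hid] at h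
  rw [← h]
  refine Finset.sum_congr rfl fun j _ => ?_
  rw [hsmul, hadd']
  refine congrArg _ (Finset.sum_congr rfl fun a _ => ?_)
  exact fusedLoop_eq _ _

variable (s : J → k)

/-- The weighted sum of the coevaluations of the simple objects. -/
def kirby : 𝟙_ C ⟶ unitObj Xs :=
  ∑ j, dim k (Xs.obj j) • (η_ (Xs.obj j) ((Xs.obj j)ᘁ) ≫ inc Xs s (ε_ (Xs.obj j) ((Xs.obj j)ᘁ)))

/-- The handle slide: `Γ_A` fuses `A` with each loop `X_j`, and after summing with weights `d_j` the
result is again the weighted loop, with `A` on its other side. -/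
theorem kirby_gamma (hs : ∀ j, s j ≠ 0) (A : C) :
    A ◁ kirby k Xs s ≫ gamma Xs s A = 𝟙 _ ⊗≫ kirby k Xs s ▷ A := by
  have h : ∀ j, A ◁ (dim k (Xs.obj j) • (η_ (Xs.obj j) ((Xs.obj j)ᘁ) ≫
      inc Xs s (ε_ (Xs.obj j) ((Xs.obj j)ᘁ)))) ≫ gamma Xs s A =
      ∑ i, (ρ_ A).hom ≫ ((s i)⁻¹ • ((dim k (Xs.obj j) • ∑ a,
        fusedLoop ((dec k Xs (A ⊗ Xs.obj j)).p i a) ((dec k Xs (A ⊗ Xs.obj j)).q i a)) ≫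
          unitι Xs i ▷ A)) := by
    intro j
    rw [MonoidalLinear.whiskerLeft_smul, Linear.smul_comp, MonoidalCategory.whiskerLeft_comp,
      Category.assoc, inc_gamma Xs hs (twistedDual A), gammaApp, inc]
    simp only [twistedDual, monoidalComp, sum_whiskerRight, Preadditive.comp_sum,
      MonoidalLinear.smul_whiskerRight, Linear.comp_smul, Linear.smul_comp, Finset.smul_sum,
      Preadditive.sum_comp]
    refine Finset.sum_congr rfl fun i _ => Finset.sum_congr rfl fun a _ => ?_
    rw [smul_comm, fusedLoop]
    congr 2
    monoidal
  have h' : ∀ i, (dim k (Xs.obj i) • (η_ (Xs.obj i) ((Xs.obj i)ᘁ) ≫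
      inc Xs s (ε_ (Xs.obj i) ((Xs.obj i)ᘁ)))) ▷ A = (λ_ A).hom ≫
      ((s i)⁻¹ • ((dim k (Xs.obj i) • (𝟙 _ ⊗≫ η_ (Xs.obj i) ((Xs.obj i)ᘁ) ▷ A)) ≫
        unitι Xs i ▷ A)) := by
    intro i
    rw [inc_ev]
    simp only [monoidalComp, MonoidalLinear.smul_whiskerRight, Linear.comp_smul, Linear.smul_comp,
      comp_whiskerRight]
    rw [smul_comm]
    congr 2
    monoidal
  -- The sums over the original colour `j` and the fused colour `i` are exchanged, so that
  -- `sum_fusedLoop` applies for fixed `i`.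
  rw [kirby, whiskerLeft_sum, Preadditive.sum_comp, Finset.sum_congr rfl fun j _ => h j,
    Finset.sum_comm, monoidalComp, sum_whiskerRight, Preadditive.comp_sum, Preadditive.comp_sum]
  refine Finset.sum_congr rfl fun i _ => ?_
  rw [h', ← Preadditive.comp_sum, ← Finset.smul_sum, ← Preadditive.sum_comp,
    sum_fusedLoop]
  rw [Linear.comp_smul, Linear.comp_smul, Linear.comp_smul, Linear.comp_smul]
  congr 1
  monoidal

end Kirby

/-! ### The coend acting on an object with two half-braidings. -/

section UnitAction

variable {k : Type w} [Field k] [IsAlgClosed k]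
  {C : Type u} [Category.{v} C] [Abelian C] [Linear k C] [MonoidalCategory C]
  [MonoidalPreadditive C] [MonoidalLinear k C] [BraidedCategory C]
  [RightRigidCategory C] [RibbonCategory C] [IsFusion k C]
  {J : Type x} [Fintype J] (Xs : SimpleReps C J) (s : J → k) {W : C}

/-- The dinatural family `act`. -/
def actDin (L R : HalfBraiding W) : Dinatural (tensorRight W) W where
  app e := act e L R
  right f e := whiskerRight_act f e L R
  left g e := whiskerLeft_act g e L R
  add e e' := by
    have h : tilde (e + e') = tilde e + tilde e' := by simp [tilde]
    simp only [act, h, monoidalComp, MonoidalPreadditive.whiskerLeft_add, Preadditive.comp_add,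
      Preadditive.add_comp]

/-- The action of `⨁_j X_j ⊗ X_j^*` on an object with two half-braidings. -/
def actU (L R : HalfBraiding W) : unitObj Xs ⊗ W ⟶ W := (actDin L R).desc Xs s

variable {s}

theorem inc_actU (hs : ∀ j, s j ≠ 0) (L R : HalfBraiding W) {S Z : C} (e : Z ⊗ S ⟶ 𝟙_ C) :
    inc Xs s e ▷ W ≫ actU Xs s L R = act e L R :=
  Dinatural.fac (F := tensorRight W) hs (actDin L R) e

/-- On `inc e` this is `act_nest`. It is how `R` is exchanged for `L`: a strand crossing by `R`
after the action may instead enter the coend through `Γ` and cross by `L` before it. -/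
theorem gamma_actU (hs : ∀ j, s j ≠ 0) (L R : HalfBraiding W) (A : C) :
    (𝟙 _ ⊗≫ gamma Xs s A ▷ W ⊗≫ unitObj Xs ◁ cross L A ⊗≫ actU Xs s L R ▷ A :
      A ⊗ (unitObj Xs ⊗ W) ⟶ W ⊗ A) = A ◁ actU Xs s L R ≫ cross R A := by
  refine unit_hom_ext (F := tensorRight W ⋙ tensorLeft A) (Xs := Xs) hs fun {S Z} e => ?_
  change A ◁ (inc Xs s e ▷ W) ≫ _ = A ◁ (inc Xs s e ▷ W) ≫ _
  let a := twistedDual A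
  calc
    _ = 𝟙 _ ⊗≫ (A ◁ inc Xs s e ≫ gamma Xs s A) ▷ W ⊗≫ unitObj Xs ◁ cross L A ⊗≫
        actU Xs s L R ▷ A := by monoidal
    _ = 𝟙 _ ⊗≫ (A ⊗ S ⊗ Z) ◁ a.coev ▷ W ⊗≫ (inc Xs s (nest a.ev e) ▷ (A ⊗ W) ≫
        unitObj Xs ◁ cross L A) ⊗≫ actU Xs s L R ▷ A := by
      rw [inc_gamma Xs hs a, gammaApp]; monoidal
    _ = 𝟙 _ ⊗≫ (A ⊗ S ⊗ Z) ◁ a.coev ▷ W ⊗≫ ((A ⊗ S) ⊗ (Z ⊗ Aᘁ)) ◁ cross L A ⊗≫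
        (inc Xs s (nest a.ev e) ▷ W ≫ actU Xs s L R) ▷ A := by
      rw [← whisker_exchange]; monoidal
    _ = A ◁ (inc Xs s e ▷ W ≫ actU Xs s L R) ≫ cross R A := by
      rw [inc_actU Xs hs, inc_actU Xs hs, act_nest]
    _ = _ := by monoidal

theorem actU_exchange (hs : ∀ j, s j ≠ 0) {B : C} {L R N : HalfBraiding W} {b b' : HalfBraiding B}
    (hL : ExchAt b b' L N) (hR : ExchAt b b' R N) :
    (unitObj Xs ◁ cross N B ⊗≫ actU Xs s L R ▷ B : unitObj Xs ⊗ (B ⊗ W) ⟶ W ⊗ B) =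
      𝟙 _ ⊗≫ cross b (unitObj Xs) ▷ W ⊗≫ B ◁ actU Xs s L R ≫ cross N B := by
  refine unit_hom_ext (F := tensorRight (B ⊗ W)) (Xs := Xs) hs fun {S Z} e => ?_
  change inc Xs s e ▷ (B ⊗ W) ≫ _ = inc Xs s e ▷ (B ⊗ W) ≫ _
  calc
    _ = (inc Xs s e ▷ (B ⊗ W) ≫ unitObj Xs ◁ cross N B) ⊗≫ actU Xs s L R ▷ B := by monoidal
    _ = (S ⊗ Z) ◁ cross N B ⊗≫ (inc Xs s e ▷ W ≫ actU Xs s L R) ▷ B := by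
      rw [← whisker_exchange]; monoidal
    _ = 𝟙 _ ⊗≫ (𝟙 ((S ⊗ Z) ⊗ B) ⊗≫ S ◁ cross b Z ⊗≫ cross b S ▷ Z ⊗≫ 𝟙 (B ⊗ (S ⊗ Z))) ▷ W ⊗≫
        B ◁ (inc Xs s e ▷ W ≫ actU Xs s L R) ≫ cross N B := by
      rw [inc_actU Xs hs, act_exchange e hL hR]; monoidal
    _ = 𝟙 _ ⊗≫ (cross b (S ⊗ Z) ≫ B ◁ inc Xs s e) ▷ W ⊗≫ B ◁ actU Xs s L R ≫ cross N B := by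
      rw [← cross_tensor]; monoidal
    _ = _ := by rw [← cross_naturality]; monoidal

/-- `Ω_B` crosses `S` and `Z` by braidings of opposite sense. Here `L` and `R` start from `hbPos`
and `hbNeg`, so the crossings produced by `act_exchange` cancel both. -/
theorem actU_exchange_omega (hs : ∀ j, s j ≠ 0) {B : C} {L R N : HalfBraiding W}
    {b : HalfBraiding B} (hL : ExchAt (hbPos B) b L N) (hR : ExchAt (hbNeg B) b R N) :
    (𝟙 _ ⊗≫ omega Xs B ▷ W ⊗≫ unitObj Xs ◁ cross N B ⊗≫ actU Xs s L R ▷ B :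
      B ⊗ (unitObj Xs ⊗ W) ⟶ W ⊗ B) = B ◁ actU Xs s L R ≫ cross N B := by
  refine unit_hom_ext (F := tensorRight W ⋙ tensorLeft B) (Xs := Xs) hs fun {S Z} e => ?_
  change B ◁ (inc Xs s e ▷ W) ≫ _ = B ◁ (inc Xs s e ▷ W) ≫ _
  calc
    _ = 𝟙 _ ⊗≫ (B ◁ inc Xs s e ≫ omega Xs B) ▷ W ⊗≫ unitObj Xs ◁ cross N B ⊗≫
        actU Xs s L R ▷ B := by monoidal
    _ = 𝟙 _ ⊗≫ cross (hbTensor (hbPos S) (hbNeg Z)) B ▷ W ⊗≫ (inc Xs s e ▷ (B ⊗ W) ≫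
        unitObj Xs ◁ cross N B) ⊗≫ actU Xs s L R ▷ B := by
      rw [inc_omega Xs hs]; monoidal
    _ = 𝟙 _ ⊗≫ cross (hbTensor (hbPos S) (hbNeg Z)) B ▷ W ⊗≫ ((S ⊗ Z) ◁ cross N B ⊗≫
        (inc Xs s e ▷ W ≫ actU Xs s L R) ▷ B) := by
      rw [← whisker_exchange]; monoidal
    _ = 𝟙 _ ⊗≫ (β_ B S).hom ▷ (Z ⊗ W) ⊗≫ S ◁ ((β_ Z B).inv ≫ (β_ Z B).hom) ▷ W ⊗≫
        (β_ B S).inv ▷ (Z ⊗ W) ⊗≫ B ◁ act e L R ≫ cross N B := by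
      rw [inc_actU Xs hs, act_exchange e hL hR, cross_hbTensor]
      simp only [cross_hbPos, cross_hbNeg]
      monoidal
    _ = 𝟙 _ ⊗≫ ((β_ B S).hom ≫ (β_ B S).inv) ▷ (Z ⊗ W) ⊗≫
        B ◁ act e L R ≫ cross N B := by
      rw [Iso.inv_hom_id]; monoidal
    _ = B ◁ (inc Xs s e ▷ W ≫ actU Xs s L R) ≫ cross N B := by
      rw [Iso.hom_inv_id, inc_actU Xs hs]; monoidal
    _ = _ := by monoidal

end UnitAction

/-! ### The averaging projector and idempotence of `Q`. -/

section Averages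

variable (k : Type w) [Field k] [IsAlgClosed k]
  {C : Type u} [Category.{v} C] [Abelian C] [Linear k C] [MonoidalCategory C]
  [MonoidalPreadditive C] [MonoidalLinear k C] [BraidedCategory C]
  [RightRigidCategory C] [RibbonCategory C] [IsFusion k C]
  {J : Type x} [Fintype J] (Xs : SimpleReps C J) {W : C}

/-- The normalized sum of the loops around `W`. -/
def average (L R : HalfBraiding W) : W ⟶ W :=
  (globalDim k Xs)⁻¹ • ∑ j, dim k (Xs.obj j) • encircle L R (Xs.obj j)

theorem Q_eq_average {X Y : C} (l : HalfBraiding X) (m : HalfBraiding Y) :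
    Q k Xs l m = average k Xs (hbTensor l (hbPos Y)) (hbTensor (hbNeg X) m) := by
  simp only [Q, average, loop_eq_encircle]

theorem average_hbNeg (X : C) (L R : HalfBraiding W) :
    average k Xs (hbTensor (hbNeg X) L) (hbTensor (hbNeg X) R) = X ◁ average k Xs L R := by
  simp only [average, encircle_hbNeg, MonoidalLinear.whiskerLeft_smul, whiskerLeft_sum]

theorem average_hbPos (Z : C) (L R : HalfBraiding W) :
    average k Xs (hbTensor L (hbPos Z)) (hbTensor R (hbPos Z)) = average k Xs L R ▷ Z := by
  simp only [average, encircle_hbPos, MonoidalLinear.smul_whiskerRight, sum_whiskerRight]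

/-- The average is the action of the Kirby element, so that its properties follow from those of
`kirby` and `actU`. -/
theorem average_eq {s : J → k} (hs : ∀ j, s j ≠ 0) (L R : HalfBraiding W) :
    average k Xs L R =
      (globalDim k Xs)⁻¹ • ((λ_ W).inv ≫ kirby k Xs s ▷ W ≫ actU Xs s L R) := by
  simp only [average, kirby, encircle, sum_whiskerRight, Preadditive.comp_sum, Preadditive.sum_comp,
    MonoidalLinear.smul_whiskerRight, Linear.comp_smul, Linear.smul_comp, comp_whiskerRight,
    Category.assoc, inc_actU Xs hs]

/-- Each loop contributes its closed value `d_j`, and the weighted sum `∑ d_j²` cancels the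
normalisation. -/
theorem comp_average (hD : globalDim k Xs ≠ 0) {V : C} (L R : HalfBraiding W) (f : V ⟶ W)
    (h : ∀ A : C, A ◁ f ≫ cross L A = A ◁ f ≫ cross R A) : f ≫ average k Xs L R = f := by
  have h1 : ∀ j, f ≫ encircle L R (Xs.obj j) = dim k (Xs.obj j) • f := by
    intro j
    rw [comp_encircle L R f h, trace_id k]
    simp only [monoidalComp, MonoidalLinear.smul_whiskerRight, Linear.smul_comp, Linear.comp_smul]
    congr 1
    monoidal
  simp only [average, Linear.comp_smul, Preadditive.comp_sum, h1, smul_smul, ← pow_two,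
    ← Finset.sum_smul]
  rw [show ∑ j, dim k (Xs.obj j) ^ 2 = globalDim k Xs from rfl, inv_mul_cancel₀ hD, one_smul]

theorem average_comp (hD : globalDim k Xs ≠ 0) {V : C} (L R : HalfBraiding W) (g : W ⟶ V)
    (h : ∀ A : C, cross L A ≫ g ▷ A = cross R A ≫ g ▷ A) : average k Xs L R ≫ g = g := by
  have h1 : ∀ j, encircle L R (Xs.obj j) ≫ g = dim k (Xs.obj j) • g := by
    intro j
    rw [encircle_comp L R g h, trace_id k]
    simp only [monoidalComp, MonoidalLinear.smul_whiskerRight, Linear.smul_comp, Linear.comp_smul]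
    congr 1
    monoidal
  simp only [average, Linear.smul_comp, Preadditive.sum_comp, h1, smul_smul, ← pow_two,
    ← Finset.sum_smul]
  rw [show ∑ j, dim k (Xs.obj j) ^ 2 = globalDim k Xs from rfl, inv_mul_cancel₀ hD, one_smul]

/-- The average exchanges `L` for `R`. -/
theorem cross_average {s : J → k} (hs : ∀ j, s j ≠ 0) (L R : HalfBraiding W) (A : C) :
    cross L A ≫ average k Xs L R ▷ A = A ◁ average k Xs L R ≫ cross R A := by
  rw [average_eq k Xs hs]
  simp only [MonoidalLinear.smul_whiskerRight, MonoidalLinear.whiskerLeft_smul, Linear.comp_smul,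
    Linear.smul_comp]
  congr 1
  symm
  calc
    _ = 𝟙 _ ⊗≫ A ◁ kirby k Xs s ▷ W ⊗≫ (A ◁ actU Xs s L R ≫ cross R A) := by monoidal
    -- `A` is rerouted into the coend, trading `R` for `L`; the Kirby element then lets it through.
    _ = 𝟙 _ ⊗≫ (A ◁ kirby k Xs s ≫ gamma Xs s A) ▷ W ⊗≫ unitObj Xs ◁ cross L A ⊗≫
        actU Xs s L R ▷ A := by rw [← gamma_actU Xs hs]; monoidal
    _ = 𝟙 _ ⊗≫ (kirby k Xs s ▷ (A ⊗ W) ≫ unitObj Xs ◁ cross L A) ⊗≫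
        actU Xs s L R ▷ A := by rw [kirby_gamma k Xs s hs]; monoidal
    _ = _ := by rw [← whisker_exchange]; monoidal

/-- Half-braidings compatible with `L` and `R` commute with the average. -/
theorem average_exchange {s : J → k} (hs : ∀ j, s j ≠ 0) {L R N : HalfBraiding W} {B : C}
    {b b' : HalfBraiding B} (hL : ExchAt b b' L N) (hR : ExchAt b b' R N) :
    cross N B ≫ average k Xs L R ▷ B = B ◁ average k Xs L R ≫ cross N B := by
  rw [average_eq k Xs hs]
  simp only [MonoidalLinear.smul_whiskerRight, MonoidalLinear.whiskerLeft_smul, Linear.comp_smul,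
    Linear.smul_comp]
  congr 1
  calc
    _ = 𝟙 _ ⊗≫ ((𝟙_ C) ◁ cross N B ≫ kirby k Xs s ▷ (W ⊗ B)) ⊗≫ actU Xs s L R ▷ B := by monoidal
    _ = 𝟙 _ ⊗≫ kirby k Xs s ▷ (B ⊗ W) ⊗≫ (unitObj Xs ◁ cross N B ⊗≫ actU Xs s L R ▷ B) := by
      rw [whisker_exchange]; monoidal
    _ = 𝟙 _ ⊗≫ (kirby k Xs s ▷ B ≫ cross b (unitObj Xs)) ▷ W ⊗≫ B ◁ actU Xs s L R ≫ cross N B := by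
      rw [actU_exchange Xs hs hL hR]; monoidal
    _ = _ := by rw [cross_copairing]; monoidal

/-- Half-braidings `L` and `R` that can be slid past each other. -/
def Exchange (L R : HalfBraiding W) : Prop := ∀ B : C, ExchAt (hbPos B) (hbPos B) L R

variable {k} {s : J → k}

theorem Exchange.average_left {L R : HalfBraiding W} (h : Exchange L R) (hs : ∀ j, s j ≠ 0) :
    Intertwines L L (average k Xs L R) := fun B =>
  average_exchange k Xs hs (exchAt_hbNeg_self L B) (ExchAt.swap h B)

theorem Exchange.average_right {L R : HalfBraiding W} (h : Exchange L R) (hs : ∀ j, s j ≠ 0) :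
    Intertwines R R (average k Xs L R) := fun B =>
  average_exchange k Xs hs (h B) (exchAt_hbPos_self R B)

/-- The average turns `L` into `R`, but it also commutes with `L`; hence the two half-braidings
agree on its image. -/
theorem Exchange.whiskerLeft_average {L R : HalfBraiding W} (h : Exchange L R)
    (hs : ∀ j, s j ≠ 0) (A : C) :
    A ◁ average k Xs L R ≫ cross L A = A ◁ average k Xs L R ≫ cross R A := by
  rw [← cross_average k Xs hs, h.average_left Xs hs]

theorem Exchange.average_idem {L R : HalfBraiding W} (h : Exchange L R) (hs : ∀ j, s j ≠ 0)
    (hD : globalDim k Xs ≠ 0) :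
    average k Xs L R ≫ average k Xs L R = average k Xs L R :=
  comp_average k Xs hD L R _ (h.whiskerLeft_average Xs hs)

/-- On each of `X` and `Y` one of the two crossings is a braiding, which slides past any
half-braiding. -/
theorem exchange_crossings {X Y : C} (l : HalfBraiding X) (m : HalfBraiding Y) :
    Exchange (hbTensor l (hbPos Y)) (hbTensor (hbNeg X) m) := fun B =>
  (exchAt_hbNeg_right l B).tensor (exchAt_hbPos_left m B)

theorem Q_idem {s : J → k} (hs : ∀ j, s j ≠ 0) (hD : globalDim k Xs ≠ 0) {X Y : C}
    (l : HalfBraiding X) (m : HalfBraiding Y) : Q k Xs l m ≫ Q k Xs l m = Q k Xs l m := by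
  rw [Q_eq_average]
  exact (exchange_crossings l m).average_idem Xs hs hD

theorem nonempty_reducedTensor {s : J → k} (hs : ∀ j, s j ≠ 0) (hD : globalDim k Xs ≠ 0) {X Y : C}
    (l : HalfBraiding X) (m : HalfBraiding Y) : Nonempty (ReducedTensor k Xs l m) := by
  obtain ⟨I, i, e, h1, h2⟩ := IsIdempotentComplete.idempotents_split _ _ (Q_idem Xs hs hD l m)
  exact ⟨⟨I, i, e, h1, h2⟩⟩

end Averages

/-! ### Restricting half-braidings to images of idempotents. -/

section Restriction

variable {C : Type u} [Category.{v} C] [MonoidalCategory C]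

theorem Intertwines.inv {X Y : C} {l : HalfBraiding X} {m : HalfBraiding Y} {f : X ⟶ Y}
    (h : Intertwines l m f) {g : Y ⟶ X} (hgf : g ≫ f = 𝟙 Y) (hfg : f ≫ g = 𝟙 X) :
    Intertwines m l g := by
  intro A
  have h1 : A ◁ g ≫ A ◁ f = 𝟙 _ := by
    rw [← MonoidalCategory.whiskerLeft_comp, hgf, whiskerLeft_id]
  have h2 : f ▷ A ≫ g ▷ A = 𝟙 _ := by
    rw [← comp_whiskerRight, hfg, id_whiskerRight]
  calc
    cross m A ≫ g ▷ A = (A ◁ g ≫ A ◁ f) ≫ cross m A ≫ g ▷ A := by rw [h1, Category.id_comp]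
    _ = A ◁ g ≫ (A ◁ f ≫ cross m A) ≫ g ▷ A := by simp only [Category.assoc]
    _ = A ◁ g ≫ cross l A ≫ f ▷ A ≫ g ▷ A := by rw [← h A]; simp only [Category.assoc]
    _ = _ := by rw [h2, Category.comp_id]

theorem Intertwines.whiskerLeft {X Y Y' : C} (l : HalfBraiding X) {m : HalfBraiding Y}
    {m' : HalfBraiding Y'} {g : Y ⟶ Y'} (hg : Intertwines m m' g) :
    Intertwines (hbTensor l m) (hbTensor l m') (X ◁ g) := by
  have h := (intertwines_id l).tensor hg
  rwa [id_tensorHom] at h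

theorem Intertwines.whiskerRight {X X' Y : C} {l : HalfBraiding X} {l' : HalfBraiding X'}
    {f : X ⟶ X'} (hf : Intertwines l l' f) (m : HalfBraiding Y) :
    Intertwines (hbTensor l m) (hbTensor l' m) (f ▷ Y) := by
  have h := hf.tensor (intertwines_id m)
  rwa [tensorHom_id] at h

theorem Intertwines.of_cross_eq {X Y : C} {l l' : HalfBraiding X} {m m' : HalfBraiding Y} {f : X ⟶ Y}
    (h : Intertwines l m f) (hl : ∀ A, cross l A = cross l' A) (hm : ∀ A, cross m A = cross m' A) :
    Intertwines l' m' f := by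
  intro A
  rw [← hl, ← hm, h A]

variable {I W : C} {i : I ⟶ W} {p : W ⟶ I} {N : HalfBraiding W} {n : HalfBraiding I}

theorem intertwines_inclusion (hN : Intertwines N N (p ≫ i)) (hip : i ≫ p = 𝟙 I)
    (h : ∀ A, cross n A = A ◁ i ≫ cross N A ≫ p ▷ A) : Intertwines n N i := by
  intro A
  rw [h, Category.assoc, Category.assoc, ← comp_whiskerRight, hN A, ← Category.assoc,
    ← MonoidalCategory.whiskerLeft_comp, ← Category.assoc i, hip, Category.id_comp]

theorem intertwines_projection (hN : Intertwines N N (p ≫ i)) (hip : i ≫ p = 𝟙 I)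
    (h : ∀ A, cross n A = A ◁ i ≫ cross N A ≫ p ▷ A) : Intertwines N n p := by
  intro A
  rw [h, ← Category.assoc (A ◁ p), ← MonoidalCategory.whiskerLeft_comp, ← Category.assoc (A ◁ _),
    ← hN A, Category.assoc, ← comp_whiskerRight, Category.assoc, hip, Category.comp_id]

/-- The idempotent commutes with the crossings of `N`, so `p` carries `N` to the compressed
crossings (`hp`), which makes them multiplicative. Invertibility then comes from duals. -/
theorem exists_restriction [RightRigidCategory C] (hN : Intertwines N N (p ≫ i))
    (hip : i ≫ p = 𝟙 I) :
    ∃ n : HalfBraiding I, ∀ A, cross n A = A ◁ i ≫ cross N A ≫ p ▷ A := by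
  let c : ∀ A : C, A ⊗ I ⟶ I ⊗ A := fun A => A ◁ i ≫ cross N A ≫ p ▷ A
  have hp : ∀ A, A ◁ p ≫ c A = cross N A ≫ p ▷ A := by
    intro A
    change A ◁ p ≫ A ◁ i ≫ cross N A ≫ p ▷ A = _
    rw [← Category.assoc (A ◁ p), ← MonoidalCategory.whiskerLeft_comp, ← Category.assoc (A ◁ _),
      ← hN A, Category.assoc, ← comp_whiskerRight, Category.assoc, hip, Category.comp_id]
  have hnat : ∀ {A B : C} (f : A ⟶ B), f ▷ I ≫ c B = c A ≫ I ◁ f := by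
    intro A B f
    simp only [c, Category.assoc]
    rw [← whisker_exchange_assoc, cross_naturality_assoc, whisker_exchange]
  have htensor : ∀ A B : C, c (A ⊗ B) = 𝟙 _ ⊗≫ A ◁ c B ⊗≫ c A ▷ B ⊗≫ 𝟙 _ := by
    intro A B
    symm
    calc
      _ = 𝟙 _ ⊗≫ A ◁ (B ◁ i ≫ cross N B) ⊗≫ (A ◁ p ≫ c A) ▷ B ⊗≫ 𝟙 _ := by
        simp only [c]; monoidal
      _ = 𝟙 _ ⊗≫ A ◁ B ◁ i ⊗≫ (𝟙 ((A ⊗ B) ⊗ W) ⊗≫ A ◁ cross N B ⊗≫ cross N A ▷ B ⊗≫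
          𝟙 (W ⊗ A ⊗ B)) ⊗≫ p ▷ A ▷ B ⊗≫ 𝟙 _ := by rw [hp]; monoidal
      _ = _ := by rw [← cross_tensor]; simp only [c]; monoidal
  have hunit : c (𝟙_ C) = 𝟙 _ ⊗≫ 𝟙 _ := by
    simp only [c]
    calc
      _ = 𝟙 _ ⊗≫ (i ≫ p) ⊗≫ 𝟙 _ := by rw [cross_unit]; monoidal
      _ = _ := by rw [hip]; monoidal
  have := isIso_of_lax c hnat htensor hunit
  exact ⟨ofCross c hnat htensor, fun A => rfl⟩

/-- `L` and `R` agree on the map `f`. -/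
def Agree {V W : C} (L R : HalfBraiding W) (f : V ⟶ W) : Prop :=
  ∀ A : C, A ◁ f ≫ cross L A = A ◁ f ≫ cross R A

theorem Agree.comp {V W W' : C} {L R : HalfBraiding W} {L' R' : HalfBraiding W'} {f : V ⟶ W}
    (h : Agree L R f) {g : W ⟶ W'} (hL : Intertwines L L' g) (hR : Intertwines R R' g) :
    Agree L' R' (f ≫ g) := by
  intro A
  rw [MonoidalCategory.whiskerLeft_comp, Category.assoc, Category.assoc, ← hL A, ← hR A,
    ← Category.assoc, h A, Category.assoc]

theorem agree_of_intertwines {V W : C} {n : HalfBraiding V} {L R : HalfBraiding W} {f : V ⟶ W}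
    (hL : Intertwines n L f) (hR : Intertwines n R f) : Agree L R f := fun A =>
  (hL A).symm.trans (hR A)

theorem Agree.precomp {U V W : C} {L R : HalfBraiding W} {f : V ⟶ W} (h : Agree L R f)
    (g : U ⟶ V) : Agree L R (g ≫ f) := by
  intro A
  rw [MonoidalCategory.whiskerLeft_comp, Category.assoc, Category.assoc, h A]

end Restriction

/-! ### The two crossings past a tensor product. -/

section Crossings

variable {C : Type u} [Category.{v} C] [MonoidalCategory C] [BraidedCategory C]

/-- The half-braiding with crossings `crossLeft`. -/
abbrev hbLeft {X : C} (l : HalfBraiding X) (Y : C) : HalfBraiding (X ⊗ Y) := hbTensor l (hbPos Y)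

/-- The half-braiding with crossings `crossRight`. -/
abbrev hbRight (X : C) {Y : C} (m : HalfBraiding Y) : HalfBraiding (X ⊗ Y) := hbTensor (hbNeg X) m

theorem cross_hbLeft {X : C} (l : HalfBraiding X) (Y A : C) :
    cross (hbLeft l Y) A = crossLeft l Y A := cross_hbTensor _ _ _

theorem cross_hbRight (X : C) {Y : C} (m : HalfBraiding Y) (A : C) :
    cross (hbRight X m) A = crossRight X m A := cross_hbTensor _ _ _

/-- By the hexagon, braiding past `Y` and then past `Z` is braiding past `Y ⊗ Z`. -/
theorem intertwines_associator_left {X : C} (l : HalfBraiding X) (Y Z : C) :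
    Intertwines (hbLeft (hbLeft l Y) Z) (hbLeft l (Y ⊗ Z)) (α_ X Y Z).hom :=
  (Intertwines.associator l (hbPos Y) (hbPos Z)).of_cross_eq (fun _ => rfl) fun A => by
    rw [cross_hbTensor, cross_hbTensor_hbPos, cross_hbTensor]

theorem intertwines_associator_right (X Y : C) {Z : C} (n : HalfBraiding Z) :
    Intertwines (hbRight (X ⊗ Y) n) (hbRight X (hbRight Y n)) (α_ X Y Z).hom :=
  (Intertwines.associator (hbNeg X) (hbNeg Y) n).of_cross_eq (fun A => by
    rw [cross_hbTensor, cross_hbTensor_hbNeg, cross_hbTensor]) fun _ => rfl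

end Crossings

/-! ### Reduced tensor products, their morphisms and the associator. -/

section TensorProduct

variable {k : Type w} [Field k] [IsAlgClosed k]
  {C : Type u} [Category.{v} C] [Abelian C] [Linear k C] [MonoidalCategory C]
  [MonoidalPreadditive C] [MonoidalLinear k C] [BraidedCategory C]
  [RightRigidCategory C] [RibbonCategory C] [IsFusion k C]
  {J : Type x} [Fintype J] {Xs : SimpleReps C J} {s : J → k}

namespace ReducedTensor

variable {X Y : C} {l : HalfBraiding X} {m : HalfBraiding Y} (T : ReducedTensor k Xs l m)

theorem π_ι_left (hs : ∀ j, s j ≠ 0) : Intertwines (hbLeft l Y) (hbLeft l Y) (T.π ≫ T.ι) := by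
  rw [T.π_ι, Q_eq_average]
  exact (exchange_crossings l m).average_left Xs hs

theorem π_ι_right (hs : ∀ j, s j ≠ 0) : Intertwines (hbRight X m) (hbRight X m) (T.π ≫ T.ι) := by
  rw [T.π_ι, Q_eq_average]
  exact (exchange_crossings l m).average_right Xs hs

/-- COMM is what makes `Q` commute with the second half-braidings. Both strands of the loop must
cross `B` first by `hbNeg` and then by `hbPos`: for `hbLeft` the change happens at `X` by COMM for
`l`, for `hbRight` at `Y` by COMM for `m`. -/
theorem π_ι_tensor (hs : ∀ j, s j ≠ 0) {l₂ : HalfBraiding X} {m₂ : HalfBraiding Y}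
    (hl : COMM l l₂) (hm : COMM m m₂) :
    Intertwines (hbTensor l₂ m₂) (hbTensor l₂ m₂) (T.π ≫ T.ι) := by
  rw [T.π_ι, Q_eq_average]
  exact fun B => average_exchange k Xs hs
    (((comm_iff l l₂).1 hl B).tensor (exchAt_hbPos_left m₂ B))
    ((exchAt_hbNeg_left l₂ B).tensor ((comm_iff m m₂).1 hm B))

theorem ι_Q : T.ι ≫ Q k Xs l m = T.ι := by
  rw [← T.π_ι, ← Category.assoc, T.ι_π, Category.id_comp]

theorem agree_ι (hs : ∀ j, s j ≠ 0) : Agree (hbLeft l Y) (hbRight X m) T.ι := by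
  intro A
  have h := (exchange_crossings l m).whiskerLeft_average Xs hs A
  rw [← Q_eq_average] at h
  rw [← T.ι_Q, MonoidalCategory.whiskerLeft_comp, Category.assoc, Category.assoc, h]

instance : Mono T.ι := ⟨fun a b h => by
  simpa only [Category.assoc, T.ι_π, Category.comp_id] using congrArg (· ≫ T.π) h⟩

end ReducedTensor

variable {T : ∀ P R : ZEl C, ReducedTensor k Xs P.hb₁ R.hb₁}

namespace TensorObjects

variable (O : TensorObjects k Xs s T) (P R V : ZEl C)

/-- The inclusion of the tensor product. -/
def incl : (O.tensor P R).X ⟶ P.X ⊗ R.X := (T P R).ι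

/-- The projection onto the tensor product. -/
def proj : P.X ⊗ R.X ⟶ (O.tensor P R).X := (T P R).π

theorem incl_proj : O.incl P R ≫ O.proj P R = 𝟙 _ := (T P R).ι_π

theorem proj_incl : O.proj P R ≫ O.incl P R = Q k Xs P.hb₁ R.hb₁ := (T P R).π_ι

instance : Mono (O.incl P R) := inferInstanceAs (Mono (T P R).ι)

theorem agree_incl (hs : ∀ j, s j ≠ 0) :
    Agree (hbLeft P.hb₁ R.X) (hbRight P.X R.hb₁) (O.incl P R) :=
  (T P R).agree_ι hs

theorem incl_left (hs : ∀ j, s j ≠ 0) :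
    Intertwines (O.tensor P R).hb₁ (hbLeft P.hb₁ R.X) (O.incl P R) :=
  intertwines_inclusion ((T P R).π_ι_left hs) (T P R).ι_π fun A =>
    (O.tensor₁_left P R A).trans (by rw [cross_hbLeft]; rfl)

theorem proj_left (hs : ∀ j, s j ≠ 0) :
    Intertwines (hbLeft P.hb₁ R.X) (O.tensor P R).hb₁ (O.proj P R) :=
  intertwines_projection ((T P R).π_ι_left hs) (T P R).ι_π fun A =>
    (O.tensor₁_left P R A).trans (by rw [cross_hbLeft]; rfl)

theorem incl_right (hs : ∀ j, s j ≠ 0) :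
    Intertwines (O.tensor P R).hb₁ (hbRight P.X R.hb₁) (O.incl P R) :=
  intertwines_inclusion ((T P R).π_ι_right hs) (T P R).ι_π fun A =>
    (O.tensor₁_right P R A).trans (by rw [cross_hbRight]; rfl)

theorem proj_right (hs : ∀ j, s j ≠ 0) :
    Intertwines (hbRight P.X R.hb₁) (O.tensor P R).hb₁ (O.proj P R) :=
  intertwines_projection ((T P R).π_ι_right hs) (T P R).ι_π fun A =>
    (O.tensor₁_right P R A).trans (by rw [cross_hbRight]; rfl)

theorem incl_tensor (hs : ∀ j, s j ≠ 0) :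
    Intertwines (O.tensor P R).hb₂ (hbTensor P.hb₂ R.hb₂) (O.incl P R) :=
  intertwines_inclusion ((T P R).π_ι_tensor hs P.comm R.comm) (T P R).ι_π fun A =>
    (O.tensor₂_eq P R A).trans (by rw [cross_hbTensor, crossTensor]; rfl)

theorem proj_tensor (hs : ∀ j, s j ≠ 0) :
    Intertwines (hbTensor P.hb₂ R.hb₂) (O.tensor P R).hb₂ (O.proj P R) :=
  intertwines_projection ((T P R).π_ι_tensor hs P.comm R.comm) (T P R).ι_π fun A =>
    (O.tensor₂_eq P R A).trans (by rw [cross_hbTensor, crossTensor]; rfl)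

/-- Maps on which the two crossings agree factor through the tensor product. -/
theorem comp_proj_incl (hD : globalDim k Xs ≠ 0) {W : C} {P R : ZEl C} {f : W ⟶ P.X ⊗ R.X}
    (h : Agree (hbLeft P.hb₁ R.X) (hbRight P.X R.hb₁) f) :
    f ≫ O.proj P R ≫ O.incl P R = f := by
  rw [proj_incl, Q_eq_average]; exact comp_average k Xs hD _ _ f h

/-- By `average_hbNeg`, whiskering `Q` by `X` is again an average, so absorption on a triple product
needs only agreement of its two half-braidings. -/
theorem comp_whiskerLeft_proj_incl (hD : globalDim k Xs ≠ 0) {W X : C} {P R : ZEl C}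
    {f : W ⟶ X ⊗ (P.X ⊗ R.X)}
    (h : Agree (hbRight X (hbLeft P.hb₁ R.X)) (hbRight X (hbRight P.X R.hb₁)) f) :
    f ≫ X ◁ (O.proj P R ≫ O.incl P R) = f := by
  rw [proj_incl, Q_eq_average, ← average_hbNeg]; exact comp_average k Xs hD _ _ f h

theorem comp_whiskerRight_proj_incl (hD : globalDim k Xs ≠ 0) {W Z : C} {P R : ZEl C}
    {f : W ⟶ (P.X ⊗ R.X) ⊗ Z}
    (h : Agree (hbLeft (hbLeft P.hb₁ R.X) Z) (hbLeft (hbRight P.X R.hb₁) Z) f) :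
    f ≫ (O.proj P R ≫ O.incl P R) ▷ Z = f := by
  rw [proj_incl, Q_eq_average, ← average_hbPos]; exact comp_average k Xs hD _ _ f h

/-- The tensor product of two morphisms. -/
def tensorHom (hs : ∀ j, s j ≠ 0) {P P' R R' : ZEl C} (f : P ⟶ P') (g : R ⟶ R') :
    O.tensor P R ⟶ O.tensor P' R' where
  f := O.incl P R ≫ (f.f ⊗ₘ g.f) ≫ O.proj P' R'
  comm₁ := (O.incl_left P R hs).comp ((f.comm₁.tensor (.hbPos g.f)).comp (O.proj_left P' R' hs))
  comm₂ := (O.incl_tensor P R hs).comp ((f.comm₂.tensor g.comm₂).comp (O.proj_tensor P' R' hs))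

/-- `f ⊗ g` intertwines both crossings, so it maps the part where they agree into the corresponding
part and the projection is harmless. -/
theorem tensorHom_incl (hs : ∀ j, s j ≠ 0) (hD : globalDim k Xs ≠ 0) {P P' R R' : ZEl C}
    (f : P ⟶ P') (g : R ⟶ R') :
    (O.tensorHom hs f g).f ≫ O.incl P' R' = O.incl P R ≫ (f.f ⊗ₘ g.f) := by
  have h : Agree (hbLeft P'.hb₁ R'.X) (hbRight P'.X R'.hb₁) (O.incl P R ≫ (f.f ⊗ₘ g.f)) :=
    (O.agree_incl P R hs).comp (f.comm₁.tensor (.hbPos g.f)) (Intertwines.tensor (.hbNeg f.f) g.comm₁)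
  have h' := O.comp_proj_incl hD h
  simpa only [tensorHom, Category.assoc] using h'

theorem tensorHom_incl_assoc (hs : ∀ j, s j ≠ 0) (hD : globalDim k Xs ≠ 0) {P P' R R' : ZEl C}
    (f : P ⟶ P') (g : R ⟶ R') {Z : C} (h : P'.X ⊗ R'.X ⟶ Z) :
    (O.tensorHom hs f g).f ≫ O.incl P' R' ≫ h = O.incl P R ≫ (f.f ⊗ₘ g.f) ≫ h := by
  rw [← Category.assoc, O.tensorHom_incl hs hD, Category.assoc]

/-- The inclusion of an iterated tensor product bracketed to the left. -/
def inclL : (O.tensor (O.tensor P R) V).X ⟶ (P.X ⊗ R.X) ⊗ V.X :=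
  O.incl (O.tensor P R) V ≫ O.incl P R ▷ V.X

/-- The inclusion of an iterated tensor product bracketed to the right. -/
def inclR : (O.tensor P (O.tensor R V)).X ⟶ P.X ⊗ (R.X ⊗ V.X) :=
  O.incl P (O.tensor R V) ≫ P.X ◁ O.incl R V

/-- The associator as a map of `C`. -/
def assocMap : (O.tensor (O.tensor P R) V).X ⟶ (O.tensor P (O.tensor R V)).X :=
  O.inclL P R V ≫ (α_ P.X R.X V.X).hom ≫ P.X ◁ O.proj R V ≫ O.proj P (O.tensor R V)

/-- The inverse associator as a map of `C`. -/
def assocInvMap : (O.tensor P (O.tensor R V)).X ⟶ (O.tensor (O.tensor P R) V).X :=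
  O.inclR P R V ≫ (α_ P.X R.X V.X).inv ≫ O.proj P R ▷ V.X ≫ O.proj (O.tensor P R) V

theorem inclL_projL : O.inclL P R V ≫ O.proj P R ▷ V.X ≫ O.proj (O.tensor P R) V = 𝟙 _ := by
  rw [inclL, Category.assoc, ← comp_whiskerRight_assoc, incl_proj, id_whiskerRight,
    Category.id_comp, incl_proj]

theorem inclR_projR : O.inclR P R V ≫ P.X ◁ O.proj R V ≫ O.proj P (O.tensor R V) = 𝟙 _ := by
  rw [inclR, Category.assoc, ← MonoidalCategory.whiskerLeft_comp_assoc, incl_proj, whiskerLeft_id,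
    Category.id_comp, incl_proj]

/-- On a triple product there are three crossings, using the half-braiding of `P`, of `R` or of `V`
and braidings on the other factors. All three agree on the image of `inclL`: the second and third
make the inner projector invisible (`h1`), the first and second the outer one (`h2`). -/
theorem assocMap_inclR (hs : ∀ j, s j ≠ 0) (hD : globalDim k Xs ≠ 0) :
    O.assocMap P R V ≫ O.inclR P R V = O.inclL P R V ≫ (α_ P.X R.X V.X).hom := by
  have h1 : (O.inclL P R V ≫ (α_ P.X R.X V.X).hom) ≫ P.X ◁ (O.proj R V ≫ O.incl R V) =
      O.inclL P R V ≫ (α_ P.X R.X V.X).hom := by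
    refine O.comp_whiskerLeft_proj_incl hD ?_
    refine Agree.comp (L := hbLeft (hbRight P.X R.hb₁) V.X) (R := hbRight (P.X ⊗ R.X) V.hb₁) ?_
      (Intertwines.associator _ _ _) (intertwines_associator_right _ _ _)
    exact (O.agree_incl _ V hs).comp ((O.incl_right P R hs).whiskerRight _)
      ((Intertwines.hbNeg _).whiskerRight _)
  have h2 : (O.inclL P R V ≫ (α_ P.X R.X V.X).hom ≫ P.X ◁ O.proj R V) ≫
      O.proj P (O.tensor R V) ≫ O.incl P (O.tensor R V) =
      O.inclL P R V ≫ (α_ P.X R.X V.X).hom ≫ P.X ◁ O.proj R V := by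
    refine O.comp_proj_incl hD ?_
    refine Agree.comp (L := hbLeft (hbLeft P.hb₁ R.X) V.X) (R := hbLeft (hbRight P.X R.hb₁) V.X) ?_
      ((intertwines_associator_left _ _ _).comp ((Intertwines.hbPos _).whiskerLeft _))
      ((Intertwines.associator _ _ _).comp ((O.proj_left R V hs).whiskerLeft _))
    exact (agree_of_intertwines ((O.incl_left P R hs).whiskerRight _)
      ((O.incl_right P R hs).whiskerRight _)).precomp _
  simp only [inclR, assocMap, Category.assoc, MonoidalCategory.whiskerLeft_comp] at h1 h2 ⊢
  rw [reassoc_of% h2, h1]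

theorem assocInvMap_inclL (hs : ∀ j, s j ≠ 0) (hD : globalDim k Xs ≠ 0) :
    O.assocInvMap P R V ≫ O.inclL P R V = O.inclR P R V ≫ (α_ P.X R.X V.X).inv := by
  have h1 : (O.inclR P R V ≫ (α_ P.X R.X V.X).inv) ≫ (O.proj P R ≫ O.incl P R) ▷ V.X =
      O.inclR P R V ≫ (α_ P.X R.X V.X).inv := by
    refine O.comp_whiskerRight_proj_incl hD ?_
    refine Agree.comp (L := hbLeft P.hb₁ (R.X ⊗ V.X)) (R := hbRight P.X (hbLeft R.hb₁ V.X)) ?_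
      ((intertwines_associator_left _ _ _).inv (Iso.inv_hom_id _) (Iso.hom_inv_id _))
      (Intertwines.associator_inv _ _ _)
    exact (O.agree_incl P _ hs).comp ((Intertwines.hbPos _).whiskerLeft _)
      ((O.incl_left R V hs).whiskerLeft _)
  have h2 : (O.inclR P R V ≫ (α_ P.X R.X V.X).inv ≫ O.proj P R ▷ V.X) ≫
      O.proj (O.tensor P R) V ≫ O.incl (O.tensor P R) V =
      O.inclR P R V ≫ (α_ P.X R.X V.X).inv ≫ O.proj P R ▷ V.X := by
    refine O.comp_proj_incl hD ?_
    refine Agree.comp (L := hbRight P.X (hbLeft R.hb₁ V.X)) (R := hbRight P.X (hbRight R.X V.hb₁)) ?_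
      ((Intertwines.associator_inv _ _ _).comp ((O.proj_right P R hs).whiskerRight _))
      (((intertwines_associator_right _ _ _).inv (Iso.inv_hom_id _) (Iso.hom_inv_id _)).comp
        ((Intertwines.hbNeg _).whiskerRight _))
    exact (agree_of_intertwines ((O.incl_left R V hs).whiskerLeft _)
      ((O.incl_right R V hs).whiskerLeft _)).precomp _
  simp only [inclL, assocInvMap, Category.assoc, comp_whiskerRight] at h1 h2 ⊢
  rw [reassoc_of% h2, h1]

theorem assocMap_assocInvMap (hs : ∀ j, s j ≠ 0) (hD : globalDim k Xs ≠ 0) :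
    O.assocMap P R V ≫ O.assocInvMap P R V = 𝟙 _ := by
  rw [assocInvMap, reassoc_of% O.assocMap_inclR P R V hs hD, Iso.hom_inv_id_assoc, inclL_projL]

theorem assocInvMap_assocMap (hs : ∀ j, s j ≠ 0) (hD : globalDim k Xs ≠ 0) :
    O.assocInvMap P R V ≫ O.assocMap P R V = 𝟙 _ := by
  rw [assocMap, reassoc_of% O.assocInvMap_inclL P R V hs hD, Iso.inv_hom_id_assoc, inclR_projR]

theorem assocMap_intertwines₁ (hs : ∀ j, s j ≠ 0) :
    Intertwines (O.tensor (O.tensor P R) V).hb₁ (O.tensor P (O.tensor R V)).hb₁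
      (O.assocMap P R V) :=
  ((O.incl_left _ V hs).comp ((O.incl_left P R hs).whiskerRight _)).comp
    ((intertwines_associator_left _ _ _).comp
      (((Intertwines.hbPos _).whiskerLeft _).comp (O.proj_left P _ hs)))

theorem assocMap_intertwines₂ (hs : ∀ j, s j ≠ 0) :
    Intertwines (O.tensor (O.tensor P R) V).hb₂ (O.tensor P (O.tensor R V)).hb₂
      (O.assocMap P R V) :=
  ((O.incl_tensor _ V hs).comp ((O.incl_tensor P R hs).whiskerRight _)).comp
    ((Intertwines.associator _ _ _).comp
      (((O.proj_tensor R V hs).whiskerLeft _).comp (O.proj_tensor P _ hs)))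

/-- An isomorphism of the center from an isomorphism of `C`. -/
def _root_.EllipticCenter.ZEl.mkIso {P R : ZEl C} (f : P.X ⟶ R.X) (g : R.X ⟶ P.X)
    (hfg : f ≫ g = 𝟙 _) (hgf : g ≫ f = 𝟙 _) (h₁ : Intertwines P.hb₁ R.hb₁ f)
    (h₂ : Intertwines P.hb₂ R.hb₂ f) : P ≅ R where
  hom := ⟨f, h₁, h₂⟩
  inv := ⟨g, h₁.inv hgf hfg, h₂.inv hgf hfg⟩
  hom_inv_id := ZEl.Hom.ext hfg
  inv_hom_id := ZEl.Hom.ext hgf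

/-- The associator. -/
def associator (hs : ∀ j, s j ≠ 0) (hD : globalDim k Xs ≠ 0) :
    O.tensor (O.tensor P R) V ≅ O.tensor P (O.tensor R V) :=
  ZEl.mkIso (O.assocMap P R V) (O.assocInvMap P R V) (O.assocMap_assocInvMap P R V hs hD)
    (O.assocInvMap_assocMap P R V hs hD) (O.assocMap_intertwines₁ P R V hs)
    (O.assocMap_intertwines₂ P R V hs)

end TensorObjects

end TensorProduct

/-! ### Functoriality, naturality of the associator and the pentagon. -/

section Center

variable {C : Type u} [Category.{v} C] [MonoidalCategory C] [BraidedCategory C]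

@[simp]
theorem ZEl.id_f (P : ZEl C) : ZEl.Hom.f (𝟙 P) = 𝟙 P.X := rfl

@[simp]
theorem ZEl.comp_f {P R V : ZEl C} (f : P ⟶ R) (g : R ⟶ V) :
    ZEl.Hom.f (f ≫ g) = ZEl.Hom.f f ≫ ZEl.Hom.f g := rfl

theorem ZEl.hom_ext {P R : ZEl C} {f g : P ⟶ R} (h : ZEl.Hom.f f = ZEl.Hom.f g) : f = g :=
  ZEl.Hom.ext h

end Center

section Coherence

variable {k : Type w} [Field k] [IsAlgClosed k]
  {C : Type u} [Category.{v} C] [Abelian C] [Linear k C] [MonoidalCategory C]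
  [MonoidalPreadditive C] [MonoidalLinear k C] [BraidedCategory C]
  [RightRigidCategory C] [RibbonCategory C] [IsFusion k C]
  {J : Type x} [Fintype J] {Xs : SimpleReps C J} {s : J → k}

variable {T : ∀ P R : ZEl C, ReducedTensor k Xs P.hb₁ R.hb₁}

namespace TensorObjects

variable (O : TensorObjects k Xs s T) (hs : ∀ j, s j ≠ 0) (hD : globalDim k Xs ≠ 0)

theorem tensorHom_id (P R : ZEl C) : O.tensorHom hs (𝟙 P) (𝟙 R) = 𝟙 _ := by
  apply ZEl.hom_ext
  simp only [tensorHom, ZEl.id_f, id_tensorHom_id, Category.id_comp, incl_proj]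

theorem tensorHom_comp (hD : globalDim k Xs ≠ 0) {P P' P'' R R' R'' : ZEl C} (f : P ⟶ P')
    (g : R ⟶ R') (f' : P' ⟶ P'') (g' : R' ⟶ R'') :
    O.tensorHom hs f g ≫ O.tensorHom hs f' g' = O.tensorHom hs (f ≫ f') (g ≫ g') := by
  apply ZEl.hom_ext
  rw [← cancel_mono (O.incl _ _), ZEl.comp_f, Category.assoc, O.tensorHom_incl hs hD,
    O.tensorHom_incl hs hD, O.tensorHom_incl_assoc hs hD, ZEl.comp_f, ZEl.comp_f,
    tensorHom_comp_tensorHom]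

theorem tensorHom_inclL (hD : globalDim k Xs ≠ 0) {P P' R R' V V' : ZEl C} (f : P ⟶ P')
    (g : R ⟶ R') (h : V ⟶ V') :
    (O.tensorHom hs (O.tensorHom hs f g) h).f ≫ O.inclL P' R' V' =
      O.inclL P R V ≫ ((f.f ⊗ₘ g.f) ⊗ₘ h.f) := by
  rw [inclL, inclL, O.tensorHom_incl_assoc hs hD, ← MonoidalCategory.tensorHom_id,
    tensorHom_comp_tensorHom, O.tensorHom_incl hs hD, Category.comp_id, Category.assoc,
    ← MonoidalCategory.tensorHom_id, tensorHom_comp_tensorHom, Category.id_comp]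

theorem tensorHom_inclR (hD : globalDim k Xs ≠ 0) {P P' R R' V V' : ZEl C} (f : P ⟶ P')
    (g : R ⟶ R') (h : V ⟶ V') :
    (O.tensorHom hs f (O.tensorHom hs g h)).f ≫ O.inclR P' R' V' =
      O.inclR P R V ≫ (f.f ⊗ₘ (g.f ⊗ₘ h.f)) := by
  rw [inclR, inclR, O.tensorHom_incl_assoc hs hD, ← MonoidalCategory.id_tensorHom,
    tensorHom_comp_tensorHom, O.tensorHom_incl hs hD, Category.comp_id, Category.assoc,
    ← MonoidalCategory.id_tensorHom, tensorHom_comp_tensorHom, Category.id_comp]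

theorem mono_inclR (P R V : ZEl C) : Mono (O.inclR P R V) :=
  (SplitMono.mk _ (O.inclR_projR P R V)).mono

theorem associator_naturality {P P' R R' V V' : ZEl C} (f : P ⟶ P')
    (g : R ⟶ R') (h : V ⟶ V') :
    O.tensorHom hs (O.tensorHom hs f g) h ≫ (O.associator P' R' V' hs hD).hom =
      (O.associator P R V hs hD).hom ≫ O.tensorHom hs f (O.tensorHom hs g h) := by
  apply ZEl.hom_ext
  have := O.mono_inclR P' R' V'
  rw [← cancel_mono (O.inclR P' R' V')]
  change ((O.tensorHom hs (O.tensorHom hs f g) h).f ≫ O.assocMap P' R' V') ≫ _ =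
    (O.assocMap P R V ≫ (O.tensorHom hs f (O.tensorHom hs g h)).f) ≫ _
  rw [Category.assoc, Category.assoc, O.assocMap_inclR _ _ _ hs hD, O.tensorHom_inclR hs hD,
    reassoc_of% O.tensorHom_inclL hs hD f g h, reassoc_of% O.assocMap_inclR P R V hs hD,
    MonoidalCategory.associator_naturality]

/-- After embedding into `P ⊗ (R ⊗ (V ⊗ W))` each associator becomes that of `C`, and the coherence
of `C` finishes the proof. -/
theorem pentagon (P R V W : ZEl C) :
    O.tensorHom hs (O.associator P R V hs hD).hom (𝟙 W) ≫
      (O.associator P (O.tensor R V) W hs hD).hom ≫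
        O.tensorHom hs (𝟙 P) (O.associator R V W hs hD).hom =
      (O.associator (O.tensor P R) V W hs hD).hom ≫
        (O.associator P R (O.tensor V W) hs hD).hom := by
  apply ZEl.hom_ext
  have := O.mono_inclR P R (O.tensor V W)
  -- The full inclusion of the fourfold product can be cancelled, since its last stage is split by
  -- the projection onto the product of `V` and `W`.
  have hm : ∀ {A : C} {a b : A ⟶ (O.tensor P (O.tensor R (O.tensor V W))).X},
      a ≫ O.inclR P R (O.tensor V W) ≫ P.X ◁ R.X ◁ O.incl V W =
        b ≫ O.inclR P R (O.tensor V W) ≫ P.X ◁ R.X ◁ O.incl V W → a = b := by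
    intro A a b h
    have h' := congrArg (· ≫ P.X ◁ R.X ◁ O.proj V W) h
    simp only [Category.assoc, ← MonoidalCategory.whiskerLeft_comp, incl_proj, whiskerLeft_id,
      Category.comp_id] at h'
    exact (cancel_mono _).1 h'
  apply hm
  have t1 : (O.tensorHom hs (O.associator P R V hs hD).hom (𝟙 W)).f ≫
      O.incl (O.tensor P (O.tensor R V)) W =
      O.incl (O.tensor (O.tensor P R) V) W ≫ O.assocMap P R V ▷ W.X := by
    rw [O.tensorHom_incl hs hD, ← MonoidalCategory.tensorHom_id]; rfl
  have t2 : (O.tensorHom hs (𝟙 P) (O.associator R V W hs hD).hom).f ≫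
      O.incl P (O.tensor R (O.tensor V W)) =
      O.incl P (O.tensor (O.tensor R V) W) ≫ P.X ◁ O.assocMap R V W := by
    rw [O.tensorHom_incl hs hD, ← MonoidalCategory.id_tensorHom]; rfl
  have e1 := O.assocMap_inclR P R V hs hD
  have e2 := O.assocMap_inclR P R (O.tensor V W) hs hD
  have e3 := O.assocMap_inclR (O.tensor P R) V W hs hD
  have e4 := O.assocMap_inclR P (O.tensor R V) W hs hD
  have e5 := O.assocMap_inclR R V W hs hD
  simp only [inclR] at e3 e4 e5
  change ((O.tensorHom hs (O.associator P R V hs hD).hom (𝟙 W)).f ≫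
    O.assocMap P (O.tensor R V) W ≫ (O.tensorHom hs (𝟙 P) (O.associator R V W hs hD).hom).f) ≫ _ =
    (O.assocMap (O.tensor P R) V W ≫ O.assocMap P R (O.tensor V W)) ≫ _
  generalize (O.tensorHom hs (O.associator P R V hs hD).hom (𝟙 W)).f = f₁ at t1 ⊢
  generalize (O.tensorHom hs (𝟙 P) (O.associator R V W hs hD).hom).f = f₂ at t2 ⊢
  calc
    _ = f₁ ≫ O.assocMap P (O.tensor R V) W ≫ (f₂ ≫ O.incl P (O.tensor R (O.tensor V W))) ≫
        P.X ◁ (O.incl R (O.tensor V W) ≫ R.X ◁ O.incl V W) := by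
      rw [inclR]; monoidal
    _ = f₁ ≫ O.assocMap P (O.tensor R V) W ≫ O.incl P (O.tensor (O.tensor R V) W) ≫
        P.X ◁ (O.assocMap R V W ≫ O.incl R (O.tensor V W) ≫ R.X ◁ O.incl V W) := by
      rw [t2]; monoidal
    _ = f₁ ≫ (O.assocMap P (O.tensor R V) W ≫ O.incl P (O.tensor (O.tensor R V) W) ≫
        P.X ◁ O.incl (O.tensor R V) W) ⊗≫ P.X ◁ O.incl R V ▷ W.X ⊗≫ 𝟙 _ := by
      rw [e5, inclL]; monoidal
    _ = (f₁ ≫ O.incl (O.tensor P (O.tensor R V)) W) ≫ (O.incl P (O.tensor R V) ≫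
        P.X ◁ O.incl R V) ▷ W.X ⊗≫ 𝟙 _ := by
      rw [e4, inclL]; monoidal
    _ = O.incl (O.tensor (O.tensor P R) V) W ≫ (O.assocMap P R V ≫ O.inclR P R V) ▷ W.X ⊗≫
        𝟙 _ := by
      rw [t1, inclR]; monoidal
    _ = (O.incl (O.tensor (O.tensor P R) V) W ≫ O.incl (O.tensor P R) V ▷ W.X) ⊗≫
        O.incl P R ▷ (V.X ⊗ W.X) ⊗≫ 𝟙 _ := by
      rw [e1, inclL]; monoidal
    _ = (O.assocMap (O.tensor P R) V W ≫ O.incl (O.tensor P R) (O.tensor V W)) ≫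
        ((O.tensor P R).X ◁ O.incl V W ≫ O.incl P R ▷ (V.X ⊗ W.X)) ⊗≫ 𝟙 _ := by
      rw [inclL] at e3
      calc
        _ = ((O.incl (O.tensor (O.tensor P R) V) W ≫ O.incl (O.tensor P R) V ▷ W.X) ≫ (α_ _ _ _).hom)
            ≫ O.incl P R ▷ (V.X ⊗ W.X) ⊗≫ 𝟙 _ := by monoidal
        _ = _ := by rw [← e3]; monoidal
    _ = (O.assocMap (O.tensor P R) V W ≫ O.inclL P R (O.tensor V W) ≫ (α_ _ _ _).hom) ≫
        P.X ◁ R.X ◁ O.incl V W := by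
      rw [whisker_exchange, inclL]; monoidal
    _ = _ := by rw [← e2]; monoidal

end TensorObjects

end Coherence

/-! ### The unit object: generation by the unit, and the unit maps. -/

section ActNaturality

variable {C : Type u} [Category.{v} C] [MonoidalCategory C] [BraidedCategory C]
  [RightRigidCategory C] [RibbonCategory C]

theorem act_naturality {S Z W W' : C} (e : Z ⊗ S ⟶ 𝟙_ C) {L R : HalfBraiding W}
    {L' R' : HalfBraiding W'} {f : W ⟶ W'} (hL : Intertwines L L' f) (hR : Intertwines R R' f) :
    (S ⊗ Z) ◁ f ≫ act e L' R' = act e L R ≫ f := by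
  simp only [act]
  calc
    _ = 𝟙 _ ⊗≫ S ◁ (Z ◁ f ≫ cross L' Z) ⊗≫ cross R' S ▷ Z ⊗≫ W' ◁ tilde e ⊗≫ 𝟙 _ := by monoidal
    _ = 𝟙 _ ⊗≫ S ◁ cross L Z ⊗≫ (S ◁ f ≫ cross R' S) ▷ Z ⊗≫ W' ◁ tilde e ⊗≫ 𝟙 _ := by
      rw [← hL Z]; monoidal
    _ = 𝟙 _ ⊗≫ S ◁ cross L Z ⊗≫ cross R S ▷ Z ⊗≫ (f ▷ (S ⊗ Z) ≫ W' ◁ tilde e) ⊗≫ 𝟙 _ := by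
      rw [← hR S]; monoidal
    _ = _ := by rw [← whisker_exchange]; monoidal

end ActNaturality

section Units

variable {k : Type w} [Field k] [IsAlgClosed k]
  {C : Type u} [Category.{v} C] [Abelian C] [Linear k C] [MonoidalCategory C]
  [MonoidalPreadditive C] [MonoidalLinear k C] [BraidedCategory C]
  [RightRigidCategory C] [RibbonCategory C] [IsFusion k C]
  {J : Type x} [Fintype J] (Xs : SimpleReps C J) {s : J → k}

theorem actU_naturality (hs : ∀ j, s j ≠ 0) {W W' : C} {L R : HalfBraiding W}
    {L' R' : HalfBraiding W'} {f : W ⟶ W'} (hL : Intertwines L L' f) (hR : Intertwines R R' f) :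
    unitObj Xs ◁ f ≫ actU Xs s L' R' = actU Xs s L R ≫ f := by
  refine unit_hom_ext (F := tensorRight W) (Xs := Xs) hs fun {S Z} e => ?_
  change inc Xs s e ▷ W ≫ _ = inc Xs s e ▷ W ≫ _
  rw [← whisker_exchange_assoc, inc_actU Xs hs, reassoc_of% inc_actU Xs hs L R e,
    act_naturality e hL hR]

variable (s) in
/-- The unit `𝟙 ⟶ ⨁_j X_j ⊗ X_j^*`. -/
def unitIn : 𝟙_ C ⟶ unitObj Xs := (λ_ (𝟙_ C)).inv ≫ inc Xs s (λ_ (𝟙_ C)).hom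

theorem unitIn_actU (hs : ∀ j, s j ≠ 0) {W : C} (L R : HalfBraiding W) :
    unitIn Xs s ▷ W ≫ actU Xs s L R = (λ_ W).hom := by
  rw [unitIn, comp_whiskerRight, Category.assoc, inc_actU Xs hs, act, tilde_unit, cross_unit,
    cross_unit]
  monoidal

/-- The coend is generated from `𝟙` by `Γ`: absorbing `S` into the unit yields the pair `S`, `Sᘁ`
and a new strand `S`, and pairing this strand with `Z` turns `Sᘁ` into `Z` through the mate of `e`.
-/
theorem inc_eq_gamma (hs : ∀ j, s j ≠ 0) {S Z : C} (e : Z ⊗ S ⟶ 𝟙_ C) :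
    (𝟙 _ ⊗≫ S ◁ unitIn Xs s ▷ Z ⊗≫ gamma Xs s S ▷ Z ⊗≫ unitObj Xs ◁ tilde e ⊗≫ 𝟙 _ :
      S ⊗ Z ⟶ unitObj Xs) = inc Xs s e := by
  let a := twistedDual S
  have h1 : inc Xs s (nest (ε_ S (Sᘁ)) (λ_ (𝟙_ C)).hom) =
      ((ρ_ S).hom ⊗ₘ (λ_ (Sᘁ)).hom) ≫ inc Xs s (ε_ S (Sᘁ)) := by
    apply inc_comp
    simp only [nest]
    monoidal
  have h2 : tilde e = S ◁ mate e ≫ evTilde S := by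
    rw [evTilde_eq, whiskerLeft_tilde, mate_ev]
  calc
    _ = 𝟙 _ ⊗≫ (S ◁ inc Xs s (λ_ (𝟙_ C)).hom ≫ gamma Xs s S) ▷ Z ⊗≫ unitObj Xs ◁ tilde e ⊗≫
        𝟙 _ := by rw [unitIn]; monoidal
    _ = 𝟙 _ ⊗≫ S ◁ coevTilde S ▷ Z ⊗≫ (inc Xs s (ε_ S (Sᘁ)) ▷ (S ⊗ Z) ≫
        unitObj Xs ◁ tilde e) ⊗≫ 𝟙 _ := by
      have hc : a.coev = coevTilde S := rfl
      have he : a.ev = ε_ S (Sᘁ) := rfl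
      rw [inc_gamma Xs hs a, gammaApp, hc, he, h1]
      monoidal
    _ = 𝟙 _ ⊗≫ S ◁ (coevTilde S ▷ Z ≫ (Sᘁ ⊗ S) ◁ mate e) ⊗≫ (S ⊗ Sᘁ) ◁ evTilde S ⊗≫
        inc Xs s (ε_ S (Sᘁ)) := by
      rw [← whisker_exchange, h2]; monoidal
    _ = 𝟙 _ ⊗≫ S ◁ (mate e ⊗≫ (coevTilde S ▷ Sᘁ ⊗≫ Sᘁ ◁ evTilde S) ⊗≫ 𝟙 (Sᘁ)) ⊗≫
        inc Xs s (ε_ S (Sᘁ)) := by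
      rw [← whisker_exchange]; monoidal
    _ = S ◁ mate e ≫ inc Xs s (ε_ S (Sᘁ)) := by
      rw [evTilde_coevTilde]; monoidal
    _ = _ := by rw [whiskerLeft_inc, mate_ev]

theorem unitIn_pos (Z : C) : Z ◁ unitIn Xs s ≫ cross (hbPos (unitObj Xs)) Z =
    𝟙 _ ⊗≫ unitIn Xs s ▷ Z := by
  have h := Intertwines.hbPos (unitIn Xs s) Z
  rw [← h, cross_hbPos, braiding_tensorUnit_right]
  monoidal

theorem unitIn_neg (Z : C) : Z ◁ unitIn Xs s ≫ cross (hbNeg (unitObj Xs)) Z =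
    𝟙 _ ⊗≫ unitIn Xs s ▷ Z := by
  have h := Intertwines.hbNeg (unitIn Xs s) Z
  rw [← h, cross_hbNeg, braiding_inv_tensorUnit_left]
  monoidal

/-- Maps out of `U ⊗ W` after which the crossings through `Γ` and `L` agree with those through
`n` and `R` are determined by their restriction to `W`. -/
theorem actU_unitIn (hs : ∀ j, s j ≠ 0) {V W : C} {L R : HalfBraiding W}
    {n : HalfBraiding (unitObj Xs)}
    (hn : ∀ Z : C, Z ◁ unitIn Xs s ≫ cross n Z = 𝟙 _ ⊗≫ unitIn Xs s ▷ Z)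
    (E : unitObj Xs ⊗ W ⟶ V)
    (h : ∀ A : C, (𝟙 _ ⊗≫ gamma Xs s A ▷ W ⊗≫ unitObj Xs ◁ cross L A ⊗≫ E ▷ A :
      A ⊗ (unitObj Xs ⊗ W) ⟶ V ⊗ A) = 𝟙 _ ⊗≫ cross n A ▷ W ⊗≫ unitObj Xs ◁ cross R A ⊗≫ E ▷ A) :
    actU Xs s L R ≫ (λ_ W).inv ≫ unitIn Xs s ▷ W ≫ E = E := by
  refine unit_hom_ext (F := tensorRight W) (Xs := Xs) hs fun {S Z} e => ?_
  change inc Xs s e ▷ W ≫ _ = inc Xs s e ▷ W ≫ _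
  rw [reassoc_of% inc_actU Xs hs L R e, ← inc_eq_gamma Xs hs e, act]
  calc
    _ = 𝟙 _ ⊗≫ S ◁ cross L Z ⊗≫ cross R S ▷ Z ⊗≫ (W ◁ tilde e ≫
        ((λ_ W).inv ≫ unitIn Xs s ▷ W ≫ E) ▷ 𝟙_ C) ⊗≫ 𝟙 _ := by monoidal
    _ = 𝟙 _ ⊗≫ S ◁ cross L Z ⊗≫ ((𝟙_ C) ◁ cross R S ≫ unitIn Xs s ▷ (W ⊗ S)) ▷ Z ⊗≫
        E ▷ S ▷ Z ⊗≫ V ◁ tilde e ⊗≫ 𝟙 _ := by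
      rw [whisker_exchange]; monoidal
    _ = 𝟙 _ ⊗≫ S ◁ cross L Z ⊗≫ (𝟙 (S ⊗ 𝟙_ C) ⊗≫ unitIn Xs s ▷ S) ▷ W ▷ Z ⊗≫
        unitObj Xs ◁ cross R S ▷ Z ⊗≫ E ▷ S ▷ Z ⊗≫ V ◁ tilde e ⊗≫ 𝟙 _ := by
      rw [whisker_exchange]; monoidal
    _ = 𝟙 _ ⊗≫ S ◁ cross L Z ⊗≫ S ◁ unitIn Xs s ▷ W ▷ Z ⊗≫
        (𝟙 (S ⊗ (unitObj Xs ⊗ W)) ⊗≫ cross n S ▷ W ⊗≫ unitObj Xs ◁ cross R S ⊗≫ E ▷ S) ▷ Z ⊗≫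
        V ◁ tilde e ⊗≫ 𝟙 _ := by
      rw [← hn]; monoidal
    -- The hypothesis on `E` trades the crossings by `n` and `R` for `Γ` and `L`. Now `Z` and `S`
    -- both cross `W` by `L`, so their pairing can be pulled off `W`.
    _ = 𝟙 _ ⊗≫ S ◁ ((𝟙_ C) ◁ cross L Z ≫ unitIn Xs s ▷ (W ⊗ Z)) ⊗≫ gamma Xs s S ▷ W ▷ Z ⊗≫
        unitObj Xs ◁ cross L S ▷ Z ⊗≫ (E ▷ (S ⊗ Z) ≫ V ◁ tilde e) ⊗≫ 𝟙 _ := by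
      rw [← h]; monoidal
    _ = 𝟙 _ ⊗≫ S ◁ unitIn Xs s ▷ (Z ⊗ W) ⊗≫ ((S ⊗ unitObj Xs) ◁ cross L Z ≫
        gamma Xs s S ▷ (W ⊗ Z)) ⊗≫
        unitObj Xs ◁ cross L S ▷ Z ⊗≫ (unitObj Xs ⊗ W) ◁ tilde e ⊗≫ E := by
      rw [whisker_exchange (unitIn Xs s) (cross L Z), ← whisker_exchange E (tilde e)]; monoidal
    _ = 𝟙 _ ⊗≫ S ◁ unitIn Xs s ▷ (Z ⊗ W) ⊗≫ gamma Xs s S ▷ (Z ⊗ W) ⊗≫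
        unitObj Xs ◁ ((𝟙 ((S ⊗ Z) ⊗ W) ⊗≫ S ◁ cross L Z ⊗≫ cross L S ▷ Z ⊗≫ 𝟙 (W ⊗ (S ⊗ Z))) ≫
          W ◁ tilde e ⊗≫ 𝟙 ((𝟙_ C) ⊗ W)) ⊗≫ E := by
      rw [whisker_exchange]; monoidal
    _ = _ := by rw [← cross_tensor, ← cross_pairing]; monoidal

section Left

theorem leftUnitMap_eq {Y : C} (m : HalfBraiding Y) :
    leftUnitMap k Xs s m = actU Xs s (hbPos Y) m := by
  simp only [leftUnitMap, actU, Dinatural.desc, actDin, act]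
  rfl

variable {Y : C} {m : HalfBraiding Y}

/-- The left unit map is the action with `L` the braiding and `R = m`. Its three intertwining
properties are `gamma_actU`, `actU_exchange` and, with COMM, `actU_exchange_omega`. -/
theorem leftUnitMap_left (hs : ∀ j, s j ≠ 0) {Γ : HalfBraiding (unitObj Xs)}
    (hΓ : ∀ A, cross Γ A = gamma Xs s A) :
    Intertwines (hbLeft Γ Y) m (leftUnitMap k Xs s m) := by
  intro A
  rw [leftUnitMap_eq, ← gamma_actU Xs hs, cross_hbTensor, hΓ]
  monoidal

theorem leftUnitMap_right (hs : ∀ j, s j ≠ 0) :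
    Intertwines (hbRight (unitObj Xs) m) m (leftUnitMap k Xs s m) := by
  intro A
  rw [leftUnitMap_eq, cross_hbTensor]
  have h := actU_exchange Xs hs (exchAt_hbPos_left m A) (exchAt_hbPos_self m A)
  simp only [cross_hbPos] at h
  simp only [cross_hbNeg]
  calc
    _ = 𝟙 _ ⊗≫ (β_ (unitObj Xs) A).inv ▷ Y ⊗≫ (unitObj Xs ◁ cross m A ⊗≫
        actU Xs s (hbPos Y) m ▷ A) := by monoidal
    _ = 𝟙 _ ⊗≫ ((β_ (unitObj Xs) A).inv ≫ (β_ (unitObj Xs) A).hom) ▷ Y ⊗≫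
        A ◁ actU Xs s (hbPos Y) m ≫ cross m A := by rw [h]; monoidal
    _ = _ := by rw [Iso.inv_hom_id]; monoidal

theorem leftUnitMap_tensor (hs : ∀ j, s j ≠ 0) {Ω : HalfBraiding (unitObj Xs)}
    (hΩ : ∀ A, cross Ω A = omega Xs A) {m₂ : HalfBraiding Y} (hm : COMM m m₂) :
    Intertwines (hbTensor Ω m₂) m₂ (leftUnitMap k Xs s m) := by
  intro A
  rw [leftUnitMap_eq, ← actU_exchange_omega Xs hs (exchAt_hbPos_left m₂ A) ((comm_iff m m₂).1 hm A),
    cross_hbTensor, hΩ]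
  monoidal

theorem leftUnitMap_unitIn (hs : ∀ j, s j ≠ 0) {Y V : C} {m : HalfBraiding Y}
    {Γ : HalfBraiding (unitObj Xs)} (hΓ : ∀ A, cross Γ A = gamma Xs s A) (E : unitObj Xs ⊗ Y ⟶ V)
    (h : ∀ A : C, cross (hbLeft Γ Y) A ≫ E ▷ A = cross (hbRight (unitObj Xs) m) A ≫ E ▷ A) :
    leftUnitMap k Xs s m ≫ (λ_ Y).inv ≫ unitIn Xs s ▷ Y ≫ E = E := by
  rw [leftUnitMap_eq]
  refine actU_unitIn Xs hs (unitIn_neg Xs) E fun A => ?_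
  have h := h A
  rw [cross_hbTensor, cross_hbTensor, hΓ] at h
  calc
    _ = (𝟙 _ ⊗≫ gamma Xs s A ▷ Y ⊗≫ unitObj Xs ◁ cross (hbPos Y) A ⊗≫ 𝟙 _) ≫ E ▷ A := by monoidal
    _ = _ := by rw [h]; monoidal

theorem leftUnitMap_naturality (hs : ∀ j, s j ≠ 0) {Y' : C} {m' : HalfBraiding Y'} {f : Y ⟶ Y'}
    (hf : Intertwines m m' f) :
    unitObj Xs ◁ f ≫ leftUnitMap k Xs s m' = leftUnitMap k Xs s m ≫ f := by
  rw [leftUnitMap_eq, leftUnitMap_eq]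
  exact actU_naturality Xs hs (.hbPos f) hf

end Left

section Right

variable {Y : C} {l : HalfBraiding Y}

theorem unitι_actU (hs : ∀ j, s j ≠ 0) {W : C} (L R : HalfBraiding W) (j : J) :
    unitι Xs j ▷ W ≫ actU Xs s L R = s j • act (ε_ (Xs.obj j) ((Xs.obj j)ᘁ)) L R := by
  have h : unitι Xs j = s j • inc Xs s (ε_ (Xs.obj j) ((Xs.obj j)ᘁ)) := by
    rw [inc_ev, smul_smul, mul_inv_cancel₀ (hs j), one_smul]
  rw [h, MonoidalLinear.smul_whiskerRight, Linear.smul_comp, inc_actU Xs hs]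

theorem rightUnitMap_eq_omega (hs : ∀ j, s j ≠ 0) :
    rightUnitMap k Xs s l = omega Xs Y ≫ actU Xs s (hbPos Y) l := by
  rw [rightUnitMap, omega, Preadditive.sum_comp]
  refine Finset.sum_congr rfl fun j _ => ?_
  rw [Category.assoc, Category.assoc, unitι_actU Xs hs, Linear.comp_smul, Linear.comp_smul]
  congr 2
  simp only [act, cross_hbPos, evTilde_eq]
  symm
  calc
    _ = 𝟙 _ ⊗≫ (β_ Y (Xs.obj j)).hom ▷ (Xs.obj j)ᘁ ⊗≫
        Xs.obj j ◁ ((β_ ((Xs.obj j)ᘁ) Y).inv ≫ (β_ ((Xs.obj j)ᘁ) Y).hom) ⊗≫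
        cross l (Xs.obj j) ▷ (Xs.obj j)ᘁ ⊗≫ Y ◁ tilde (ε_ (Xs.obj j) ((Xs.obj j)ᘁ)) ⊗≫
        𝟙 _ := by monoidal
    _ = _ := by rw [Iso.inv_hom_id]; monoidal

/-- A second factorisation, in which the crossing of `Y` with `Z` cancels with the opposite sense.
The form through `Ω` combines with COMM for `Γ` and `Ω`; this one combines with naturality of the
braiding. -/
theorem rightUnitMap_eq_braiding (hs : ∀ j, s j ≠ 0) :
    rightUnitMap k Xs s l = (β_ Y (unitObj Xs)).hom ≫ actU Xs s (hbNeg Y) l := by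
  rw [rightUnitMap_eq_omega Xs hs]
  refine unit_hom_ext (F := tensorLeft Y) (Xs := Xs) hs fun {S Z} e => ?_
  change Y ◁ inc Xs s e ≫ _ = Y ◁ inc Xs s e ≫ _
  rw [reassoc_of% inc_omega Xs hs Y e, BraidedCategory.braiding_naturality_right_assoc,
    inc_actU Xs hs, inc_actU Xs hs, cross_hbTensor]
  simp only [act, cross_hbPos, cross_hbNeg, BraidedCategory.braiding_tensor_right_hom]
  calc
    _ = 𝟙 _ ⊗≫ (β_ Y S).hom ▷ Z ⊗≫ S ◁ ((β_ Z Y).inv ≫ (β_ Z Y).hom) ⊗≫ cross l S ▷ Z ⊗≫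
        Y ◁ tilde e ⊗≫ 𝟙 _ := by monoidal
    _ = 𝟙 _ ⊗≫ (β_ Y S).hom ▷ Z ⊗≫ S ◁ ((β_ Y Z).hom ≫ (β_ Y Z).inv) ⊗≫ cross l S ▷ Z ⊗≫
        Y ◁ tilde e ⊗≫ 𝟙 _ := by rw [Iso.inv_hom_id, Iso.hom_inv_id]
    _ = _ := by monoidal

/-- COMM for `Γ` and `Ω`, at `A` and `Y`, moves `Γ_A` past `Ω_Y`; then `gamma_actU` applies. -/
theorem rightUnitMap_right (hs : ∀ j, s j ≠ 0) {Γ : HalfBraiding (unitObj Xs)}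
    (hΓ : ∀ A, cross Γ A = gamma Xs s A) :
    Intertwines (hbRight Y Γ) l (rightUnitMap k Xs s l) := by
  intro A
  have h := comm_gamma_omega Xs hs A Y
  simp only [cross_gammaHB, cross_omegaHB] at h
  rw [rightUnitMap_eq_omega Xs hs, cross_hbTensor, hΓ, cross_hbNeg]
  calc
    _ = (𝟙 (A ⊗ (Y ⊗ unitObj Xs)) ⊗≫ (β_ Y A).inv ▷ unitObj Xs ⊗≫ Y ◁ gamma Xs s A ⊗≫
        omega Xs Y ▷ A ⊗≫ 𝟙 (unitObj Xs ⊗ (Y ⊗ A))) ⊗≫ actU Xs s (hbPos Y) l ▷ A := by monoidal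
    _ = A ◁ omega Xs Y ≫ (𝟙 _ ⊗≫ gamma Xs s A ▷ Y ⊗≫ unitObj Xs ◁ cross (hbPos Y) A ⊗≫
        actU Xs s (hbPos Y) l ▷ A) := by rw [← h, cross_hbPos]; monoidal
    _ = _ := by rw [gamma_actU Xs hs]; monoidal

theorem rightUnitMap_left (hs : ∀ j, s j ≠ 0) :
    Intertwines (hbLeft l (unitObj Xs)) l (rightUnitMap k Xs s l) := by
  intro A
  have h := actU_exchange Xs hs (exchAt_hbNeg_left l A) (exchAt_hbNeg_self l A)
  simp only [cross_hbNeg] at h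
  have h1 : cross l A ▷ unitObj Xs ≫ (β_ (Y ⊗ A) (unitObj Xs)).hom =
      (β_ (A ⊗ Y) (unitObj Xs)).hom ≫ unitObj Xs ◁ cross l A :=
    BraidedCategory.braiding_naturality_left _ _
  simp only [BraidedCategory.braiding_tensor_left_hom] at h1
  rw [rightUnitMap_eq_braiding Xs hs, cross_hbTensor, cross_hbPos]
  calc
    _ = 𝟙 _ ⊗≫ (cross l A ▷ unitObj Xs ≫ (α_ Y A (unitObj Xs)).hom ≫ Y ◁ (β_ A (unitObj Xs)).hom ≫
        (α_ Y (unitObj Xs) A).inv ≫ (β_ Y (unitObj Xs)).hom ▷ A ≫ (α_ (unitObj Xs) Y A).hom) ⊗≫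
        actU Xs s (hbNeg Y) l ▷ A := by monoidal
    _ = 𝟙 _ ⊗≫ A ◁ (β_ Y (unitObj Xs)).hom ⊗≫ (β_ A (unitObj Xs)).hom ▷ Y ⊗≫
        (unitObj Xs ◁ cross l A ⊗≫ actU Xs s (hbNeg Y) l ▷ A) := by rw [h1]; monoidal
    _ = 𝟙 _ ⊗≫ A ◁ (β_ Y (unitObj Xs)).hom ⊗≫ ((β_ A (unitObj Xs)).hom ≫
        (β_ A (unitObj Xs)).inv) ▷ Y ⊗≫ A ◁ actU Xs s (hbNeg Y) l ≫ cross l A := by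
      rw [h]; monoidal
    _ = _ := by rw [Iso.hom_inv_id]; monoidal

theorem rightUnitMap_tensor (hs : ∀ j, s j ≠ 0) {Ω : HalfBraiding (unitObj Xs)}
    (hΩ : ∀ A, cross Ω A = omega Xs A) {l₂ : HalfBraiding Y} (hl : COMM l l₂) :
    Intertwines (hbTensor l₂ Ω) l₂ (rightUnitMap k Xs s l) := by
  intro A
  have h := leftUnitMap_tensor Xs hs hΩ hl A
  rw [leftUnitMap_eq, cross_hbTensor, hΩ] at h
  rw [rightUnitMap_eq_omega Xs hs, cross_hbTensor, hΩ]
  calc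
    _ = 𝟙 _ ⊗≫ cross l₂ A ▷ unitObj Xs ⊗≫ (𝟙 ((Y ⊗ A) ⊗ unitObj Xs) ⊗≫ Y ◁ omega Xs A ⊗≫
        omega Xs Y ▷ A ⊗≫ 𝟙 (unitObj Xs ⊗ (Y ⊗ A))) ⊗≫ actU Xs s (hbPos Y) l ▷ A := by monoidal
    _ = 𝟙 _ ⊗≫ (cross l₂ A ▷ unitObj Xs ≫ omega Xs (Y ⊗ A)) ⊗≫
        actU Xs s (hbPos Y) l ▷ A := by rw [← omega_tensor Xs hs]; monoidal
    _ = A ◁ omega Xs Y ≫ (𝟙 (A ⊗ (unitObj Xs ⊗ Y)) ⊗≫ omega Xs A ▷ Y ⊗≫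
        unitObj Xs ◁ cross l₂ A ⊗≫ 𝟙 ((unitObj Xs ⊗ Y) ⊗ A)) ≫ actU Xs s (hbPos Y) l ▷ A := by
      rw [omega_naturality Xs hs, omega_tensor Xs hs]; monoidal
    _ = _ := by rw [h]; monoidal

theorem rightUnitMap_naturality (hs : ∀ j, s j ≠ 0) {Y' : C} {l' : HalfBraiding Y'} {f : Y ⟶ Y'}
    (hf : Intertwines l l' f) :
    f ▷ unitObj Xs ≫ rightUnitMap k Xs s l' = rightUnitMap k Xs s l ≫ f := by
  rw [rightUnitMap_eq_omega Xs hs, rightUnitMap_eq_omega Xs hs, ← Category.assoc,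
    omega_naturality Xs hs, Category.assoc, actU_naturality Xs hs (.hbPos f) hf, Category.assoc]

theorem unitIn_rightUnitMap (hs : ∀ j, s j ≠ 0) :
    Y ◁ unitIn Xs s ≫ rightUnitMap k Xs s l = (ρ_ Y).hom := by
  rw [rightUnitMap_eq_braiding Xs hs, BraidedCategory.braiding_naturality_right_assoc,
    unitIn_actU Xs hs, braiding_tensorUnit_right]
  simp

/-- The braiding moves the coend to the left of `Y`, which reduces the claim to `actU_unitIn` with
`L = hbNeg Y` and `R = l`. -/
theorem rightUnitMap_unitIn (hs : ∀ j, s j ≠ 0) {V : C} {Γ : HalfBraiding (unitObj Xs)}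
    (hΓ : ∀ A, cross Γ A = gamma Xs s A) (E : Y ⊗ unitObj Xs ⟶ V)
    (h : ∀ A : C, cross (hbLeft l (unitObj Xs)) A ≫ E ▷ A = cross (hbRight Y Γ) A ≫ E ▷ A) :
    rightUnitMap k Xs s l ≫ (ρ_ Y).inv ≫ Y ◁ unitIn Xs s ≫ E = E := by
  have h1 := actU_unitIn Xs hs (L := hbNeg Y) (R := l) (n := hbPos (unitObj Xs))
    (unitIn_pos Xs) ((β_ Y (unitObj Xs)).inv ≫ E) (fun A => ?_)
  · rw [rightUnitMap_eq_braiding Xs hs, Category.assoc, ← cancel_epi (β_ Y (unitObj Xs)).inv,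
      Iso.inv_hom_id_assoc]
    rw [BraidedCategory.braiding_inv_naturality_left_assoc] at h1
    simpa using h1
  · have h2 := h A
    rw [cross_hbTensor, cross_hbTensor, hΓ, cross_hbNeg, cross_hbPos] at h2
    rw [cross_hbNeg, cross_hbPos]
    have h3 : gamma Xs s A ▷ Y ≫ (β_ Y (unitObj Xs ⊗ A)).inv =
        (β_ Y (A ⊗ unitObj Xs)).inv ≫ Y ◁ gamma Xs s A :=
      BraidedCategory.braiding_inv_naturality_left _ _
    simp only [BraidedCategory.braiding_tensor_right_inv] at h3
    have h4 : cross l A ▷ unitObj Xs ≫ (β_ (Y ⊗ A) (unitObj Xs)).hom =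
        (β_ (A ⊗ Y) (unitObj Xs)).hom ≫ unitObj Xs ◁ cross l A :=
      BraidedCategory.braiding_naturality_left _ _
    simp only [BraidedCategory.braiding_tensor_left_hom] at h4
    calc
      _ = 𝟙 _ ⊗≫ (gamma Xs s A ▷ Y ≫ (α_ _ _ _).hom ≫ unitObj Xs ◁ (β_ Y A).inv ≫ (α_ _ _ _).inv ≫
          (β_ Y (unitObj Xs)).inv ▷ A ≫ (α_ _ _ _).hom) ⊗≫ E ▷ A := by monoidal
      _ = A ◁ (β_ Y (unitObj Xs)).inv ≫ ((𝟙 (A ⊗ (Y ⊗ unitObj Xs)) ⊗≫ (β_ Y A).inv ▷ unitObj Xs ⊗≫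
          Y ◁ gamma Xs s A ⊗≫ 𝟙 ((Y ⊗ unitObj Xs) ⊗ A)) ≫ E ▷ A) := by
        rw [h3]; monoidal
      _ = 𝟙 _ ⊗≫ A ◁ (β_ Y (unitObj Xs)).inv ⊗≫ cross l A ▷ unitObj Xs ⊗≫
          Y ◁ (β_ A (unitObj Xs)).hom ⊗≫ 𝟙 _ ≫ E ▷ A := by
        rw [← h2]; monoidal
      _ = 𝟙 _ ⊗≫ A ◁ (β_ Y (unitObj Xs)).inv ⊗≫ cross l A ▷ unitObj Xs ⊗≫
          Y ◁ (β_ A (unitObj Xs)).hom ⊗≫ ((β_ Y (unitObj Xs)).hom ≫ (β_ Y (unitObj Xs)).inv) ▷ A ≫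
          E ▷ A := by
        rw [Iso.hom_inv_id]; monoidal
      _ = 𝟙 _ ⊗≫ A ◁ (β_ Y (unitObj Xs)).inv ⊗≫ (cross l A ▷ unitObj Xs ≫ (α_ _ _ _).hom ≫
          Y ◁ (β_ A (unitObj Xs)).hom ≫ (α_ _ _ _).inv ≫ (β_ Y (unitObj Xs)).hom ▷ A ≫
          (α_ _ _ _).hom) ⊗≫ ((β_ Y (unitObj Xs)).inv ≫ E) ▷ A := by monoidal
      _ = 𝟙 _ ⊗≫ A ◁ ((β_ Y (unitObj Xs)).inv ≫ (β_ Y (unitObj Xs)).hom) ⊗≫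
          (β_ A (unitObj Xs)).hom ▷ Y ⊗≫ unitObj Xs ◁ cross l A ⊗≫
          ((β_ Y (unitObj Xs)).inv ≫ E) ▷ A := by rw [h4]; monoidal
      _ = _ := by rw [Iso.inv_hom_id]; monoidal

end Right

/-- The compatibility underlying the triangle identity. -/
theorem rightUnitMap_leftUnitMap (hs : ∀ j, s j ≠ 0) {X Y V : C} {l : HalfBraiding X}
    {m : HalfBraiding Y} (E : X ⊗ Y ⟶ V)
    (h : ∀ A : C, cross (hbLeft l Y) A ≫ E ▷ A = cross (hbRight X m) A ≫ E ▷ A) :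
    rightUnitMap k Xs s l ▷ Y ≫ E =
      (α_ X (unitObj Xs) Y).hom ≫ X ◁ leftUnitMap k Xs s m ≫ E := by
  rw [rightUnitMap_eq_omega Xs hs, leftUnitMap_eq]
  refine unit_hom_ext (F := tensorLeft X ⋙ tensorRight Y) (Xs := Xs) hs fun {S Z} e => ?_
  change (X ◁ inc Xs s e) ▷ Y ≫ _ = (X ◁ inc Xs s e) ▷ Y ≫ _
  have h2 := h S
  rw [cross_hbTensor, cross_hbTensor, cross_hbNeg, cross_hbPos] at h2
  calc
    _ = (X ◁ inc Xs s e ≫ omega Xs X) ▷ Y ≫ actU Xs s (hbPos X) l ▷ Y ≫ E := by monoidal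
    _ = cross (hbTensor (hbPos S) (hbNeg Z)) X ▷ Y ≫
        (inc Xs s e ▷ X ≫ actU Xs s (hbPos X) l) ▷ Y ≫ E := by rw [inc_omega Xs hs]; monoidal
    _ = 𝟙 _ ⊗≫ (β_ X S).hom ▷ (Z ⊗ Y) ⊗≫ S ◁ ((β_ Z X).inv ≫ (β_ Z X).hom) ▷ Y ⊗≫
        cross l S ▷ (Z ⊗ Y) ⊗≫ X ◁ (tilde e ▷ Y) ⊗≫ E := by
      rw [inc_actU Xs hs, cross_hbTensor, act]
      simp only [cross_hbPos, cross_hbNeg]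
      monoidal
    -- The paired strands between `X` and `Y` are pulled to the right of `Y`, so that `S` crosses
    -- all of `X ⊗ Y` by `hbLeft`; the hypothesis on `E` then replaces this by `hbRight`.
    _ = 𝟙 _ ⊗≫ (β_ X S).hom ▷ (Z ⊗ Y) ⊗≫ (cross l S ▷ (Z ⊗ Y) ≫ (X ⊗ S) ◁ (β_ Z Y).hom) ⊗≫
        X ◁ (β_ S Y).hom ▷ Z ⊗≫ ((X ⊗ Y) ◁ tilde e ≫ E ▷ 𝟙_ C) ⊗≫ 𝟙 _ := by
      rw [Iso.inv_hom_id, cross_pairing (hbPos Y) (tilde e), cross_tensor]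
      simp only [cross_hbPos]
      monoidal
    _ = 𝟙 _ ⊗≫ (β_ X S).hom ▷ (Z ⊗ Y) ⊗≫ (S ⊗ X) ◁ (β_ Z Y).hom ⊗≫
        ((𝟙 (S ⊗ (X ⊗ Y)) ⊗≫ cross l S ▷ Y ⊗≫ X ◁ (β_ S Y).hom ⊗≫ 𝟙 ((X ⊗ Y) ⊗ S)) ≫ E ▷ S) ▷ Z ⊗≫
        V ◁ tilde e ⊗≫ 𝟙 _ := by
      rw [whisker_exchange E, ← whisker_exchange (cross l S)]; monoidal
    _ = 𝟙 _ ⊗≫ (β_ X S).hom ▷ (Z ⊗ Y) ⊗≫ ((S ⊗ X) ◁ (β_ Z Y).hom ≫ (β_ X S).inv ▷ (Y ⊗ Z)) ⊗≫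
        X ◁ cross m S ▷ Z ⊗≫ (E ▷ (S ⊗ Z) ≫ V ◁ tilde e) ⊗≫ 𝟙 _ := by
      rw [h2]; monoidal
    _ = 𝟙 _ ⊗≫ ((β_ X S).hom ≫ (β_ X S).inv) ▷ (Z ⊗ Y) ⊗≫ (X ⊗ S) ◁ (β_ Z Y).hom ⊗≫
        X ◁ cross m S ▷ Z ⊗≫ (X ⊗ Y) ◁ tilde e ⊗≫ E := by
      rw [whisker_exchange (β_ X S).inv, ← whisker_exchange E]; monoidal
    _ = 𝟙 _ ⊗≫ X ◁ act e (hbPos Y) m ≫ E := by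
      rw [Iso.hom_inv_id, act, cross_hbPos]; monoidal
    _ = _ := by rw [← inc_actU Xs hs]; monoidal

end Units

/-! ### Unit constraints, the triangle, and assembly of the structure. -/

section UnitConstraints

variable {k : Type w} [Field k] [IsAlgClosed k]
  {C : Type u} [Category.{v} C] [Abelian C] [Linear k C] [MonoidalCategory C]
  [MonoidalPreadditive C] [MonoidalLinear k C] [BraidedCategory C]
  [RightRigidCategory C] [RibbonCategory C] [IsFusion k C]
  {J : Type x} [Fintype J] {Xs : SimpleReps C J} {s : J → k}

theorem Intertwines.smul {X Y : C} {l : HalfBraiding X} {m : HalfBraiding Y} {f : X ⟶ Y}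
    (h : Intertwines l m f) (c : k) : Intertwines l m (c • f) := by
  intro A
  rw [MonoidalLinear.smul_whiskerRight, MonoidalLinear.whiskerLeft_smul, Linear.comp_smul,
    Linear.smul_comp, h A]

variable {T : ∀ P R : ZEl C, ReducedTensor k Xs P.hb₁ R.hb₁}

namespace TensorObjects

variable (O : TensorObjects k Xs s T)

theorem proj_agree (hs : ∀ j, s j ≠ 0) (P R : ZEl C) (A : C) :
    cross (hbLeft P.hb₁ R.X) A ≫ O.proj P R ▷ A = cross (hbRight P.X R.hb₁) A ≫ O.proj P R ▷ A :=
  (O.proj_left P R hs A).trans (O.proj_right P R hs A).symm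

theorem proj_incl_comp (hD : globalDim k Xs ≠ 0) {P R : ZEl C} {V : C} {n : HalfBraiding V}
    {g : P.X ⊗ R.X ⟶ V} (hl : Intertwines (hbLeft P.hb₁ R.X) n g)
    (hr : Intertwines (hbRight P.X R.hb₁) n g) : O.proj P R ≫ O.incl P R ≫ g = g := by
  rw [← Category.assoc, proj_incl, Q_eq_average]
  exact average_comp k Xs hD _ _ g fun A => (hl A).trans (hr A).symm

/-- The map underlying the left unit constraint. -/
def leftMap (P : ZEl C) : O.unit.X ⊗ P.X ⟶ P.X := leftUnitMap k Xs s P.hb₁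

/-- The map underlying the right unit constraint. -/
def rightMap (P : ZEl C) : P.X ⊗ O.unit.X ⟶ P.X := rightUnitMap k Xs s P.hb₁

/-- The map `𝟙 ⟶ ⨁_j X_j ⊗ X_j^*` with target the unit object. -/
def unitMap : 𝟙_ C ⟶ O.unit.X := unitIn Xs s

section Unitors

variable (P : ZEl C)

theorem leftMap_left (hΓ : ∀ A, cross O.unit₁ A = gamma Xs s A) (hs : ∀ j, s j ≠ 0) :
    Intertwines (hbLeft O.unit.hb₁ P.X) P.hb₁ (O.leftMap P) :=
  leftUnitMap_left Xs hs hΓ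

theorem leftMap_right (hs : ∀ j, s j ≠ 0) :
    Intertwines (hbRight O.unit.X P.hb₁) P.hb₁ (O.leftMap P) :=
  leftUnitMap_right Xs hs

theorem leftMap_tensor (hs : ∀ j, s j ≠ 0) :
    Intertwines (hbTensor O.unit.hb₂ P.hb₂) P.hb₂ (O.leftMap P) :=
  leftUnitMap_tensor Xs hs O.unit₂_eq P.comm

theorem rightMap_left (hs : ∀ j, s j ≠ 0) :
    Intertwines (hbLeft P.hb₁ O.unit.X) P.hb₁ (O.rightMap P) :=
  rightUnitMap_left Xs hs

theorem rightMap_right (hΓ : ∀ A, cross O.unit₁ A = gamma Xs s A) (hs : ∀ j, s j ≠ 0) :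
    Intertwines (hbRight P.X O.unit.hb₁) P.hb₁ (O.rightMap P) :=
  rightUnitMap_right Xs hs hΓ

theorem rightMap_tensor (hs : ∀ j, s j ≠ 0) :
    Intertwines (hbTensor P.hb₂ O.unit.hb₂) P.hb₂ (O.rightMap P) :=
  rightUnitMap_tensor Xs hs O.unit₂_eq P.comm

theorem unitMap_leftMap (hs : ∀ j, s j ≠ 0) : O.unitMap ▷ P.X ≫ O.leftMap P = (λ_ P.X).hom := by
  have h := unitIn_actU (s := s) Xs hs (hbPos P.X) P.hb₁
  rwa [← leftUnitMap_eq] at h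

theorem unitMap_rightMap (hs : ∀ j, s j ≠ 0) : P.X ◁ O.unitMap ≫ O.rightMap P = (ρ_ P.X).hom :=
  unitIn_rightUnitMap Xs hs

theorem leftMap_unitMap (hΓ : ∀ A, cross O.unit₁ A = gamma Xs s A) (hs : ∀ j, s j ≠ 0) :
    O.leftMap P ≫ (λ_ P.X).inv ≫ O.unitMap ▷ P.X ≫ O.proj O.unit P = O.proj O.unit P :=
  leftUnitMap_unitIn Xs hs hΓ _ (O.proj_agree hs O.unit P)

theorem rightMap_unitMap (hΓ : ∀ A, cross O.unit₁ A = gamma Xs s A) (hs : ∀ j, s j ≠ 0) :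
    O.rightMap P ≫ (ρ_ P.X).inv ≫ P.X ◁ O.unitMap ≫ O.proj P O.unit = O.proj P O.unit :=
  rightUnitMap_unitIn Xs hs hΓ _ (O.proj_agree hs P O.unit)

/-- The left unit constraint. -/
def leftUnitor (hΓ : ∀ A, cross O.unit₁ A = gamma Xs s A) (hs : ∀ j, s j ≠ 0)
    (hD : globalDim k Xs ≠ 0) {κ : k} (hκ : κ ≠ 0) : O.tensor O.unit P ≅ P :=
  ZEl.mkIso (O.incl O.unit P ≫ (κ • O.leftMap P))
    (κ⁻¹ • ((λ_ P.X).inv ≫ O.unitMap ▷ P.X ≫ O.proj O.unit P))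
    (by
      rw [Linear.comp_smul, Linear.comp_smul, Linear.smul_comp, smul_smul, inv_mul_cancel₀ hκ,
        one_smul, Category.assoc, O.leftMap_unitMap P hΓ hs, incl_proj])
    (by
      rw [Linear.smul_comp, Linear.comp_smul, Linear.comp_smul, smul_smul, inv_mul_cancel₀ hκ,
        one_smul, Category.assoc, Category.assoc,
        O.proj_incl_comp hD (O.leftMap_left P hΓ hs) (O.leftMap_right P hs),
        O.unitMap_leftMap P hs, Iso.inv_hom_id])
    ((O.incl_left O.unit P hs).comp ((O.leftMap_left P hΓ hs).smul κ))
    ((O.incl_tensor O.unit P hs).comp ((O.leftMap_tensor P hs).smul κ))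

/-- The right unit constraint. -/
def rightUnitor (hΓ : ∀ A, cross O.unit₁ A = gamma Xs s A) (hs : ∀ j, s j ≠ 0)
    (hD : globalDim k Xs ≠ 0) {κ : k} (hκ : κ ≠ 0) : O.tensor P O.unit ≅ P :=
  ZEl.mkIso (O.incl P O.unit ≫ (κ • O.rightMap P))
    (κ⁻¹ • ((ρ_ P.X).inv ≫ P.X ◁ O.unitMap ≫ O.proj P O.unit))
    (by
      rw [Linear.comp_smul, Linear.comp_smul, Linear.smul_comp, smul_smul, inv_mul_cancel₀ hκ,
        one_smul, Category.assoc, O.rightMap_unitMap P hΓ hs, incl_proj])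
    (by
      rw [Linear.smul_comp, Linear.comp_smul, Linear.comp_smul, smul_smul, inv_mul_cancel₀ hκ,
        one_smul, Category.assoc, Category.assoc,
        O.proj_incl_comp hD (O.rightMap_left P hs) (O.rightMap_right P hΓ hs),
        O.unitMap_rightMap P hs, Iso.inv_hom_id])
    ((O.incl_right P O.unit hs).comp ((O.rightMap_right P hΓ hs).smul κ))
    ((O.incl_tensor P O.unit hs).comp ((O.rightMap_tensor P hs).smul κ))

end Unitors

/-- The morphisms of the tensor structure. -/
def morphisms (hΓ : ∀ A, cross O.unit₁ A = gamma Xs s A) (hs : ∀ j, s j ≠ 0)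
    (hD : globalDim k Xs ≠ 0) {κ : k} (hκ : κ ≠ 0) : TensorMorphisms O κ where
  hom := O.tensorHom hs
  hom_f _ _ := rfl
  assoc P R V := O.associator P R V hs hD
  assoc_f _ _ _ := Category.assoc _ _ _
  leftUnit P := O.leftUnitor P hΓ hs hD hκ
  leftUnit_f _ := rfl
  rightUnit P := O.rightUnitor P hΓ hs hD hκ
  rightUnit_f _ := rfl

theorem leftUnitor_naturality (hΓ : ∀ A, cross O.unit₁ A = gamma Xs s A) (hs : ∀ j, s j ≠ 0)
    (hD : globalDim k Xs ≠ 0) {κ : k} (hκ : κ ≠ 0) {P P' : ZEl C} (f : P ⟶ P') :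
    O.tensorHom hs (𝟙 O.unit) f ≫ (O.leftUnitor P' hΓ hs hD hκ).hom =
      (O.leftUnitor P hΓ hs hD hκ).hom ≫ f := by
  apply ZEl.hom_ext
  have h : O.unit.X ◁ f.f ≫ O.leftMap P' = O.leftMap P ≫ f.f :=
    leftUnitMap_naturality Xs hs f.comm₁
  change (O.tensorHom hs (𝟙 O.unit) f).f ≫ O.incl O.unit P' ≫ (κ • O.leftMap P') =
    (O.incl O.unit P ≫ (κ • O.leftMap P)) ≫ f.f
  rw [O.tensorHom_incl_assoc hs hD, Linear.comp_smul, Linear.comp_smul, Linear.comp_smul,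
    Linear.smul_comp, Category.assoc, ← h, ZEl.id_f, MonoidalCategory.id_tensorHom]

theorem rightUnitor_naturality (hΓ : ∀ A, cross O.unit₁ A = gamma Xs s A) (hs : ∀ j, s j ≠ 0)
    (hD : globalDim k Xs ≠ 0) {κ : k} (hκ : κ ≠ 0) {P P' : ZEl C} (f : P ⟶ P') :
    O.tensorHom hs f (𝟙 O.unit) ≫ (O.rightUnitor P' hΓ hs hD hκ).hom =
      (O.rightUnitor P hΓ hs hD hκ).hom ≫ f := by
  apply ZEl.hom_ext
  have h : f.f ▷ O.unit.X ≫ O.rightMap P' = O.rightMap P ≫ f.f :=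
    rightUnitMap_naturality Xs hs f.comm₁
  change (O.tensorHom hs f (𝟙 O.unit)).f ≫ O.incl P' O.unit ≫ (κ • O.rightMap P') =
    (O.incl P O.unit ≫ (κ • O.rightMap P)) ≫ f.f
  rw [O.tensorHom_incl_assoc hs hD, Linear.comp_smul, Linear.comp_smul, Linear.comp_smul,
    Linear.smul_comp, Category.assoc, ← h, ZEl.id_f, MonoidalCategory.tensorHom_id]

theorem triangle (hΓ : ∀ A, cross O.unit₁ A = gamma Xs s A) (hs : ∀ j, s j ≠ 0)
    (hD : globalDim k Xs ≠ 0) {κ : k} (hκ : κ ≠ 0) (P R : ZEl C) :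
    (O.associator P O.unit R hs hD).hom ≫
        O.tensorHom hs (𝟙 P) (O.leftUnitor R hΓ hs hD hκ).hom =
      O.tensorHom hs (O.rightUnitor P hΓ hs hD hκ).hom (𝟙 R) := by
  apply ZEl.hom_ext
  change O.assocMap P O.unit R ≫ O.incl P (O.tensor O.unit R) ≫
      (𝟙 P.X ⊗ₘ (O.incl O.unit R ≫ (κ • O.leftMap R))) ≫ O.proj P R =
    O.incl (O.tensor P O.unit) R ≫
      ((O.incl P O.unit ≫ (κ • O.rightMap P)) ⊗ₘ 𝟙 R.X) ≫ O.proj P R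
  have h : O.rightMap P ▷ R.X ≫ O.proj P R =
      (α_ P.X O.unit.X R.X).hom ≫ P.X ◁ O.leftMap R ≫ O.proj P R :=
    rightUnitMap_leftUnitMap Xs hs (O.proj P R) (O.proj_agree hs P R)
  have h2 := O.assocMap_inclR P O.unit R hs hD
  rw [inclR] at h2
  rw [MonoidalCategory.id_tensorHom, MonoidalCategory.tensorHom_id,
    MonoidalCategory.whiskerLeft_comp, comp_whiskerRight, Category.assoc, Category.assoc,
    reassoc_of% h2, inclL, Category.assoc]
  simp only [MonoidalLinear.whiskerLeft_smul, MonoidalLinear.smul_whiskerRight, Linear.comp_smul,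
    Linear.smul_comp, h]

/-- The monoidal structure. -/
theorem exists_monoidal (hΓ : ∀ A, cross O.unit₁ A = gamma Xs s A) (hs : ∀ j, s j ≠ 0)
    (hD : globalDim k Xs ≠ 0) {κ : k} (hκ : κ ≠ 0) :
    ∃ (M : TensorMorphisms O κ) (𝓜 : MonoidalCategory (ZEl C)),
      𝓜.toMonoidalCategoryStruct = M.toStruct := by
  refine ⟨O.morphisms hΓ hs hD hκ, @MonoidalCategory.mk _ _ (O.morphisms hΓ hs hD hκ).toStruct
    ?_ ?_ ?_ ?_ ?_ ?_ ?_ ?_ ?_ ?_, rfl⟩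
  · intro P P' R R' f g
    change O.tensorHom hs f g = O.tensorHom hs f (𝟙 R) ≫ O.tensorHom hs (𝟙 P') g
    rw [O.tensorHom_comp hs hD, Category.comp_id, Category.id_comp]
  · exact O.tensorHom_id hs
  · intros; exact O.tensorHom_comp hs hD _ _ _ _
  · exact O.tensorHom_id hs
  · exact O.tensorHom_id hs
  · intros; exact O.associator_naturality hs hD _ _ _
  · intros; exact O.leftUnitor_naturality hΓ hs hD hκ _
  · intros; exact O.rightUnitor_naturality hΓ hs hD hκ _
  · exact O.pentagon hs hD
  · exact O.triangle hΓ hs hD hκ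

end TensorObjects

/-- COMM for a reduced product is inherited from `X ⊗ Y` along the split inclusion; there it is COMM
on `X` followed by sliding a braiding on `Y`. The equality with `gamma` is kept because the unit
constraints use this description of `Γ`. -/
theorem exists_tensorObjects (hs : ∀ j, s j ≠ 0)
    (T : ∀ P R : ZEl C, ReducedTensor k Xs P.hb₁ R.hb₁) (hΓ : IsGamma k Xs s (gammaHB Xs hs)) :
    ∃ O : TensorObjects k Xs s T, ∀ A, cross O.unit₁ A = gamma Xs s A := by
  have h₁ : ∀ P R : ZEl C, ∃ n : HalfBraiding (T P R).I, ∀ A, cross n A =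
      A ◁ (T P R).ι ≫ cross (hbLeft P.hb₁ R.X) A ≫ (T P R).π ▷ A := fun P R =>
    exists_restriction ((T P R).π_ι_left hs) (T P R).ι_π
  have h₂ : ∀ P R : ZEl C, ∃ n : HalfBraiding (T P R).I, ∀ A, cross n A =
      A ◁ (T P R).ι ≫ cross (hbTensor P.hb₂ R.hb₂) A ≫ (T P R).π ▷ A := fun P R =>
    exists_restriction ((T P R).π_ι_tensor hs P.comm R.comm) (T P R).ι_π
  choose n₁ hn₁ using h₁
  choose n₂ hn₂ using h₂
  refine ⟨⟨n₁, fun P R A => ?_, fun P R A => ?_, n₂, fun P R A => ?_, fun P R => ?_,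
    gammaHB Xs hs, hΓ, omegaHB Xs hs, fun A => rfl, comm_gamma_omega Xs hs⟩, fun A => rfl⟩
  · rw [hn₁, cross_hbLeft]
  · have h := (T P R).agree_ι hs A
    rw [hn₁, ← Category.assoc, h, Category.assoc, cross_hbRight]
  · rw [hn₂, cross_hbTensor, crossTensor]
  · rw [comm_iff]
    intro B
    exact ExchAt.of_mono (((comm_iff _ _).1 P.comm B).tensor (exchAt_hbPos_left R.hb₂ B))
      (T P R).ι_π (intertwines_inclusion ((T P R).π_ι_left hs) (T P R).ι_π (hn₁ P R))
      (intertwines_inclusion ((T P R).π_ι_tensor hs P.comm R.comm) (T P R).ι_π (hn₂ P R))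

end UnitConstraints

/-! ### The dual-basis formula for `Γ`. -/

section Rotation

variable {C : Type u} [Category.{v} C] [MonoidalCategory C] [BraidedCategory C]
  [RightRigidCategory C] [RibbonCategory C]

/-- The map `S^* ⟶ T^* ⊗ A` corresponding to `q : T ⟶ A ⊗ S`. -/
def rotate {A S T : C} (q : T ⟶ A ⊗ S) : Sᘁ ⟶ Tᘁ ⊗ A :=
  𝟙 _ ⊗≫ Sᘁ ◁ coevTilde A ⊗≫ mate ((Sᘁ ⊗ Aᘁ) ◁ q ≫ nest (ε_ A (Aᘁ)) (ε_ S (Sᘁ))) ▷ A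

/-- The property that determines `rotate q`: `tilde_nest` opens the nested pairing, and the created
strand `A` straightens. It gives both the inverse of `rotate` and the identification of `pairing`
with a trace. -/
theorem rotate_evTilde {A S T : C} (q : T ⟶ A ⊗ S) :
    T ◁ rotate q ⊗≫ evTilde T ▷ A = q ▷ Sᘁ ⊗≫ A ◁ evTilde S ⊗≫ 𝟙 _ := by
  have h : T ◁ mate ((Sᘁ ⊗ Aᘁ) ◁ q ≫ nest (ε_ A (Aᘁ)) (ε_ S (Sᘁ))) ≫ evTilde T =
      q ▷ (Sᘁ ⊗ Aᘁ) ⊗≫ A ◁ evTilde S ▷ Aᘁ ⊗≫ evTilde A := by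
    rw [evTilde_eq, whiskerLeft_tilde, mate_ev, ← whiskerRight_tilde, tilde_nest, evTilde_eq,
      evTilde_eq]
    monoidal
  rw [rotate]
  calc
    _ = 𝟙 _ ⊗≫ T ◁ Sᘁ ◁ coevTilde A ⊗≫ (T ◁ mate ((Sᘁ ⊗ Aᘁ) ◁ q ≫
        nest (ε_ A (Aᘁ)) (ε_ S (Sᘁ))) ≫ evTilde T) ▷ A ⊗≫ 𝟙 _ := by monoidal
    _ = 𝟙 _ ⊗≫ ((T ⊗ Sᘁ) ◁ coevTilde A ≫ (q ▷ Sᘁ ⊗≫ A ◁ evTilde S ⊗≫ 𝟙 A) ▷ (Aᘁ ⊗ A)) ⊗≫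
        evTilde A ▷ A ⊗≫ 𝟙 _ := by rw [h]; monoidal
    _ = 𝟙 _ ⊗≫ (q ▷ Sᘁ ⊗≫ A ◁ evTilde S ⊗≫ 𝟙 A) ⊗≫ (A ◁ coevTilde A ⊗≫ evTilde A ▷ A) ⊗≫
        𝟙 _ := by rw [whisker_exchange]; monoidal
    _ = _ := by rw [coevTilde_evTilde]; monoidal

/-- The inverse of `rotate`. -/
def unrotate {A S T : C} (r : Sᘁ ⟶ Tᘁ ⊗ A) : T ⟶ A ⊗ S :=
  𝟙 _ ⊗≫ T ◁ coevTilde S ⊗≫ (T ◁ r ⊗≫ evTilde T ▷ A) ▷ S ⊗≫ 𝟙 _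

theorem unrotate_rotate {A S T : C} (q : T ⟶ A ⊗ S) : unrotate (rotate q) = q := by
  rw [unrotate, rotate_evTilde]
  calc
    _ = 𝟙 _ ⊗≫ (T ◁ coevTilde S ≫ q ▷ (Sᘁ ⊗ S)) ⊗≫ A ◁ evTilde S ▷ S ⊗≫ 𝟙 _ := by monoidal
    _ = q ⊗≫ A ◁ (S ◁ coevTilde S ⊗≫ evTilde S ▷ S) ⊗≫ 𝟙 _ := by
      rw [whisker_exchange]; monoidal
    _ = _ := by rw [coevTilde_evTilde]; monoidal

theorem rotate_unrotate {A S T : C} (r : Sᘁ ⟶ Tᘁ ⊗ A) : rotate (unrotate r) = r := by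
  have h1 : ∀ r' : Sᘁ ⟶ Tᘁ ⊗ A,
      𝟙 _ ⊗≫ coevTilde T ▷ Sᘁ ⊗≫ Tᘁ ◁ (T ◁ r' ⊗≫ evTilde T ▷ A) ⊗≫ 𝟙 _ = r' := by
    intro r'
    calc
      _ = 𝟙 _ ⊗≫ (coevTilde T ▷ Sᘁ ≫ (Tᘁ ⊗ T) ◁ r') ⊗≫ Tᘁ ◁ evTilde T ▷ A ⊗≫ 𝟙 _ := by monoidal
      _ = r' ⊗≫ (coevTilde T ▷ Tᘁ ⊗≫ Tᘁ ◁ evTilde T) ▷ A ⊗≫ 𝟙 _ := by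
        rw [← whisker_exchange]; monoidal
      _ = _ := by rw [evTilde_coevTilde]; monoidal
  have h2 : T ◁ rotate (unrotate r) ⊗≫ evTilde T ▷ A = T ◁ r ⊗≫ evTilde T ▷ A := by
    rw [rotate_evTilde, unrotate]
    calc
      _ = 𝟙 _ ⊗≫ T ◁ coevTilde S ▷ Sᘁ ⊗≫ ((T ◁ r ⊗≫ evTilde T ▷ A) ▷ (S ⊗ Sᘁ) ≫
          ((𝟙_ C) ⊗ A) ◁ evTilde S) ⊗≫ 𝟙 _ := by monoidal
      _ = 𝟙 _ ⊗≫ T ◁ (coevTilde S ▷ Sᘁ ⊗≫ Sᘁ ◁ evTilde S) ⊗≫ T ◁ r ⊗≫ evTilde T ▷ A ⊗≫ 𝟙 _ := by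
        rw [← whisker_exchange]; monoidal
      _ = _ := by rw [evTilde_coevTilde]; monoidal
  rw [← h1 (rotate (unrotate r)), h2, h1]

theorem trace_rotate_eq {A S T : C} (p : A ⊗ S ⟶ T) (q : T ⟶ A ⊗ S) :
    trace (𝟙 A ⊗≫ A ◁ η_ S (Sᘁ) ⊗≫ (p ⊗ₘ rotate q) ⊗≫ evTilde T ▷ A ⊗≫ 𝟙 A) =
      trace (q ≫ p) := by
  rw [← trace_partialTrace, partialTrace, MonoidalCategory.tensorHom_def]
  congr 1
  calc
    _ = 𝟙 _ ⊗≫ A ◁ η_ S (Sᘁ) ⊗≫ p ▷ Sᘁ ⊗≫ (T ◁ rotate q ⊗≫ evTilde T ▷ A) ⊗≫ 𝟙 _ := by monoidal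
    _ = _ := by rw [rotate_evTilde]; monoidal

theorem whiskerLeft_coevTilde_mate {A S T U : C} (p : A ⊗ S ⟶ T) (q : T ⟶ A ⊗ S)
    (f : T ⊗ Tᘁ ⟶ U) :
    𝟙 _ ⊗≫ (A ⊗ S ⊗ Sᘁ) ◁ coevTilde A ⊗≫ ((p ▷ (Sᘁ ⊗ Aᘁ) ≫
        T ◁ mate ((Sᘁ ⊗ Aᘁ) ◁ q ≫ nest (ε_ A (Aᘁ)) (ε_ S (Sᘁ)))) ≫ f) ▷ A =
      (𝟙 (A ⊗ (S ⊗ Sᘁ)) ⊗≫ (p ⊗ₘ rotate q) ⊗≫ 𝟙 _) ≫ f ▷ A := by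
  rw [rotate, MonoidalCategory.tensorHom_def]
  calc
    _ = 𝟙 _ ⊗≫ ((A ⊗ S) ◁ (Sᘁ ◁ coevTilde A) ≫ p ▷ (Sᘁ ⊗ Aᘁ ⊗ A)) ⊗≫
        T ◁ mate ((Sᘁ ⊗ Aᘁ) ◁ q ≫ nest (ε_ A (Aᘁ)) (ε_ S (Sᘁ))) ▷ A ⊗≫ f ▷ A := by monoidal
    _ = _ := by rw [whisker_exchange]; monoidal

end Rotation

section DualBases

variable {k : Type w} [Field k] [IsAlgClosed k]
  {C : Type u} [Category.{v} C] [Abelian C] [Linear k C] [MonoidalCategory C]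
  [MonoidalPreadditive C] [MonoidalLinear k C] [BraidedCategory C]
  [RightRigidCategory C] [RibbonCategory C] [IsFusion k C]
  {J : Type x} [Fintype J] (Xs : SimpleReps C J) {s : J → k}

variable (k) in
/-- The linear equivalence given by `rotate`. -/
def rotateEquiv (A S T : C) : (T ⟶ A ⊗ S) ≃ₗ[k] (Sᘁ ⟶ Tᘁ ⊗ A) where
  toFun := rotate
  invFun := unrotate
  left_inv := unrotate_rotate
  right_inv := rotate_unrotate
  map_add' q q' := by
    simp only [rotate, MonoidalPreadditive.whiskerLeft_add, Preadditive.add_comp, mate_add, MonoidalPreadditive.add_whiskerRight,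
      monoidalComp, Preadditive.comp_add]
  map_smul' c q := by
    simp only [rotate, MonoidalLinear.whiskerLeft_smul, Linear.smul_comp, mate_smul,
      MonoidalLinear.smul_whiskerRight, monoidalComp, Linear.comp_smul, RingHom.id_apply]

theorem pairing_rotate {A S T : C} (p : A ⊗ S ⟶ T) (q : T ⟶ A ⊗ S) :
    pairing k p (rotate q) = scalar k (trace (q ≫ p)) := by
  rw [pairing, trace_rotate_eq]

/-- The dual bases obtained from a decomposition of `A ⊗ X_i`. -/
theorem Decomp.isDualBasisSum {A S : C} (D : Decomp Xs (A ⊗ S)) (j : J) :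
    IsDualBasisSum k (𝟙 (A ⊗ (S ⊗ Sᘁ)) ⊗≫ (∑ a, (D.p j a ⊗ₘ
      (dim k (Xs.obj j))⁻¹ • rotate (D.q j a))) ⊗≫ 𝟙 ((Xs.obj j ⊗ (Xs.obj j)ᘁ) ⊗ A)) := by
  have hd := dim_ne_zero k Xs j
  -- `rotate` turns the pairing of `p_a` and `q_b` into the trace of `q_b ≫ p_a`, which is `d_j`
  -- when `a = b`; hence the factor `d_j⁻¹`.
  refine ⟨D.n j, D.basisP k j, (D.basisQ k j).map ((rotateEquiv k A S (Xs.obj j)).trans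
    (LinearEquiv.smulOfNeZero k _ _ (inv_ne_zero hd))), fun a b => ?_, ?_⟩
  · have h : ((D.basisQ k j).map ((rotateEquiv k A S (Xs.obj j)).trans
        (LinearEquiv.smulOfNeZero k _ _ (inv_ne_zero hd)))) b =
        rotateEquiv k A S (Xs.obj j) ((dim k (Xs.obj j))⁻¹ • D.q j b) := by
      rw [Module.Basis.map_apply, D.basisQ_apply k, map_smul]; rfl
    rw [h, D.basisP_apply k]
    change pairing k _ (rotate _) = _
    rw [pairing_rotate, Linear.smul_comp, D.orth]
    by_cases hab : a = b
    · rw [if_pos hab, if_pos hab.symm, trace_smul, trace_id k, smul_smul, inv_mul_cancel₀ hd,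
        scalar_smul_id]
    · rw [if_neg hab, if_neg (Ne.symm hab), smul_zero, ← zero_smul k (𝟙 _), trace_smul, zero_smul,
        ← zero_smul k (𝟙 _), scalar_smul_id]
  · congr 2
    refine Finset.sum_congr rfl fun a _ => ?_
    rw [D.basisP_apply k, Module.Basis.map_apply, D.basisQ_apply k]
    rfl

theorem isGamma_gammaHB (hs : ∀ j, s j ≠ 0) (hs2 : ∀ j, s j ^ 2 = dim k (Xs.obj j)) :
    IsGamma k Xs s (gammaHB Xs hs) := by
  intro A
  refine ⟨fun i j => _, fun i j => (dec k Xs (A ⊗ Xs.obj i)).isDualBasisSum Xs j, ?_⟩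
  change gamma Xs s A = _
  rw [gamma, Dinatural.desc]
  refine Finset.sum_congr rfl fun i _ => ?_
  change s i • (A ◁ unitπ Xs i ≫ gammaApp Xs s (twistedDual A) _) = _
  simp only [mul_smul, ← Finset.smul_sum]
  congr 1
  simp only [← Linear.comp_smul, ← Preadditive.comp_sum]
  congr 1
  rw [gammaApp, inc]
  simp only [monoidalComp, sum_whiskerRight, Preadditive.comp_sum, Preadditive.sum_comp,
    Finset.smul_sum, MonoidalLinear.smul_whiskerRight, Linear.comp_smul]
  refine Finset.sum_congr rfl fun j _ => Finset.sum_congr rfl fun a _ => ?_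
  have h := whiskerLeft_coevTilde_mate ((dec k Xs (A ⊗ Xs.obj i)).p j a)
    ((dec k Xs (A ⊗ Xs.obj i)).q j a) (unitι Xs j)
  refine (congrArg ((s j)⁻¹ • ·) h).trans ?_
  -- Here `s j` is a square root of `d_j`: the factor `(s j)⁻¹` from `inc` is the weight `s j` times
  -- the `d_j⁻¹` of the dual basis. The other weight `s i` comes from `Dinatural.desc`.
  have hc : s j * (dim k (Xs.obj j))⁻¹ = (s j)⁻¹ := by
    rw [← hs2 j, pow_two, mul_inv, mul_inv_cancel_left₀ (hs j)]
  simp only [monoidalComp, MonoidalCategory.tensorHom_def, MonoidalLinear.whiskerLeft_smul,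
    Linear.comp_smul, Linear.smul_comp, smul_smul, hc]

end DualBases

end EllipticCenter

end

theorem mainTheorem3 {k : Type w} [Field k] [IsAlgClosed k] [CharZero k]
    {C : Type u} [Category.{v} C] [Abelian C] [Linear k C] [MonoidalCategory C]
    [MonoidalPreadditive C] [MonoidalLinear k C] [BraidedCategory C] [RightRigidCategory C]
    [EllipticCenter.RibbonCategory C] [EllipticCenter.IsFusion k C]
    {J : Type x} [Fintype J] (Xs : EllipticCenter.SimpleReps C J)
    (hD : EllipticCenter.globalDim k Xs ≠ 0)
    (s : J → k) (hs : ∀ j, s j ^ 2 = EllipticCenter.dim k (Xs.obj j)) :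
    (∀ {X Y : C} (l : HalfBraiding X) (m : HalfBraiding Y),
      EllipticCenter.Q k Xs l m ≫ EllipticCenter.Q k Xs l m = EllipticCenter.Q k Xs l m ∧
      Nonempty (EllipticCenter.ReducedTensor k Xs l m)) ∧
    ∀ (T : ∀ P R : EllipticCenter.ZEl C, EllipticCenter.ReducedTensor k Xs P.hb₁ R.hb₁)
      (κ : k), κ ≠ 0 →
      ∃ (O : EllipticCenter.TensorObjects k Xs s T) (M : EllipticCenter.TensorMorphisms O κ)
        (𝓜 : MonoidalCategory (EllipticCenter.ZEl C)),
        𝓜.toMonoidalCategoryStruct = M.toStruct := by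
  have hs0 : ∀ j, s j ≠ 0 := fun j h =>
    EllipticCenter.dim_ne_zero k Xs j (by rw [← hs j, h, zero_pow two_ne_zero])
  refine ⟨fun l m => ⟨EllipticCenter.Q_idem Xs hs0 hD l m,
    EllipticCenter.nonempty_reducedTensor Xs hs0 hD l m⟩, fun T κ hκ => ?_⟩
  obtain ⟨O, hO⟩ := EllipticCenter.exists_tensorObjects hs0 T
    (EllipticCenter.isGamma_gammaHB Xs hs0 hs)
  obtain ⟨M, 𝓜, h⟩ := O.exists_monoidal hO hs0 hD hκ
  exact ⟨O, M, 𝓜, h⟩
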